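/- Let $G$ be either the unitary group $U(H)$ of a finite dimensional complex Hilbert space $H$, or, for an infinite dimensional separable complex Hilbert space $H$ and a real number $1\le p\le 2$, the Banach Lie group $U_p(H)$ of unitary operators on $H$ that differ from the identity by an element of the Schatten ideal $\mathcal L_p(H)$. For $z_1,z_2\in U(1)\setminus\{1\}$ write $z_1>z_2$ if $z_2$ can be rotated counter-clockwise into $z_1$ without passing through $1$. Let $$Y^{[2]}_+=\{(z_1,z_2,g): z_1,z_2\in U(1)\setminus\{1\},\ g\in G,\ z_1,z_2\notin\operatorname{spec}(g),\ z_1>z_2,\ g\text{ has an eigenvalue }\lambda\text{ with }z_1>\lambda>z_2\},$$ an open subset of $U(1)\times U(1)\times G$. For $(z_1,z_2,g)\in Y^{[2]}_+$ let $E_{(z_1,z_2,g)}\subset H$ be the (finite dimensional) sum of the eigenspaces of $g$ for the eigenvalues $\lambda$ with $z_1>\lambda>z_2$, and let $P=P_{(z_1,z_2,g)}$ be the orthogonal projection of $H$ onto it. Then $P$ is smooth and $E$ is a smooth vector bundle over $Y^{[2]}_+$. Let $\nabla=P\circ d$ be the connection on $E$ obtained by projecting the trivial connection on $H\times Y^{[2]}_+$,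 let $\det(\nabla)$ be the induced connection on the line bundle $L=\det E$ (the top exterior power of $E$), and let $F_{\det(\nabla)}$ be its curvature two-form. Let $(z_1,z_2,g)\in Y^{[2]}_+$, and let $C$ be a piecewise continuously differentiable closed contour in $\mathbb C\setminus\operatorname{spec}(g)$ that encloses, once and counter-clockwise, all the eigenvalues $\lambda$ of $g$ with $z_1>\lambda>z_2$, and no other point of $\operatorname{spec}(g)$ (that is, $C$ has winding number $1$ about the former and $0$ about all other points of the spectrum). Then at $(z_1,z_2,g)$ $$F_{\det(\nabla)}=\operatorname{tr}(P\,dP\,dP)=\frac1{4\pi i}\oint_{C}\operatorname{tr}\bigl((\xi-g)^{-1}dg\,(\xi-g)^{-2}dg\bigr)\,d\xi ,$$ where $dg$ denotes the derivative at $(z_1,z_2,g)$ of the projection $(z_1,z_2,g)\mapsto g$, and products of one-forms are wedge products. In particular the operator valued two-forms $P\,dP\,dP$ and $(\xi-g)^{-1}dg\,(\xi-g)^{-2}dg$, for $\xi\notin\operatorname{spec}(g)$, take values in the trace class operators. -/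

import Mathlib

open scoped ContDiff Topology

noncomputable section

/-! ### Schatten classes -/

section Schatten

variable {H : Type*} [NormedAddCommGroup H] [InnerProductSpace ℂ H]

/-- The numbers `(∑ᵢ |⟨fᵢ, A eᵢ⟩|^p)^(1/p)`, for finite orthonormal families `e`, `f` of the same
length. For `1 ≤ p < ∞` their supremum is the Schatten `p`-norm `(∑ₙ sₙ(A)^p)^(1/p)` of `A`,
`sₙ(A)` being the singular values; it is finite exactly if `A` is compact with `p`-summable
singular values. -/
def schattenSums (p : ℝ) (A : H →L[ℂ] H) : Set ℝ :=
  {r | ∃ (n : ℕ) (e f : Fin n → H), Orthonormal ℂ e ∧ Orthonormal ℂ f ∧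
    r = (∑ i, ‖inner ℂ (f i) (A (e i))‖ ^ p) ^ (1 / p)}

/-- `A` belongs to the Schatten ideal `𝓛_p(H)`, `1 ≤ p < ∞`. -/
def IsSchatten (p : ℝ) (A : H →L[ℂ] H) : Prop := BddAbove (schattenSums p A)

/-- The Schatten `p`-norm. -/
def schattenNorm (p : ℝ) (A : H →L[ℂ] H) : ℝ := sSup (schattenSums p A)

/-- Trace class operators: the Schatten ideal with `p = 1`. -/
def IsTraceClass (A : H →L[ℂ] H) : Prop := IsSchatten 1 A

theorem schattenSums_nonneg {p : ℝ} {A : H →L[ℂ] H} {r : ℝ} (hr : r ∈ schattenSums p A) :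
    0 ≤ r := by
  obtain ⟨n, e, f, -, -, rfl⟩ := hr
  positivity

theorem schattenNorm_nonneg (p : ℝ) (A : H →L[ℂ] H) : 0 ≤ schattenNorm p A :=
  Real.sSup_nonneg fun _ hr => schattenSums_nonneg hr

theorem schattenSums_nonempty (p : ℝ) (A : H →L[ℂ] H) : (schattenSums p A).Nonempty :=
  ⟨_, 0, Fin.elim0, Fin.elim0, ⟨fun i => i.elim0, fun i => i.elim0⟩,
    ⟨fun i => i.elim0, fun i => i.elim0⟩, rfl⟩

theorem schattenSums_add_le {p : ℝ} (hp : 1 ≤ p) {A B : H →L[ℂ] H} (hA : IsSchatten p A)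
    (hB : IsSchatten p B) {r : ℝ} (hr : r ∈ schattenSums p (A + B)) :
    r ≤ schattenNorm p A + schattenNorm p B := by
  obtain ⟨n, e, f, he, hf, rfl⟩ := hr
  have h1 : (∑ i, ‖inner ℂ (f i) ((A + B) (e i))‖ ^ p) ^ (1 / p) ≤
      (∑ i, |‖inner ℂ (f i) (A (e i))‖ + ‖inner ℂ (f i) (B (e i))‖| ^ p) ^ (1 / p) := by
    refine Real.rpow_le_rpow (by positivity) (Finset.sum_le_sum fun i _ => ?_) (by positivity)
    refine Real.rpow_le_rpow (norm_nonneg _) ?_ (by positivity)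
    rw [add_apply, inner_add_right]
    exact (norm_add_le _ _).trans (le_abs_self _)
  refine h1.trans ((Real.Lp_add_le _ _ _ hp).trans (add_le_add ?_ ?_))
  · simp only [abs_norm]
    exact le_csSup hA ⟨n, e, f, he, hf, rfl⟩
  · simp only [abs_norm]
    exact le_csSup hB ⟨n, e, f, he, hf, rfl⟩

theorem schattenSums_smul {p : ℝ} (hp : 1 ≤ p) (c : ℂ) {A : H →L[ℂ] H} {r : ℝ}
    (hr : r ∈ schattenSums p (c • A)) : ∃ s ∈ schattenSums p A, r = ‖c‖ * s := by
  obtain ⟨n, e, f, he, hf, rfl⟩ := hr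
  refine ⟨_, ⟨n, e, f, he, hf, rfl⟩, ?_⟩
  have hp0 : p ≠ 0 := by positivity
  have h : ∀ i, ‖inner ℂ (f i) ((c • A) (e i))‖ ^ p =
      ‖c‖ ^ p * ‖inner ℂ (f i) (A (e i))‖ ^ p := fun i => by
    rw [smul_apply, inner_smul_right, norm_mul,
      Real.mul_rpow (norm_nonneg _) (norm_nonneg _)]
  simp_rw [h]
  rw [← Finset.mul_sum, Real.mul_rpow (by positivity) (by positivity), one_div,
    Real.rpow_rpow_inv (norm_nonneg _) hp0]

theorem schattenNorm_smul_le {p : ℝ} (hp : 1 ≤ p) (c : ℂ) {A : H →L[ℂ] H}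
    (hA : IsSchatten p A) : schattenNorm p (c • A) ≤ ‖c‖ * schattenNorm p A := by
  refine csSup_le (schattenSums_nonempty _ _) fun r hr => ?_
  obtain ⟨s, hs, rfl⟩ := schattenSums_smul hp c hr
  exact mul_le_mul_of_nonneg_left (le_csSup hA hs) (norm_nonneg _)

theorem opNorm_le_schattenNorm {p : ℝ} (hp : 1 ≤ p) {A : H →L[ℂ] H} (hA : IsSchatten p A) :
    ‖A‖ ≤ schattenNorm p A := by
  have hp0 : p ≠ 0 := by positivity
  refine A.opNorm_le_of_unit_norm (𝕜 := ℂ) (schattenNorm_nonneg p A) fun x hx => ?_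
  by_cases h0 : A x = 0
  · rw [h0, norm_zero]; exact schattenNorm_nonneg p A
  have hn : ‖A x‖ ≠ 0 := norm_ne_zero_iff.2 h0
  have honb : ∀ y : H, ‖y‖ = 1 → Orthonormal ℂ (fun _ : Fin 1 => y) := fun y hy =>
    ⟨fun _ => hy, fun i j hij => absurd (Subsingleton.elim i j) hij⟩
  refine le_csSup hA ⟨1, fun _ => x, fun _ => ((‖A x‖⁻¹ : ℝ) : ℂ) • A x, honb x hx, honb _ ?_, ?_⟩
  · rw [norm_smul]; simp [hn]
  · rw [Fin.sum_univ_one, one_div, Real.rpow_rpow_inv (norm_nonneg _) hp0, inner_smul_left,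
      inner_self_eq_norm_sq_to_K, norm_mul]
    simp
    field_simp

variable (H) in
/-- The Schatten ideal `𝓛_p(H)` as a complex subspace of `B(H)`. -/
def schattenSubmodule (p : ℝ) [hp : Fact (1 ≤ p)] : Submodule ℂ (H →L[ℂ] H) where
  carrier := {A | IsSchatten p A}
  zero_mem' := by
    have hp0 : p ≠ 0 := by have := hp.out; positivity
    refine ⟨0, ?_⟩
    rintro r ⟨n, e, f, -, -, rfl⟩
    simp [Real.zero_rpow, hp0]
  add_mem' := fun hA hB => ⟨_, fun _ hr => schattenSums_add_le hp.out hA hB hr⟩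
  smul_mem' := fun c A hA => ⟨‖c‖ * schattenNorm p A, fun r hr => by
    obtain ⟨s, hs, rfl⟩ := schattenSums_smul hp.out c hr
    exact mul_le_mul_of_nonneg_left (le_csSup hA hs) (norm_nonneg _)⟩

variable (H) in
/-- The Schatten ideal `𝓛_p(H)`, as a type that carries the Schatten `p`-norm. -/
def SchattenClass (p : ℝ) [Fact (1 ≤ p)] : Type _ := schattenSubmodule H p

variable (p : ℝ) [hp : Fact (1 ≤ p)]

instance : AddCommGroup (SchattenClass H p) :=
  inferInstanceAs (AddCommGroup (schattenSubmodule H p))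

instance : Module ℂ (SchattenClass H p) :=
  inferInstanceAs (Module ℂ (schattenSubmodule H p))

/-- The underlying bounded operator of an element of `𝓛_p(H)`. -/
def SchattenClass.toOp : SchattenClass H p →ₗ[ℂ] (H →L[ℂ] H) := (schattenSubmodule H p).subtype

instance : Norm (SchattenClass H p) := ⟨fun A => schattenNorm p (SchattenClass.toOp p A)⟩

theorem SchattenClass.isSchatten (A : SchattenClass H p) :
    IsSchatten p (SchattenClass.toOp p A) := A.2

theorem SchattenClass.core : NormedSpace.Core ℂ (SchattenClass H p) where
  norm_nonneg A := schattenNorm_nonneg p _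
  norm_smul c A := by
    change schattenNorm p (SchattenClass.toOp p (c • A)) =
      ‖c‖ * schattenNorm p (SchattenClass.toOp p A)
    rw [map_smul]
    have hA := SchattenClass.isSchatten p A
    refine le_antisymm (schattenNorm_smul_le hp.out c hA) ?_
    by_cases hc : c = 0
    · rw [hc, norm_zero, zero_mul]; exact schattenNorm_nonneg _ _
    have hcA : IsSchatten p (c • SchattenClass.toOp p A) := (schattenSubmodule H p).smul_mem c hA
    have h := schattenNorm_smul_le hp.out c⁻¹ hcA
    rw [smul_smul, inv_mul_cancel₀ hc, one_smul, norm_inv] at h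
    have hc' : 0 < ‖c‖ := norm_pos_iff.2 hc
    calc ‖c‖ * schattenNorm p (SchattenClass.toOp p A)
        ≤ ‖c‖ * (‖c‖⁻¹ * schattenNorm p (c • SchattenClass.toOp p A)) :=
          mul_le_mul_of_nonneg_left h hc'.le
      _ = schattenNorm p (c • SchattenClass.toOp p A) := by field_simp
  norm_triangle A B := by
    change schattenNorm p (SchattenClass.toOp p (A + B)) ≤
      schattenNorm p (SchattenClass.toOp p A) + schattenNorm p (SchattenClass.toOp p B)
    rw [map_add]
    exact csSup_le (schattenSums_nonempty _ _) fun r hr =>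
      schattenSums_add_le hp.out (SchattenClass.isSchatten p A) (SchattenClass.isSchatten p B) hr
  norm_eq_zero_iff A := by
    have hA := opNorm_le_schattenNorm hp.out (SchattenClass.isSchatten p A)
    constructor
    · intro h
      change schattenNorm p (SchattenClass.toOp p A) = 0 at h
      rw [h] at hA
      exact Subtype.ext (norm_le_zero_iff.1 hA)
    · rintro rfl
      change schattenNorm p (SchattenClass.toOp p 0) = 0
      have h0 : IsSchatten p (0 : H →L[ℂ] H) := (schattenSubmodule H p).zero_mem
      have h := schattenNorm_smul_le hp.out (0 : ℂ) h0
      rw [smul_zero, norm_zero, zero_mul] at h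
      rw [map_zero]
      exact le_antisymm h (schattenNorm_nonneg _ _)

instance : NormedAddCommGroup (SchattenClass H p) :=
  NormedAddCommGroup.ofCore (SchattenClass.core p)

instance : NormedSpace ℂ (SchattenClass H p) :=
  NormedSpace.ofCore (SchattenClass.core p)

/-- The continuous inclusion of `𝓛_p(H)` into the bounded operators. -/
def SchattenClass.toOpL : SchattenClass H p →L[ℂ] (H →L[ℂ] H) :=
  (SchattenClass.toOp p).mkContinuous 1 fun A => by
    rw [one_mul]
    exact opNorm_le_schattenNorm hp.out (SchattenClass.isSchatten p A)

end Schatten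

/-! ### The groups `U(H)` and `U_p(H)` and their Lie algebras -/

section Groups

variable (H : Type*) [NormedAddCommGroup H] [InnerProductSpace ℂ H] [CompleteSpace H]

/-- The group `U_p(H)` of unitary operators that differ from the identity by an element of
`𝓛_p(H)`. -/
def schattenUnitary (p : ℝ) : Set (H →L[ℂ] H) :=
  {g | g ∈ unitary (H →L[ℂ] H) ∧ IsSchatten p (g - 1)}

/-- The Lie algebra of `U(H)`: skew-adjoint bounded operators, with the operator norm. -/
abbrev unitaryLie : Submodule ℝ (H →L[ℂ] H) := skewAdjoint.submodule ℝ (H →L[ℂ] H)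

/-- The Lie algebra of `U_p(H)`: skew-adjoint elements of `𝓛_p(H)`, with the Schatten norm. -/
def schattenLie (p : ℝ) [Fact (1 ≤ p)] : Submodule ℝ (SchattenClass H p) where
  carrier := {A | star (SchattenClass.toOp p A) = -SchattenClass.toOp p A}
  zero_mem' := by simp
  add_mem' := fun {A B} hA hB => by
    simp only [Set.mem_ofPred_eq] at *
    rw [map_add, star_add, hA, hB, neg_add]
  smul_mem' := fun c A hA => by
    simp only [Set.mem_ofPred_eq] at *
    have h : SchattenClass.toOp p (c • A) = c • SchattenClass.toOp p A :=
      map_smul ((SchattenClass.toOp p).restrictScalars ℝ) c A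
    rw [h, star_smul, hA, star_trivial, smul_neg]

/-- The inclusion of the Lie algebra of `U(H)` into `B(H)`. -/
def unitaryLieIncl : unitaryLie H →L[ℝ] (H →L[ℂ] H) := (unitaryLie H).subtypeL

/-- The inclusion of the Lie algebra of `U_p(H)` into `B(H)`. -/
def schattenLieIncl (p : ℝ) [Fact (1 ≤ p)] : schattenLie H p →L[ℝ] (H →L[ℂ] H) :=
  ((SchattenClass.toOpL p).restrictScalars ℝ).comp (schattenLie H p).subtypeL

end Groups

/-! ### The manifold `Y^{[2]}_+`, the bundles `E` and `L = det E`, and the connection -/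

section Gerbe

/-- `z₁ > z₂` on the unit circle without `1`: `z₂` can be rotated counter-clockwise into `z₁`
without passing through `1`. -/
def RotGT (z₁ z₂ : ℂ) : Prop :=
  ‖z₂‖ = 1 ∧ ∃ t : ℝ, 0 < t ∧ z₁ = Complex.exp (t * Complex.I) * z₂ ∧
    ∀ s ∈ Set.Icc (0 : ℝ) t, Complex.exp (s * Complex.I) * z₂ ≠ 1

variable {H : Type*} [NormedAddCommGroup H] [InnerProductSpace ℂ H] [CompleteSpace H]

/-- The conditions on `(z₁, z₂, g)`, apart from `g ∈ G`, that define `Y^{[2]}_+`: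
`z₁, z₂ ∈ U(1) ∖ {1}` are not in the spectrum of `g`, `z₁ > z₂`, and `g` has an eigenvalue
between `z₁` and `z₂`. -/
structure IsPositivePoint (z₁ z₂ : ℂ) (g : H →L[ℂ] H) : Prop where
  norm_left : ‖z₁‖ = 1
  norm_right : ‖z₂‖ = 1
  left_ne_one : z₁ ≠ 1
  right_ne_one : z₂ ≠ 1
  left_notMem : z₁ ∉ spectrum ℂ g
  right_notMem : z₂ ∉ spectrum ℂ g
  gt : RotGT z₁ z₂
  exists_eigenvalue : ∃ μ : ℂ, RotGT z₁ μ ∧ RotGT μ z₂ ∧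
    Module.End.HasEigenvalue (g : H →ₗ[ℂ] H) μ

/-- The fibre `E_{(z₁, z₂, g)}`: the sum of the eigenspaces of `g` for `z₁ > μ > z₂`. -/
def fibre (y : ℂ × ℂ × (H →L[ℂ] H)) : Submodule ℂ H :=
  ⨆ μ : {μ : ℂ // RotGT y.1 μ ∧ RotGT μ y.2.1},
    Module.End.eigenspace (y.2.2 : H →ₗ[ℂ] H) (μ : ℂ)

/-- The orthogonal projection `P` of `H` onto `E_{(z₁, z₂, g)}`. (On `Y^{[2]}_+` the fibre is finite
dimensional, hence closed; the closure makes the definition total.) -/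
def fibreProj (y : ℂ × ℂ × (H →L[ℂ] H)) : H →L[ℂ] H :=
  (fibre y).topologicalClosure.starProjection

variable {V : Type*} [NormedAddCommGroup V] [NormedSpace ℝ V] (ι : V →L[ℝ] (H →L[ℂ] H))

/-- The exponential chart of `U(1) × U(1) × G` centred at `(z₁, z₂, g)`, where `V` is the Lie algebra
of `G` and `ι` its inclusion into `B(H)`. A vector `(a, b, X)` of the model space `ℝ × ℝ × V` is
also read as the tangent vector `(i a z₁, i b z₂, g X)` at the centre. -/
def expChart (y : ℂ × ℂ × (H →L[ℂ] H)) (x : ℝ × ℝ × V) : ℂ × ℂ × (H →L[ℂ] H) :=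
  (y.1 * Complex.exp (x.1 * Complex.I), y.2.1 * Complex.exp (x.2.1 * Complex.I),
    y.2.2 * NormedSpace.exp (ι x.2.2))

/-- A smooth frame `s₁, …, s_k` of the bundle `E ⊂ H × Y^{[2]}_+` on an open neighbourhood `U` of the
point `y`, written in the exponential chart centred at `y`. -/
structure IsLocalFrame (y : ℂ × ℂ × (H →L[ℂ] H)) (U : Set (ℝ × ℝ × V)) {k : ℕ}
    (s : Fin k → ℝ × ℝ × V → H) : Prop where
  isOpen : IsOpen U
  zero_mem : 0 ∈ U
  contDiffOn : ∀ i, ContDiffOn ℝ ∞ (s i) U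
  linearIndependent : ∀ x ∈ U, LinearIndependent ℂ fun i => s i x
  span_eq : ∀ x ∈ U, Submodule.span ℂ (Set.range fun i => s i x) = fibre (expChart ι y x)

/-- The connection `∇` on `E` obtained by projecting the trivial connection of `H × Y^{[2]}_+`:
`(∇_v s)(x) = P(x) (ds)_x(v)`. -/
def projConn (y : ℂ × ℂ × (H →L[ℂ] H)) (s : ℝ × ℝ × V → H) (x v : ℝ × ℝ × V) : H :=
  fibreProj (expChart ι y x) (fderiv ℝ s x v)

/-- `A` is the connection `1`-form of `det ∇` on `L = det E` with respect to the local section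
`s₁ ∧ ⋯ ∧ s_k` of `L`, that is `(det ∇)_v (s₁ ∧ ⋯ ∧ s_k) = A(v) s₁ ∧ ⋯ ∧ s_k`, where
`(det ∇)_v (s₁ ∧ ⋯ ∧ s_k) = ∑ᵢ s₁ ∧ ⋯ ∧ ∇_v sᵢ ∧ ⋯ ∧ s_k`. -/
def IsDetConnForm (y : ℂ × ℂ × (H →L[ℂ] H)) (U : Set (ℝ × ℝ × V)) {k : ℕ}
    (s : Fin k → ℝ × ℝ × V → H) (A : ℝ × ℝ × V → (ℝ × ℝ × V →L[ℝ] ℂ)) : Prop :=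
  ∀ x ∈ U, ∀ v, ∑ i, exteriorPower.ιMulti ℂ k
      (Function.update (fun j => s j x) i (projConn ι y (s i) x v)) =
    A x v • exteriorPower.ιMulti ℂ k (fun j => s j x)

/-- `F` is the curvature `2`-form of the connection `det ∇` on `L = det E` at the point `y`: smooth local
frames of `E` with a connection `1`-form of `det ∇` exist near `y`, and for each of them
`F = dA` at `y`, with `dA(u, v) = D_u A(v) - D_v A(u)`. -/
def IsDetCurvature (y : ℂ × ℂ × (H →L[ℂ] H)) (F : ℝ × ℝ × V → ℝ × ℝ × V → ℂ) : Prop :=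
  (∃ (U : Set (ℝ × ℝ × V)) (k : ℕ) (s : Fin k → ℝ × ℝ × V → H)
      (A : ℝ × ℝ × V → (ℝ × ℝ × V →L[ℝ] ℂ)),
    IsLocalFrame ι y U s ∧ IsDetConnForm ι y U s A) ∧
  ∀ (U : Set (ℝ × ℝ × V)) (k : ℕ) (s : Fin k → ℝ × ℝ × V → H)
      (A : ℝ × ℝ × V → (ℝ × ℝ × V →L[ℝ] ℂ)),
    IsLocalFrame ι y U s → IsDetConnForm ι y U s A →
      DifferentiableAt ℝ A 0 ∧
        ∀ u v, F u v = fderiv ℝ A 0 u v - fderiv ℝ A 0 v u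

/-- The differential `dP` at `y`, evaluated on a tangent vector. -/
def dProj (y : ℂ × ℂ × (H →L[ℂ] H)) (v : ℝ × ℝ × V) : H →L[ℂ] H :=
  fderiv ℝ (fun x => fibreProj (expChart ι y x)) 0 v

/-- The differential `dg` at `y` of the projection `(z₁, z₂, g) ↦ g`, evaluated on a tangent vector. -/
def dGrp (y : ℂ × ℂ × (H →L[ℂ] H)) (v : ℝ × ℝ × V) : H →L[ℂ] H :=
  fderiv ℝ (fun x => (expChart ι y x).2.2) 0 v

/-- The operator valued `2`-form `P dP dP` at `y`; products of forms are wedge products,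
`(α β)(u, v) = α(u) β(v) - α(v) β(u)`. -/
def projForm (y : ℂ × ℂ × (H →L[ℂ] H)) (u v : ℝ × ℝ × V) : H →L[ℂ] H :=
  fibreProj y * dProj ι y u * dProj ι y v - fibreProj y * dProj ι y v * dProj ι y u

/-- The operator valued `2`-form `(ξ - g)⁻¹ dg (ξ - g)⁻² dg` at `y`. -/
def resolventForm (y : ℂ × ℂ × (H →L[ℂ] H)) (ξ : ℂ) (u v : ℝ × ℝ × V) : H →L[ℂ] H :=
  resolvent y.2.2 ξ * dGrp ι y u * resolvent y.2.2 ξ ^ 2 * dGrp ι y v -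
    resolvent y.2.2 ξ * dGrp ι y v * resolvent y.2.2 ξ ^ 2 * dGrp ι y u

/-- The trace of a (trace class) operator, computed in the orthonormal basis `b`. -/
def opTrace {κ : Type*} (b : HilbertBasis κ ℂ H) (T : H →L[ℂ] H) : ℂ :=
  ∑' i, inner ℂ (b i) (T (b i))

end Gerbe

/-! ### Contours -/

section Contours

/-- A piecewise continuously differentiable closed curve `γ : [0, 1] → ℂ`. -/
structure IsClosedContour (γ : ℝ → ℂ) : Prop where
  closed : γ 0 = γ 1
  piecewise : ∃ (n : ℕ) (t : Fin (n + 1) → ℝ), StrictMono t ∧ t 0 = 0 ∧ t (Fin.last n) = 1 ∧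
    ∀ i : Fin n, ContDiffOn ℝ 1 γ (Set.Icc (t i.castSucc) (t i.succ))

/-- The contour integral of `f` along `γ : [0, 1] → ℂ`. -/
def contourIntegral (γ : ℝ → ℂ) (f : ℂ → ℂ) : ℂ := ∫ t in (0 : ℝ)..1, f (γ t) * deriv γ t

/-- The winding number of a closed contour about a point that is not on it. -/
def contourWinding (γ : ℝ → ℂ) (a : ℂ) : ℂ :=
  (2 * Real.pi * Complex.I)⁻¹ * contourIntegral γ fun ξ => (ξ - a)⁻¹

variable {H : Type*} [NormedAddCommGroup H] [InnerProductSpace ℂ H]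

/-- `γ` is a closed contour, off the spectrum of `g`, that encloses once, counter-clockwise, the part
of the spectrum of `g` between `z₁` and `z₂`, and encloses no other point of the spectrum. -/
structure Encloses (γ : ℝ → ℂ) (z₁ z₂ : ℂ) (g : H →L[ℂ] H) : Prop where
  isClosedContour : IsClosedContour γ
  notMem : ∀ t ∈ Set.Icc (0 : ℝ) 1, γ t ∉ spectrum ℂ g
  winding_one : ∀ μ ∈ spectrum ℂ g, RotGT z₁ μ ∧ RotGT μ z₂ → contourWinding γ μ = 1
  winding_zero : ∀ μ ∈ spectrum ℂ g, ¬(RotGT z₁ μ ∧ RotGT μ z₂) → contourWinding γ μ = 0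

end Contours

/-- The assertion at a point `y = (z₁, z₂, g)` of `Y^{[2]}_+` and for a contour `γ`: `P` is smooth
near `y`, all operators whose traces occur are of trace class, the integrand is integrable, and
`F_{det ∇} = tr (P dP dP) = (1 / 4πi) ∮_γ tr ((ξ - g)⁻¹ dg (ξ - g)⁻² dg) dξ` at `y`. -/
def CurvatureFormulaAt {H : Type*} [NormedAddCommGroup H] [InnerProductSpace ℂ H] [CompleteSpace H]
    {V : Type*} [NormedAddCommGroup V] [NormedSpace ℝ V] (ι : V →L[ℝ] (H →L[ℂ] H))
    {κ : Type*} (b : HilbertBasis κ ℂ H) (y : ℂ × ℂ × (H →L[ℂ] H)) (γ : ℝ → ℂ) : Prop :=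
  ContDiffAt ℝ ∞ (fun x => fibreProj (expChart ι y x)) 0 ∧
  IsDetCurvature ι y (fun u v => opTrace b (projForm ι y u v)) ∧
  ∀ u v : ℝ × ℝ × V,
    IsTraceClass (projForm ι y u v) ∧
    (∀ ξ ∉ spectrum ℂ y.2.2, IsTraceClass (resolventForm ι y ξ u v)) ∧
    IntervalIntegrable (fun t => opTrace b (resolventForm ι y (γ t) u v) * deriv γ t)
      MeasureTheory.volume 0 1 ∧
    opTrace b (projForm ι y u v) =
      (4 * Real.pi * Complex.I)⁻¹ *
        contourIntegral γ fun ξ => opTrace b (resolventForm ι y ξ u v)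

end

/-!
The only property of `G` that matters is that the elements of its Lie algebra, and the operators
`g - 1`, are Hilbert-Schmidt. This is clear for `U(H)`, and for `U_p(H)` with `p ≤ 2` it holds because
the Schatten ideals increase with `p` (`IsSchatten.two_of_le`, `IsSchatten.isHilbertSchmidt`).
Products of two Hilbert-Schmidt operators are of trace class, and their traces are absolutely
convergent double series in any orthonormal basis (`opTrace_mul_sub_mul`).

*Smoothness.* Some disc cuts the arc between `z₁` and `z₂` out of the unit circle
(`exists_isArcDisc`). Since `z₁` and `z₂` are not in the spectrum of `g`, it keeps doing so, as far as
spectral points are concerned, near `(z₁, z₂, g)`. There `P` is the Riesz integral of the resolvent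
over the boundary of the disc (`rieszIntegral_eq_starProjection`, by the Fredholm alternative for
`g - 1`). This integral is smooth in `g`, since inversion is smooth in the Banach algebra of
continuous operator valued functions on the circle, and it is Hilbert-Schmidt, so that `P` has finite
rank (`eventually_contDiffAt_fibreProj`).

*Curvature.* Write a local frame of `E` as a map `S` from `ℂᵏ` to `H`, and let `L` be its left inverse
with `L P = L`, so that `S L = P`. The connection form of `det ∇` in this frame is `tr (L dS)`, and the
derivatives of `P S = S`, `L P = L` and `L S = 1` give `tr (dL dS) = tr (P dP dP)`
(`fderiv_detConnForm`, `isDetCurvature_opTrace_projForm`).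

*Contour integral.* Let `fⱼ` be an orthonormal basis with `g fⱼ = lⱼ fⱼ`, and let `pⱼ` be `1` if `lⱼ`
is between `z₁` and `z₂`, and `0` otherwise. The derivatives of `P g = g P` and `P² = P` determine the
matrix of `dP`: `dPⱼₖ = (pⱼ - pₖ) (lⱼ - lₖ)⁻¹ dgⱼₖ`. Hence `tr (P dP dP)`, evaluated at `(u, v)`, is the
double series with terms `(pⱼ - pₖ) (lⱼ - lₖ)⁻² dg(u)ⱼₖ dg(v)ₖⱼ`. The trace in the contour integral is
the double series with terms
`((ξ - lⱼ)⁻¹ (ξ - lₖ)⁻² - (ξ - lₖ)⁻¹ (ξ - lⱼ)⁻²) dg(u)ⱼₖ dg(v)ₖⱼ`. By partial fractions, the integral of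
the factor in `ξ` is `4πi (lⱼ - lₖ)⁻²` times the difference of the winding numbers about `lⱼ` and `lₖ`,
which are `pⱼ` and `pₖ` (`IsClosedContour.contourIntegral_partialFractions`).
-/

/-! ### Hilbert-Schmidt operators -/

section HilbertSchmidt

variable {H : Type*} [NormedAddCommGroup H] [InnerProductSpace ℂ H]

/-- `A` is a Hilbert-Schmidt operator: the sums `∑ᵢ ‖A eᵢ‖²` over finite orthonormal families `e` are
bounded. -/
def IsHilbertSchmidt (A : H →L[ℂ] H) : Prop :=
  ∃ C : ℝ, ∀ (n : ℕ) (e : Fin n → H), Orthonormal ℂ e → ∑ i, ‖A (e i)‖ ^ 2 ≤ C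

theorem isSchatten_two_iff {A : H →L[ℂ] H} : IsSchatten 2 A ↔
    ∃ C : ℝ, ∀ (n : ℕ) (e f : Fin n → H), Orthonormal ℂ e → Orthonormal ℂ f →
      ∑ i, ‖inner ℂ (f i) (A (e i))‖ ^ 2 ≤ C := by
  constructor
  · rintro ⟨M, hM⟩
    refine ⟨M ^ 2, fun n e f he hf => ?_⟩
    have h := hM ⟨n, e, f, he, hf, rfl⟩
    have h0 : 0 ≤ ∑ i, ‖inner ℂ (f i) (A (e i))‖ ^ 2 := by positivity
    simp only [Real.rpow_two, ← Real.sqrt_eq_rpow] at h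
    calc _ = (√(∑ i, ‖inner ℂ (f i) (A (e i))‖ ^ 2)) ^ 2 := (Real.sq_sqrt h0).symm
      _ ≤ M ^ 2 := by gcongr
  · rintro ⟨C, hC⟩
    refine ⟨√C, ?_⟩
    rintro r ⟨n, e, f, he, hf, rfl⟩
    simp only [Real.rpow_two, ← Real.sqrt_eq_rpow]
    exact Real.sqrt_le_sqrt (hC n e f he hf)

/-- The Schatten ideals increase with `p`: the matrix coefficients are bounded by `‖A‖`. -/
theorem IsSchatten.two_of_le {p : ℝ} (hp1 : 1 ≤ p) (hp2 : p ≤ 2) {A : H →L[ℂ] H}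
    (hA : IsSchatten p A) : IsSchatten 2 A := by
  obtain ⟨M, hM⟩ := hA
  have hp0 : 0 < p := by linarith
  refine isSchatten_two_iff.2 ⟨M ^ p * ‖A‖ ^ (2 - p), fun n e f he hf => ?_⟩
  have h := hM ⟨n, e, f, he, hf, rfl⟩
  have hS : ∑ i, ‖inner ℂ (f i) (A (e i))‖ ^ p ≤ M ^ p := by
    have h0 : 0 ≤ ∑ i, ‖inner ℂ (f i) (A (e i))‖ ^ p := by positivity
    calc _ = ((∑ i, ‖inner ℂ (f i) (A (e i))‖ ^ p) ^ (1 / p)) ^ p := by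
          rw [one_div, Real.rpow_inv_rpow h0 hp0.ne']
      _ ≤ M ^ p := Real.rpow_le_rpow (by positivity) h hp0.le
  calc ∑ i, ‖inner ℂ (f i) (A (e i))‖ ^ 2
      ≤ ∑ i, ‖inner ℂ (f i) (A (e i))‖ ^ p * ‖A‖ ^ (2 - p) := by
        refine Finset.sum_le_sum fun i _ => ?_
        have hx : ‖inner ℂ (f i) (A (e i))‖ ≤ ‖A‖ := by
          refine (norm_inner_le_norm _ _).trans ?_
          rw [hf.1 i, one_mul]
          simpa [he.1 i] using A.le_opNorm (e i)
        rw [← Real.rpow_two, show (2 : ℝ) = p + (2 - p) by ring,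
          Real.rpow_add_of_nonneg (norm_nonneg _) hp0.le (by linarith)]
        have h2 : 0 ≤ 2 - p := by linarith
        rw [show p + (2 - p) - p = 2 - p by ring]
        gcongr
    _ = (∑ i, ‖inner ℂ (f i) (A (e i))‖ ^ p) * ‖A‖ ^ (2 - p) := by rw [Finset.sum_mul]
    _ ≤ M ^ p * ‖A‖ ^ (2 - p) := by gcongr

theorem isHilbertSchmidt_of_finiteDimensional [FiniteDimensional ℂ H] (A : H →L[ℂ] H) :
    IsHilbertSchmidt A := by
  refine ⟨Module.finrank ℂ H * ‖A‖ ^ 2, fun n e he => ?_⟩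
  have hn : n ≤ Module.finrank ℂ H := by
    simpa using he.linearIndependent.fintype_card_le_finrank
  calc ∑ i, ‖A (e i)‖ ^ 2 ≤ ∑ _i : Fin n, ‖A‖ ^ 2 := by
        refine Finset.sum_le_sum fun i _ => ?_
        have := A.le_opNorm (e i)
        rw [he.1 i, mul_one] at this
        gcongr
    _ = n * ‖A‖ ^ 2 := by simp
    _ ≤ _ := by gcongr

theorem IsHilbertSchmidt.mul_left {A : H →L[ℂ] H} (hA : IsHilbertSchmidt A) (B : H →L[ℂ] H) :
    IsHilbertSchmidt (B * A) := by
  obtain ⟨C, hC⟩ := hA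
  refine ⟨‖B‖ ^ 2 * C, fun n e he => ?_⟩
  calc ∑ i, ‖(B * A) (e i)‖ ^ 2 ≤ ∑ i, ‖B‖ ^ 2 * ‖A (e i)‖ ^ 2 := by
        refine Finset.sum_le_sum fun i _ => ?_
        rw [← mul_pow]
        have := B.le_opNorm (A (e i))
        exact pow_le_pow_left₀ (norm_nonneg _) this 2
    _ = ‖B‖ ^ 2 * ∑ i, ‖A (e i)‖ ^ 2 := by rw [Finset.mul_sum]
    _ ≤ _ := by gcongr; exact hC n e he

theorem IsHilbertSchmidt.add {A B : H →L[ℂ] H} (hA : IsHilbertSchmidt A)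
    (hB : IsHilbertSchmidt B) : IsHilbertSchmidt (A + B) := by
  obtain ⟨C, hC⟩ := hA
  obtain ⟨D, hD⟩ := hB
  refine ⟨2 * C + 2 * D, fun n e he => ?_⟩
  calc ∑ i, ‖(A + B) (e i)‖ ^ 2 ≤ ∑ i, (2 * ‖A (e i)‖ ^ 2 + 2 * ‖B (e i)‖ ^ 2) := by
        refine Finset.sum_le_sum fun i _ => ?_
        have h := norm_add_le (A (e i)) (B (e i))
        rw [add_apply]
        nlinarith [sq_nonneg (‖A (e i)‖ - ‖B (e i)‖), norm_nonneg (A (e i) + B (e i))]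
    _ = 2 * ∑ i, ‖A (e i)‖ ^ 2 + 2 * ∑ i, ‖B (e i)‖ ^ 2 := by
        rw [Finset.sum_add_distrib, Finset.mul_sum, Finset.mul_sum]
    _ ≤ _ := by gcongr <;> [exact hC n e he; exact hD n e he]

theorem IsHilbertSchmidt.isSchatten_two {A : H →L[ℂ] H} (hA : IsHilbertSchmidt A) :
    IsSchatten 2 A := by
  obtain ⟨C, hC⟩ := hA
  refine isSchatten_two_iff.2 ⟨C, fun n e f he hf => le_trans ?_ (hC n e he)⟩
  refine Finset.sum_le_sum fun i _ => ?_
  have := norm_inner_le_norm (𝕜 := ℂ) (f i) (A (e i))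
  rw [hf.1 i, one_mul] at this
  gcongr

theorem IsTraceClass.sub {A B : H →L[ℂ] H} (hA : IsTraceClass A) (hB : IsTraceClass B) :
    IsTraceClass (A - B) :=
  haveI : Fact ((1 : ℝ) ≤ 1) := ⟨le_rfl⟩
  (schattenSubmodule H 1).sub_mem hA hB

variable [CompleteSpace H]

/-- By the singular value decomposition of `A` on the span of a finite orthonormal family, the
two-family sums that define the Schatten class with `p = 2` control the sums `∑ᵢ ‖A eᵢ‖²`. -/
theorem IsSchatten.isHilbertSchmidt {A : H →L[ℂ] H} (hA : IsSchatten 2 A) :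
    IsHilbertSchmidt A := by
  classical
  obtain ⟨C, hC⟩ := isSchatten_two_iff.1 hA
  refine ⟨C, fun n e he => ?_⟩
  let std := EuclideanSpace.basisFun (Fin n) ℂ
  let J₀ : EuclideanSpace ℂ (Fin n) →ₗ[ℂ] H := std.toBasis.constr ℂ e
  have hJ₀ : ∀ i, J₀ (std i) = e i := fun i => by
    rw [← std.coe_toBasis]
    exact std.toBasis.constr_basis ℂ e i
  let J : EuclideanSpace ℂ (Fin n) →ₗᵢ[ℂ] H :=
    J₀.isometryOfOrthonormal (v := std.toBasis) (by simp) (by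
      convert he using 1
      funext i
      simp [hJ₀])
  have hJ : ∀ i, J (std i) = e i := hJ₀
  let B : EuclideanSpace ℂ (Fin n) →L[ℂ] H := A.comp J.toContinuousLinearMap
  let T : EuclideanSpace ℂ (Fin n) →L[ℂ] EuclideanSpace ℂ (Fin n) :=
    (ContinuousLinearMap.adjoint B).comp B
  have hT : (T : EuclideanSpace ℂ (Fin n) →ₗ[ℂ] EuclideanSpace ℂ (Fin n)).IsSymmetric := by
    intro x y
    simp [T, ContinuousLinearMap.adjoint_inner_left, ContinuousLinearMap.adjoint_inner_right]
  have hfin : Module.finrank ℂ (EuclideanSpace ℂ (Fin n)) = n := by simp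
  let u := hT.eigenvectorBasis hfin
  have hBu : ∀ i j, inner ℂ (B (u i)) (B (u j)) = inner ℂ (u i) (T (u j)) := fun i j => by
    simp [T, ContinuousLinearMap.adjoint_inner_right]
  have hTu : ∀ j, T (u j) = (hT.eigenvalues hfin j : ℂ) • u j := fun j =>
    hT.apply_eigenvectorBasis hfin j
  have horth : ∀ i j, i ≠ j → inner ℂ (B (u i)) (B (u j)) = 0 := fun i j hij => by
    rw [hBu, hTu, inner_smul_right, u.orthonormal.2 hij, mul_zero]
  have hsum : ∀ v : OrthonormalBasis (Fin n) ℂ (EuclideanSpace ℂ (Fin n)),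
      ((∑ i, ‖B (v i)‖ ^ 2 : ℝ) : ℂ) = LinearMap.trace ℂ _
        (T : EuclideanSpace ℂ (Fin n) →ₗ[ℂ] EuclideanSpace ℂ (Fin n)) := fun v => by
    have h : ∀ i, inner ℂ (v i) (T (v i)) = ((‖B (v i)‖ ^ 2 : ℝ) : ℂ) := fun i => by
      have h' : inner ℂ (v i) (T (v i)) = inner ℂ (B (v i)) (B (v i)) :=
        ContinuousLinearMap.adjoint_inner_right B (v i) (B (v i))
      rw [h', inner_self_eq_norm_sq_to_K, Complex.ofReal_pow]
      rfl
    rw [LinearMap.trace_eq_sum_inner _ v, Complex.ofReal_sum]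
    exact Finset.sum_congr rfl fun i _ => (h i).symm
  -- the sum of squares is a trace, so that `e` may be replaced by right singular vectors
  have h1 : ∑ i, ‖A (e i)‖ ^ 2 = ∑ i, ‖B (u i)‖ ^ 2 := by
    have h := (hsum std).trans (hsum u).symm
    have h' := Complex.ofReal_injective h
    rw [← h']
    refine Finset.sum_congr rfl fun i _ => ?_
    simp only [B, ContinuousLinearMap.comp_apply, LinearIsometry.coe_toContinuousLinearMap, hJ]
  rw [h1]
  let s : Finset (Fin n) := Finset.univ.filter fun i => B (u i) ≠ 0
  let σ : Fin s.card ≃ s := s.equivFin.symm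
  have hs : ∀ k, B (u (σ k)) ≠ 0 := fun k => (Finset.mem_filter.1 (σ k).2).2
  have hJu : Orthonormal ℂ fun i => J (u i) := u.orthonormal.comp_linearIsometry J
  have hinj : Function.Injective fun k => (σ k : Fin n) :=
    Subtype.val_injective.comp σ.injective
  -- pair the right singular vectors with the normalized left ones
  have key := hC s.card (fun k => J (u (σ k)))
    (fun k => ((‖B (u (σ k))‖⁻¹ : ℝ) : ℂ) • B (u (σ k)))
    (hJu.comp _ hinj) ⟨fun k => by
      rw [norm_smul]; simp [hs k], fun k l hkl => by
      beta_reduce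
      rw [inner_smul_left, inner_smul_right, horth _ _ (hinj.ne hkl), mul_zero, mul_zero]⟩
  refine le_trans (le_of_eq ?_) key
  have h2 : ∑ i, ‖B (u i)‖ ^ 2 = ∑ i ∈ s, ‖B (u i)‖ ^ 2 := by
    refine (Finset.sum_subset (Finset.subset_univ s) fun i _ hi => ?_).symm
    have : B (u i) = 0 := by simpa [s] using hi
    simp [this]
  rw [h2, ← Finset.sum_coe_sort, ← Equiv.sum_comp σ]
  refine Finset.sum_congr rfl fun k _ => ?_
  have hn : ‖B (u (σ k))‖ ≠ 0 := norm_ne_zero_iff.2 (hs k)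
  have : A (J (u (σ k))) = B (u (σ k)) := rfl
  rw [this, inner_smul_left, inner_self_eq_norm_sq_to_K]
  simp
  field_simp

theorem isHilbertSchmidt_iff {A : H →L[ℂ] H} : IsHilbertSchmidt A ↔ IsSchatten 2 A :=
  ⟨IsHilbertSchmidt.isSchatten_two, IsSchatten.isHilbertSchmidt⟩

theorem IsHilbertSchmidt.star {A : H →L[ℂ] H} (hA : IsHilbertSchmidt A) :
    IsHilbertSchmidt (star A) := by
  rw [isHilbertSchmidt_iff] at hA ⊢
  obtain ⟨C, hC⟩ := isSchatten_two_iff.1 hA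
  refine isSchatten_two_iff.2 ⟨C, fun n e f he hf => ?_⟩
  convert hC n f e hf he using 3 with i
  rw [ContinuousLinearMap.star_eq_adjoint, ContinuousLinearMap.adjoint_inner_right, norm_inner_symm]

theorem IsHilbertSchmidt.mul_right {A : H →L[ℂ] H} (hA : IsHilbertSchmidt A) (B : H →L[ℂ] H) :
    IsHilbertSchmidt (A * B) := by
  have := (hA.star.mul_left (Star.star B)).star
  rwa [← star_mul, star_star] at this

theorem IsHilbertSchmidt.isTraceClass_mul {A B : H →L[ℂ] H} (hA : IsHilbertSchmidt A)
    (hB : IsHilbertSchmidt B) : IsTraceClass (A * B) := by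
  obtain ⟨C, hC⟩ := hA.star
  obtain ⟨D, hD⟩ := hB
  refine ⟨C + D, ?_⟩
  rintro r ⟨n, e, f, he, hf, rfl⟩
  have h0 : 0 ≤ ∑ i, ‖inner ℂ (f i) ((A * B) (e i))‖ := by positivity
  simp only [Real.rpow_one, div_one]
  calc ∑ i, ‖inner ℂ (f i) ((A * B) (e i))‖
      ≤ ∑ i, (‖Star.star A (f i)‖ ^ 2 + ‖B (e i)‖ ^ 2) := by
        refine Finset.sum_le_sum fun i _ => ?_
        have h : inner ℂ (f i) ((A * B) (e i)) = inner ℂ (Star.star A (f i)) (B (e i)) := by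
          rw [ContinuousLinearMap.star_eq_adjoint, ContinuousLinearMap.adjoint_inner_left]; rfl
        rw [h]
        refine (norm_inner_le_norm _ _).trans ?_
        nlinarith [sq_nonneg (‖Star.star A (f i)‖ - ‖B (e i)‖),
          mul_nonneg (norm_nonneg (Star.star A (f i))) (norm_nonneg (B (e i)))]
    _ ≤ C + D := by
        rw [Finset.sum_add_distrib]
        exact add_le_add (hC n f hf) (hD n e he)

end HilbertSchmidt

section HilbertSchmidtCompact

variable {H : Type*} [NormedAddCommGroup H] [InnerProductSpace ℂ H]

/-- A Hilbert-Schmidt operator is a norm limit of finite rank operators: if a finite orthonormal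
family nearly exhausts the supremum of the sums `∑ᵢ ‖A eᵢ‖²`, then `A` is small on the orthogonal
complement of the family. -/
theorem IsHilbertSchmidt.isCompactOperator [CompleteSpace H] {A : H →L[ℂ] H}
    (hA : IsHilbertSchmidt A) : IsCompactOperator A := by
  obtain ⟨C, hC⟩ := hA
  have hcl := isClosed_setOfPred_isCompactOperator (σ₁₂ := RingHom.id ℂ) (M₁ := H) (M₂ := H)
  refine hcl.closure_subset (Metric.mem_closure_iff.2 fun ε hε => ?_)
  let s : Set ℝ := {r | ∃ (n : ℕ) (e : Fin n → H), Orthonormal ℂ e ∧ r = ∑ i, ‖A (e i)‖ ^ 2}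
  have hs0 : s.Nonempty := ⟨_, 0, Fin.elim0, ⟨fun i => i.elim0, fun i => i.elim0⟩, rfl⟩
  have hsb : BddAbove s := ⟨C, by rintro r ⟨n, e, he, rfl⟩; exact hC n e he⟩
  have hδ : 0 < (ε / 2) ^ 2 := by positivity
  obtain ⟨_, ⟨n, e, he, rfl⟩, hr⟩ := exists_lt_of_lt_csSup hs0 (sub_lt_self (sSup s) hδ)
  let F : Submodule ℂ H := Submodule.span ℂ (Set.range e)
  have : FiniteDimensional ℂ F := FiniteDimensional.span_of_finite ℂ (Set.finite_range e)
  -- a unit vector orthogonal to the family extends it, which bounds its image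
  have hv : ∀ v ∈ Fᗮ, ‖A v‖ ≤ ε / 2 * ‖v‖ := by
    intro v hvF
    by_cases hv0 : v = 0
    · simp [hv0]
    have hn : ‖v‖ ≠ 0 := norm_ne_zero_iff.2 hv0
    let w : H := ((‖v‖⁻¹ : ℝ) : ℂ) • v
    have hw : ‖w‖ = 1 := by simp [w, norm_smul, hn]
    have hwe : ∀ i, inner ℂ (e i) w = 0 := fun i => by
      have := Submodule.inner_right_of_mem_orthogonal
        (Submodule.subset_span (Set.mem_range_self i) : e i ∈ F) hvF
      simp [w, this]
    have hon : Orthonormal ℂ (Fin.cons w e : Fin (n + 1) → H) := by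
      constructor
      · intro i
        refine Fin.cases ?_ (fun j => ?_) i
        · simpa using hw
        · simpa using he.1 j
      · intro i j
        refine Fin.cases ?_ (fun i => ?_) i <;> refine Fin.cases ?_ (fun j => ?_) j
        · intro h; exact absurd rfl h
        · intro _
          simpa using inner_eq_zero_symm.1 (hwe j)
        · intro _
          simpa using hwe i
        · intro h
          have : i ≠ j := fun h' => h (by rw [h'])
          simpa using he.2 this
    have h1 := le_csSup hsb ⟨n + 1, _, hon, rfl⟩
    rw [Fin.sum_univ_succ] at h1
    simp only [Fin.cons_zero, Fin.cons_succ] at h1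
    have h2 : ‖A w‖ ^ 2 ≤ (ε / 2) ^ 2 := by linarith
    have h3 : ‖A w‖ ≤ ε / 2 := le_of_sq_le_sq h2 (by positivity)
    have h4 : A v = (‖v‖ : ℂ) • A w := by
      have : (‖v‖ : ℂ) ≠ 0 := by exact_mod_cast hn
      rw [← map_smul, smul_smul, Complex.ofReal_inv, mul_inv_cancel₀ this, one_smul]
    rw [h4, norm_smul]
    simp only [Complex.norm_real, norm_norm]
    nlinarith [norm_nonneg v]
  refine ⟨A.comp F.starProjection, ?_, ?_⟩
  · have : ProperSpace F := FiniteDimensional.proper ℂ F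
    have h1 : IsCompactOperator F.orthogonalProjectionOnto :=
      isCompactOperator_of_locallyCompactSpace_dom F.orthogonalProjectionOnto
    exact (h1.clm_comp F.subtypeL).clm_comp A
  · rw [dist_eq_norm]
    refine lt_of_le_of_lt (ContinuousLinearMap.opNorm_le_bound _ (by positivity) fun x => ?_)
      (half_lt_self hε)
    have : (A - A.comp F.starProjection) x = A (x - F.starProjection x) := by simp
    rw [this]
    refine (hv _ (F.sub_starProjection_mem_orthogonal x)).trans ?_
    gcongr
    have := Fᗮ.norm_starProjection_apply_le x
    rwa [Submodule.starProjection_orthogonal_val] at this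

variable {κ κ' : Type*} (b : HilbertBasis κ ℂ H) (f : HilbertBasis κ' ℂ H)

theorem IsHilbertSchmidt.summable_sq {A : H →L[ℂ] H} (hA : IsHilbertSchmidt A) :
    Summable fun q : κ × κ' => ‖inner ℂ (b q.1) (A (f q.2))‖ ^ 2 := by
  classical
  obtain ⟨C, hC⟩ := hA
  have hC' : ∀ t : Finset κ', ∑ k ∈ t, ‖A (f k)‖ ^ 2 ≤ C := fun t => by
    rw [← Finset.sum_coe_sort, ← Equiv.sum_comp t.equivFin.symm]
    exact hC _ _ (f.orthonormal.comp (fun k => (t.equivFin.symm k : κ'))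
      (Subtype.val_injective.comp t.equivFin.symm.injective))
  refine summable_of_sum_le (c := C) (fun _ => by positivity) fun u => ?_
  calc ∑ q ∈ u, ‖inner ℂ (b q.1) (A (f q.2))‖ ^ 2
      ≤ ∑ q ∈ u.image Prod.fst ×ˢ u.image Prod.snd, ‖inner ℂ (b q.1) (A (f q.2))‖ ^ 2 :=
        Finset.sum_le_sum_of_subset_of_nonneg Finset.subset_product fun _ _ _ => by positivity
    _ = ∑ k ∈ u.image Prod.snd, ∑ j ∈ u.image Prod.fst, ‖inner ℂ (b j) (A (f k))‖ ^ 2 :=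
        Finset.sum_product_right _ _ _
    _ ≤ ∑ k ∈ u.image Prod.snd, ‖A (f k)‖ ^ 2 :=
        Finset.sum_le_sum fun k _ => b.orthonormal.sum_inner_products_le _
    _ ≤ C := hC' _

/-- The trace of an operator that factors through a finite dimensional space. -/
theorem opTrace_comp_eq_trace {k : ℕ} (S : (Fin k → ℂ) →L[ℂ] H) (K : H →L[ℂ] (Fin k → ℂ)) :
    HasSum (fun i => inner ℂ (b i) ((S.comp K) (b i)))
      (LinearMap.trace ℂ (Fin k → ℂ) (K.comp S : (Fin k → ℂ) →L[ℂ] (Fin k → ℂ))) := by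
  have h1 : ∀ j, HasSum (fun i => inner ℂ (b i) (S (Pi.single j 1)) * K (b i) j)
      (K (S (Pi.single j 1)) j) := fun j => by
    have h := b.hasSum_repr (S (Pi.single j 1))
    have h2 := h.mapL ((ContinuousLinearMap.proj (R := ℂ) (φ := fun _ : Fin k => ℂ) j).comp K)
    simpa [HilbertBasis.repr_apply_apply] using h2
  have h3 := hasSum_sum (s := Finset.univ) fun j _ => h1 j
  convert h3 using 1
  · funext i
    have : K (b i) = ∑ j, K (b i) j • (Pi.single j 1 : Fin k → ℂ) := pi_eq_sum_univ' _
    rw [ContinuousLinearMap.comp_apply]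
    conv_lhs => rw [this]
    rw [map_sum, inner_sum]
    refine Finset.sum_congr rfl fun j _ => ?_
    rw [map_smul, inner_smul_right, mul_comm]
  · rw [LinearMap.trace_eq_matrix_trace ℂ (Pi.basisFun ℂ (Fin k)), Matrix.trace]
    refine Finset.sum_congr rfl fun j _ => ?_
    simp

theorem IsHilbertSchmidt.summable_inner_mul {A B : H →L[ℂ] H} (hA : IsHilbertSchmidt A)
    (hB : IsHilbertSchmidt B) :
    Summable fun q : κ × κ' => ‖inner ℂ (b q.1) (A (f q.2))‖ * ‖inner ℂ (f q.2) (B (b q.1))‖ := by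
  have h1 := hA.summable_sq b f
  have h2 := (hB.summable_sq f b).comp_injective (Prod.swap_injective (α := κ) (β := κ'))
  refine Summable.of_nonneg_of_le (fun _ => by positivity) (fun q => ?_) (h1.add h2)
  simp only [Function.comp_apply, Prod.fst_swap, Prod.snd_swap]
  nlinarith [sq_nonneg (‖inner ℂ (b q.1) (A (f q.2))‖ - ‖inner ℂ (f q.2) (B (b q.1))‖),
    norm_nonneg (inner ℂ (b q.1) (A (f q.2))), norm_nonneg (inner ℂ (f q.2) (B (b q.1))),
    mul_nonneg (norm_nonneg (inner ℂ (b q.1) (A (f q.2))))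
      (norm_nonneg (inner ℂ (f q.2) (B (b q.1))))]

variable [CompleteSpace H]

/-- Since `exp A - 1 = A ∫₀¹ exp (t A) dt`. -/
theorem IsHilbertSchmidt.exp_sub_one {A : H →L[ℂ] H} (hA : IsHilbertSchmidt A) :
    IsHilbertSchmidt (NormedSpace.exp A - 1) := by
  have hd : ∀ t : ℝ, HasDerivAt (fun t : ℝ => NormedSpace.exp (t • A))
      (A * NormedSpace.exp (t • A)) t := fun t => hasDerivAt_exp_smul_const' A t
  have hc : Continuous fun t : ℝ => NormedSpace.exp (t • A) :=
    continuous_iff_continuousAt.2 fun t => (hd t).continuousAt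
  have h := intervalIntegral.integral_eq_sub_of_hasDerivAt (a := 0) (b := 1) (fun t _ => hd t)
    ((continuous_const.mul hc).intervalIntegrable _ _)
  have h2 : ∫ t in (0 : ℝ)..1, A * NormedSpace.exp (t • A) =
      A * ∫ t in (0 : ℝ)..1, NormedSpace.exp (t • A) :=
    (ContinuousLinearMap.mul ℝ (H →L[ℂ] H) A).intervalIntegral_comp_comm
      (hc.intervalIntegrable _ _)
  simp only [one_smul, zero_smul, NormedSpace.exp_zero] at h
  rw [← h, h2]
  exact hA.mul_right _

theorem opTrace_mul_eq_tsum {A B : H →L[ℂ] H} (hA : IsHilbertSchmidt A)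
    (hB : IsHilbertSchmidt B) :
    opTrace b (A * B) =
      ∑' q : κ × κ', inner ℂ (b q.1) (A (f q.2)) * inner ℂ (f q.2) (B (b q.1)) := by
  have hs : Summable fun q : κ × κ' =>
      inner ℂ (b q.1) (A (f q.2)) * inner ℂ (f q.2) (B (b q.1)) := by
    refine Summable.of_norm ?_
    simpa only [norm_mul] using hA.summable_inner_mul b f hB
  rw [hs.tsum_prod]
  refine tsum_congr fun i => ?_
  have h := f.tsum_inner_mul_inner (ContinuousLinearMap.adjoint A (b i)) (B (b i))
  simp only [ContinuousLinearMap.adjoint_inner_left] at h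
  rw [h]
  rfl

theorem opTrace_mul_comm {A B : H →L[ℂ] H} (hA : IsHilbertSchmidt A)
    (hB : IsHilbertSchmidt B) : opTrace b (A * B) = opTrace f (B * A) := by
  rw [opTrace_mul_eq_tsum b f hA hB, opTrace_mul_eq_tsum f b hB hA,
    ← (Equiv.prodComm κ κ').tsum_eq]
  exact tsum_congr fun q => mul_comm _ _

/-- The trace of a product of two Hilbert-Schmidt operators, in a basis other than the one that
computes the trace. -/
theorem opTrace_mul_eq_tsum_basis {A B : H →L[ℂ] H} (hA : IsHilbertSchmidt A)
    (hB : IsHilbertSchmidt B) :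
    opTrace b (A * B) =
      ∑' q : κ' × κ', inner ℂ (f q.1) (A (f q.2)) * inner ℂ (f q.2) (B (f q.1)) := by
  rw [opTrace_mul_comm b f hA hB, opTrace_mul_comm f f hB hA, opTrace_mul_eq_tsum f f hA hB]

end HilbertSchmidtCompact

/-! ### Arcs of the unit circle -/

section Arcs

open Complex (exp I)

theorem exists_angle {z : ℂ} (hz : ‖z‖ = 1) (hz1 : z ≠ 1) :
    ∃ a ∈ Set.Ioo (0 : ℝ) (2 * Real.pi), z = exp (a * I) := by
  obtain ⟨t, ht⟩ := (Complex.norm_eq_one_iff z).1 hz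
  have h2 : (0 : ℝ) < 2 * Real.pi := by positivity
  have hmem := toIcoMod_mem_Ico h2 0 t
  have hper : exp ((toIcoMod h2 0 t : ℝ) * I) = z := by
    rw [← ht, toIcoMod]
    have := Complex.exp_periodic.sub_zsmul_eq (toIcoDiv h2 0 t) (x := t * I)
    rw [← this]
    congr 1
    push_cast
    simp only [zsmul_eq_mul]
    ring
  refine ⟨_, ⟨lt_of_le_of_ne hmem.1 fun h => hz1 ?_, by simpa using hmem.2⟩, hper.symm⟩
  rw [← hper, ← h]
  simp

theorem exp_ofReal_mul_I_ne_one {s : ℝ} (hs : s ∈ Set.Ioo (0 : ℝ) (2 * Real.pi)) :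
    exp (s * I) ≠ 1 := by
  intro h
  have h1 : Real.cos s = 1 := by
    have := congrArg Complex.re h
    rwa [Complex.exp_ofReal_mul_I_re, Complex.one_re] at this
  have := (Real.cos_eq_one_iff_of_lt_of_lt (by linarith [hs.1, hs.2, Real.pi_pos]) hs.2).1 h1
  exact hs.1.ne' this

theorem eq_of_exp_ofReal_mul_I_eq {a b : ℝ} (ha : a ∈ Set.Ioo (0 : ℝ) (2 * Real.pi))
    (hb : b ∈ Set.Ioo (0 : ℝ) (2 * Real.pi)) (h : exp (a * I) = exp (b * I)) : a = b := by
  by_contra hab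
  wlog hlt : b < a generalizing a b
  · exact this hb ha h.symm (Ne.symm hab) (lt_of_le_of_ne (not_lt.1 hlt) hab)
  refine exp_ofReal_mul_I_ne_one (s := a - b) ⟨by linarith, by linarith [ha.2, hb.1]⟩ ?_
  rw [Complex.ofReal_sub, sub_mul, Complex.exp_sub, h, div_self (Complex.exp_ne_zero _)]

/-- On `U(1) ∖ {1}`, parametrized by angles in `(0, 2π)`, the relation `z₁ > z₂` is the order of the
angles. -/
theorem rotGT_exp_iff {a b : ℝ} (ha : a ∈ Set.Ioo (0 : ℝ) (2 * Real.pi))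
    (hb : b ∈ Set.Ioo (0 : ℝ) (2 * Real.pi)) : RotGT (exp (a * I)) (exp (b * I)) ↔ b < a := by
  have hadd : ∀ s : ℝ, exp (s * I) * exp (b * I) = exp ((s + b : ℝ) * I) := fun s => by
    rw [← Complex.exp_add]; push_cast; ring_nf
  constructor
  · rintro ⟨-, t, ht, hab, hne⟩
    have htb : t < 2 * Real.pi - b := by
      by_contra! hcon
      refine hne (2 * Real.pi - b) ⟨by linarith [hb.2], hcon⟩ ?_
      rw [hadd, sub_add_cancel]
      push_cast
      exact Complex.exp_two_pi_mul_I
    rw [hadd] at hab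
    have := eq_of_exp_ofReal_mul_I_eq ha ⟨by linarith [hb.1], by linarith⟩ hab
    linarith
  · intro hlt
    refine ⟨Complex.norm_exp_ofReal_mul_I b, a - b, by linarith, ?_, fun s hs => ?_⟩
    · rw [hadd, sub_add_cancel]
    · rw [hadd]
      exact exp_ofReal_mul_I_ne_one ⟨by linarith [hs.1, hb.1], by linarith [hs.2, ha.2]⟩

theorem not_rotGT_one (z : ℂ) : ¬ RotGT z 1 := by
  rintro ⟨-, t, ht, -, hne⟩
  exact hne 0 ⟨le_rfl, ht.le⟩ (by simp)

theorem cos_lt_cos_of_lt_two_pi_sub {x δ : ℝ} (hδ : 0 < δ) (hx : δ < x)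
    (hx2 : x < 2 * Real.pi - δ) : Real.cos x < Real.cos δ := by
  rcases le_or_gt x Real.pi with h | h
  · exact Real.cos_lt_cos_of_nonneg_of_le_pi hδ.le h hx
  · rw [← Real.cos_two_pi_sub x]
    exact Real.cos_lt_cos_of_nonneg_of_le_pi hδ.le (by linarith) (by linarith)

theorem norm_exp_sub_exp_sq (s m : ℝ) :
    ‖exp (s * I) - exp (m * I)‖ ^ 2 = 2 - 2 * Real.cos (s - m) := by
  rw [← Complex.normSq_eq_norm_sq, Complex.normSq_apply, Complex.sub_re, Complex.sub_im,
    Complex.exp_ofReal_mul_I_re, Complex.exp_ofReal_mul_I_re, Complex.exp_ofReal_mul_I_im,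
    Complex.exp_ofReal_mul_I_im, Real.cos_sub]
  nlinarith [Real.sin_sq_add_cos_sq s, Real.sin_sq_add_cos_sq m]

theorem norm_exp_sub_exp_lt_iff {s t m : ℝ} :
    ‖exp (s * I) - exp (m * I)‖ < ‖exp (t * I) - exp (m * I)‖ ↔
      Real.cos (t - m) < Real.cos (s - m) := by
  rw [← sq_lt_sq₀ (norm_nonneg _) (norm_nonneg _), norm_exp_sub_exp_sq, norm_exp_sub_exp_sq]
  constructor <;> intro h <;> linarith

/-- A disc that cuts the arc between `z₁` and `z₂` out of the unit circle. -/
structure IsArcDisc (z₁ z₂ c : ℂ) (r : ℝ) : Prop where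
  pos : 0 < r
  one_notMem : (1 : ℂ) ∉ Metric.closedBall c r
  eq_of_mem_sphere : ∀ μ : ℂ, ‖μ‖ = 1 → μ ∈ Metric.sphere c r → μ = z₁ ∨ μ = z₂
  /-- Points of the circle that are not close to the end points are between `z₁` and `z₂` exactly if
  they are between two slightly rotated end points. -/
  rotate : ∀ η > 0, ∃ ε > 0, ∀ α β : ℝ, |α| < ε → |β| < ε → ∀ μ : ℂ, ‖μ‖ = 1 →
    η ≤ ‖μ - z₁‖ → η ≤ ‖μ - z₂‖ →
    (RotGT (z₁ * exp (α * I)) μ ∧ RotGT μ (z₂ * exp (β * I)) ↔ μ ∈ Metric.ball c r)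

/-- The disc is centred at the midpoint of the arc, and its boundary passes through the end points. -/
theorem exists_isArcDisc {z₁ z₂ : ℂ} (h₁ : ‖z₁‖ = 1) (h₂ : ‖z₂‖ = 1) (h₁' : z₁ ≠ 1)
    (h₂' : z₂ ≠ 1) (h : RotGT z₁ z₂) : ∃ c r, IsArcDisc z₁ z₂ c r := by
  obtain ⟨a, ha, rfl⟩ := exists_angle h₁ h₁'
  obtain ⟨b, hb, rfl⟩ := exists_angle h₂ h₂'
  have hba := (rotGT_exp_iff ha hb).1 h
  obtain ⟨m, hm⟩ : ∃ m, m = (a + b) / 2 := ⟨_, rfl⟩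
  obtain ⟨δ, hδ⟩ : ∃ δ, δ = (a - b) / 2 := ⟨_, rfl⟩
  have hδ0 : 0 < δ := by linarith
  have hδπ : δ < Real.pi := by linarith [ha.2, hb.1]
  have ham : a - m = δ := by linarith
  -- the distance to the midpoint is monotone in the angular distance `|s - m|`, up to `2π - δ`
  have hr : ∀ s, s ∈ Set.Ico (0 : ℝ) (2 * Real.pi) →
      (‖exp (s * I) - exp (m * I)‖ < ‖exp (a * I) - exp (m * I)‖ ↔ b < s ∧ s < a) ∧
      (‖exp (a * I) - exp (m * I)‖ < ‖exp (s * I) - exp (m * I)‖ ↔ s < b ∨ a < s) := by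
    intro s hs
    rw [norm_exp_sub_exp_lt_iff, norm_exp_sub_exp_lt_iff, ham, ← Real.cos_abs (s - m)]
    have hs2 : |s - m| < 2 * Real.pi - δ := by
      rw [abs_lt]; constructor <;> linarith [hs.1, hs.2, ha.2, hb.1]
    have e1 : |s - m| < δ ↔ b < s ∧ s < a := by
      rw [abs_lt]; constructor <;> rintro ⟨h1, h2⟩ <;> constructor <;> linarith
    have e2 : δ < |s - m| ↔ s < b ∨ a < s := by
      rw [lt_abs]
      constructor
      · rintro (h | h)
        · right; linarith
        · left; linarith
      · rintro (h | h)
        · right; linarith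
        · left; linarith
    rw [← e1, ← e2]
    rcases lt_trichotomy |s - m| δ with hc | hc | hc
    · have := Real.cos_lt_cos_of_nonneg_of_le_pi (abs_nonneg (s - m)) hδπ.le hc
      exact ⟨⟨fun _ => hc, fun _ => this⟩, ⟨fun h => absurd h this.not_gt, fun h =>
        absurd h hc.not_gt⟩⟩
    · simp [hc]
    · have := cos_lt_cos_of_lt_two_pi_sub hδ0 hc hs2
      exact ⟨⟨fun h => absurd h this.not_gt, fun h => absurd h hc.not_gt⟩,
        ⟨fun _ => hc, fun _ => this⟩⟩
  have hone : ‖exp (a * I) - exp (m * I)‖ < ‖1 - exp (m * I)‖ := by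
    have := (hr 0 ⟨le_rfl, by positivity⟩).2.2 (Or.inl hb.1)
    simpa using this
  refine ⟨exp (m * I), ‖exp (a * I) - exp (m * I)‖, ?_, ?_, ?_, ?_⟩
  · rw [norm_pos_iff, sub_ne_zero]
    intro h
    have := eq_of_exp_ofReal_mul_I_eq ha ⟨by linarith [hb.1], by linarith [ha.2]⟩ h
    linarith
  · rw [mem_closedBall_iff_norm]
    exact not_le.2 hone
  · intro μ hμ hs
    rw [mem_sphere_iff_norm] at hs
    have hμ1 : μ ≠ 1 := by
      rintro rfl
      exact hone.ne' hs
    obtain ⟨s, hs', rfl⟩ := exists_angle hμ hμ1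
    have hs'' := hr s ⟨hs'.1.le, hs'.2⟩
    simp only [hs, lt_irrefl, false_iff, not_and_or, not_or, not_lt] at hs''
    obtain ⟨h1 | h1, h2, h3⟩ := hs''
    · right; rw [le_antisymm h1 h2]
    · left; rw [le_antisymm h3 h1]
  · intro η hη
    -- the rotated end points keep angles in `(0, 2π)` and do not pass `μ`
    let ε := min η (min (min a (2 * Real.pi - a)) (min b (2 * Real.pi - b)))
    have hε : 0 < ε := by
      have := ha.1; have := ha.2; have := hb.1; have := hb.2
      simp only [ε, lt_min_iff]
      refine ⟨?_, ⟨?_, ?_⟩, ?_, ?_⟩ <;> linarith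
    have hεη : ε ≤ η := min_le_left _ _
    have hε1 : ε ≤ a := (min_le_right _ _).trans ((min_le_left _ _).trans (min_le_left _ _))
    have hε2 : ε ≤ 2 * Real.pi - a :=
      (min_le_right _ _).trans ((min_le_left _ _).trans (min_le_right _ _))
    have hε3 : ε ≤ b := (min_le_right _ _).trans ((min_le_right _ _).trans (min_le_left _ _))
    have hε4 : ε ≤ 2 * Real.pi - b :=
      (min_le_right _ _).trans ((min_le_right _ _).trans (min_le_right _ _))
    refine ⟨ε, hε, fun α β hα hβ μ hμ h1 h2 => ?_⟩
    rw [mem_ball_iff_norm]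
    by_cases hμ1 : μ = 1
    · subst hμ1
      exact ⟨fun h => absurd h.1 (not_rotGT_one _), fun h => absurd h hone.not_gt⟩
    obtain ⟨s, hs, rfl⟩ := exists_angle hμ hμ1
    have hdist : ∀ t : ℝ, ‖exp (s * I) - exp (t * I)‖ ≤ |s - t| := fun t => by
      have h := Real.norm_exp_I_mul_ofReal_sub_one_le (x := s - t)
      have : exp (s * I) - exp (t * I) = exp (t * I) * (exp (I * (s - t : ℝ)) - 1) := by
        rw [mul_sub, ← Complex.exp_add, mul_one]
        push_cast
        ring_nf
      rw [this, norm_mul, Complex.norm_exp_ofReal_mul_I, one_mul]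
      exact h
    have hsa : ε ≤ |s - a| := hεη.trans (h1.trans (hdist a))
    have hsb : ε ≤ |s - b| := hεη.trans (h2.trans (hdist b))
    rw [abs_lt] at hα hβ
    have e : ∀ t u : ℝ, exp (t * I) * exp (u * I) = exp ((t + u : ℝ) * I) := fun t u => by
      rw [← Complex.exp_add]; push_cast; ring_nf
    rw [e, e, rotGT_exp_iff ⟨by linarith, by linarith⟩ hs,
      rotGT_exp_iff hs ⟨by linarith, by linarith⟩, (hr s ⟨hs.1.le, hs.2⟩).1, and_comm]
    rw [le_abs] at hsa hsb
    constructor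
    · rintro ⟨h3, h4⟩
      constructor
      · rcases hsb with h | h <;> linarith
      · rcases hsa with h | h <;> linarith
    · rintro ⟨h3, h4⟩
      constructor
      · rcases hsb with h | h <;> linarith
      · rcases hsa with h | h <;> linarith

end Arcs

/-! ### Riesz projections of unitary operators -/

section Riesz

variable {H : Type*} [NormedAddCommGroup H] [InnerProductSpace ℂ H]

theorem resolvent_mul_sub {h : H →L[ℂ] H} {ξ : ℂ} (hξ : ξ ∉ spectrum ℂ h) :
    resolvent h ξ * (ξ • 1 - h) = 1 := by
  rw [resolvent, Algebra.algebraMap_eq_smul_one]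
  refine Ring.inverse_mul_cancel _ ?_
  have := spectrum.notMem_iff.1 hξ
  rwa [Algebra.algebraMap_eq_smul_one] at this

theorem sub_mul_resolvent {h : H →L[ℂ] H} {ξ : ℂ} (hξ : ξ ∉ spectrum ℂ h) :
    (ξ • 1 - h) * resolvent h ξ = 1 := by
  rw [resolvent, Algebra.algebraMap_eq_smul_one]
  refine Ring.mul_inverse_cancel _ ?_
  have := spectrum.notMem_iff.1 hξ
  rwa [Algebra.algebraMap_eq_smul_one] at this

theorem resolvent_apply_of_eigen {h : H →L[ℂ] H} {ξ μ : ℂ} (hξ : ξ ∉ spectrum ℂ h) {v : H}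
    (hv : h v = μ • v) (hne : ξ ≠ μ) : resolvent h ξ v = (ξ - μ)⁻¹ • v := by
  have h1 : (ξ • 1 - h) v = (ξ - μ) • v := by simp [hv, sub_smul]
  have h2 : resolvent h ξ ((ξ • 1 - h) v) = v := by
    rw [← mul_apply_eq_comp, resolvent_mul_sub hξ]; rfl
  rw [h1, map_smul] at h2
  rw [← h2, smul_smul, inv_mul_cancel₀ (sub_ne_zero.2 hne), one_smul, h2]

theorem mem_spectrum_of_eigen {h : H →L[ℂ] H} {μ : ℂ} {v : H} (hv : h v = μ • v) (hv0 : v ≠ 0) :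
    μ ∈ spectrum ℂ h := by
  by_contra hμ
  have h1 : (μ • 1 - h) v = 0 := by simp [hv]
  have h2 : resolvent h μ ((μ • 1 - h) v) = v := by
    rw [← mul_apply_eq_comp, resolvent_mul_sub hμ]; rfl
  rw [h1, map_zero] at h2
  exact hv0 h2.symm

theorem apply_mem_closure_iSup_eigenspace {ι : Type*} (m : ι → ℂ) {h T : H →L[ℂ] H}
    (hT : ∀ (μ : ℂ) (v : H), h v = μ • v → ∃ ν : ℂ, T v = ν • v) {v : H}
    (hv : v ∈ (⨆ i, Module.End.eigenspace (h : H →ₗ[ℂ] H) (m i)).topologicalClosure) :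
    T v ∈ (⨆ i, Module.End.eigenspace (h : H →ₗ[ℂ] H) (m i)).topologicalClosure := by
  set K := ⨆ i, Module.End.eigenspace (h : H →ₗ[ℂ] H) (m i)
  have h1 : K ≤ K.comap (T : H →ₗ[ℂ] H) := iSup_le fun i w hw => by
    obtain ⟨ν, hν⟩ := hT (m i) w (by simpa using hw)
    have : w ∈ K := Submodule.mem_iSup_of_mem i hw
    simpa [hν] using K.smul_mem ν this
  have h2 : K.topologicalClosure ≤ K.topologicalClosure.comap (T : H →ₗ[ℂ] H) :=
    K.topologicalClosure_minimal (h1.trans (Submodule.comap_mono K.le_topologicalClosure))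
      (K.isClosed_topologicalClosure.preimage T.continuous)
  exact h2 hv

variable [CompleteSpace H]

theorem ContinuousLinearMap.map_circleIntegral {E F : Type*} [NormedAddCommGroup E]
    [NormedSpace ℂ E] [CompleteSpace E] [NormedAddCommGroup F] [NormedSpace ℂ F] [CompleteSpace F]
    (L : E →L[ℂ] F) {f : ℂ → E} {c : ℂ} {r : ℝ} (hf : CircleIntegrable f c r) :
    L (∮ ξ in C(c, r), f ξ) = ∮ ξ in C(c, r), L (f ξ) := by
  rw [circleIntegral, circleIntegral, ← L.intervalIntegral_comp_comm hf.out]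
  simp

/-- The Riesz integral `(2πi)⁻¹ ∮ (ξ - h)⁻¹ dξ` over a circle. -/
noncomputable def rieszIntegral (c : ℂ) (r : ℝ) (h : H →L[ℂ] H) : H →L[ℂ] H :=
  (2 * Real.pi * Complex.I)⁻¹ • ∮ ξ in C(c, r), resolvent h ξ

/-- The sum of the eigenspaces of `h` for the eigenvalues in a disc. -/
def discSpace (c : ℂ) (r : ℝ) (h : H →L[ℂ] H) : Submodule ℂ H :=
  ⨆ μ : {μ : ℂ // μ ∈ Metric.ball c r}, Module.End.eigenspace (h : H →ₗ[ℂ] H) (μ : ℂ)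

theorem continuousOn_resolvent {h : H →L[ℂ] H} {s : Set ℂ} (hs : ∀ ξ ∈ s, ξ ∉ spectrum ℂ h) :
    ContinuousOn (resolvent h) s := fun ξ hξ =>
  (spectrum.hasDerivAt_resolvent_const_left
    (spectrum.notMem_iff.1 (hs ξ hξ))).continuousAt.continuousWithinAt

theorem norm_eq_one_of_mem_spectrum_unitary {h : H →L[ℂ] H} (hu : h ∈ unitary (H →L[ℂ] H)) {μ : ℂ}
    (hμ : μ ∈ spectrum ℂ h) : ‖μ‖ = 1 :=
  mem_sphere_zero_iff_norm.1 (spectrum.subset_circle_of_unitary hu hμ)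

/-- Eigenvectors of a unitary operator are eigenvectors of its adjoint. -/
theorem star_apply_of_eigen {h : H →L[ℂ] H} (hu : h ∈ unitary (H →L[ℂ] H)) {μ : ℂ} {v : H}
    (hv : h v = μ • v) : star h v = μ⁻¹ • v := by
  by_cases hv0 : v = 0
  · simp [hv0]
  have hμ : μ ≠ 0 := by
    have := norm_eq_one_of_mem_spectrum_unitary hu (mem_spectrum_of_eigen hv hv0)
    rintro rfl
    simp at this
  have h1 : star h (h v) = v := by
    rw [← mul_apply_eq_comp, (Unitary.mem_iff.1 hu).1]; rfl
  rw [hv, map_smul] at h1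
  rw [← h1, smul_smul, inv_mul_cancel₀ hμ, one_smul, h1]

/-- The orthogonal projection onto a closed sum of eigenspaces of a unitary operator commutes with
the operator. -/
theorem commute_starProjection_iSup_eigenspace {ι : Type*} (m : ι → ℂ) {h : H →L[ℂ] H}
    (hu : h ∈ unitary (H →L[ℂ] H)) :
    Commute (⨆ i, Module.End.eigenspace (h : H →ₗ[ℂ] H) (m i)).topologicalClosure.starProjection
      h := by
  set K := (⨆ i, Module.End.eigenspace (h : H →ₗ[ℂ] H) (m i)).topologicalClosure with hK
  ext x
  change K.starProjection (h x) = h (K.starProjection x)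
  refine Submodule.eq_starProjection_of_mem_orthogonal
    (apply_mem_closure_iSup_eigenspace m (fun μ v hv => ⟨μ, hv⟩)
      (K.starProjection_apply_mem x)) ?_
  rw [← map_sub, Submodule.mem_orthogonal]
  intro w hw
  have h1 := apply_mem_closure_iSup_eigenspace (T := star h) m
    (fun μ v hv => ⟨_, star_apply_of_eigen hu hv⟩) hw
  have h2 := Submodule.inner_right_of_mem_orthogonal h1 (K.sub_starProjection_mem_orthogonal x)
  rwa [ContinuousLinearMap.star_eq_adjoint, ContinuousLinearMap.adjoint_inner_left] at h2

variable {c : ℂ} {r : ℝ} {h : H →L[ℂ] H}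

theorem rieszIntegral_apply_of_eigen (hs : ∀ ξ ∈ Metric.sphere c r, ξ ∉ spectrum ℂ h)
    (hr : 0 < r) {μ : ℂ} (hμ : μ ∈ Metric.ball c r) {v : H} (hv : h v = μ • v) :
    rieszIntegral c r h v = v := by
  have hint : CircleIntegrable (resolvent h) c r :=
    (continuousOn_resolvent hs).circleIntegrable hr.le
  have h1 : (∮ ξ in C(c, r), resolvent h ξ) v = ∮ ξ in C(c, r), resolvent h ξ v :=
    (ContinuousLinearMap.apply ℂ H v).map_circleIntegral hint
  have h2 : ∮ ξ in C(c, r), resolvent h ξ v = ∮ ξ in C(c, r), (ξ - μ)⁻¹ • v :=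
    circleIntegral.integral_congr hr.le fun ξ hξ =>
      resolvent_apply_of_eigen (hs ξ hξ) hv fun h => by
        rw [h, mem_sphere_iff_norm] at hξ
        rw [mem_ball_iff_norm] at hμ
        exact hμ.ne hξ
  rw [rieszIntegral, smul_apply, h1, h2, circleIntegral.integral_smul_const,
    circleIntegral.integral_sub_inv_of_mem_ball hμ, smul_smul, inv_mul_cancel₀ (by simp), one_smul]

/-- The Riesz integral of a unitary operator that differs from `1` by a compact operator is the
orthogonal projection onto the sum of the eigenspaces inside the circle. The complementary part of
`h`, extended by `1`, has no eigenvalue in the closed disc, hence by the Fredholm alternative a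
holomorphic resolvent there, so that it does not contribute to the integral. -/
theorem rieszIntegral_eq_starProjection (hr : 0 < r) (h1 : (1 : ℂ) ∉ Metric.closedBall c r)
    (hu : h ∈ unitary (H →L[ℂ] H)) (hc : IsCompactOperator (h - 1 : H →L[ℂ] H))
    (hs : ∀ ξ ∈ Metric.sphere c r, ξ ∉ spectrum ℂ h) :
    rieszIntegral c r h = (discSpace c r h).topologicalClosure.starProjection := by
  set K := (discSpace c r h).topologicalClosure with hK
  set P := K.starProjection with hP
  have hPh : P * h = h * P :=
    commute_starProjection_iSup_eigenspace (fun μ : {μ : ℂ // μ ∈ Metric.ball c r} => (μ : ℂ)) hu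
  have hPP : P * P = P := K.isIdempotentElem_starProjection
  have hint : CircleIntegrable (resolvent h) c r :=
    (continuousOn_resolvent hs).circleIntegrable hr.le
  -- on the closed sum of the eigenspaces the integral is the identity
  have hon : ∀ v ∈ K, rieszIntegral c r h v = v := by
    have h3 : K ≤ LinearMap.eqLocus (rieszIntegral c r h : H →ₗ[ℂ] H) LinearMap.id := by
      refine Submodule.topologicalClosure_minimal _ (iSup_le fun μ v hv => ?_) ?_
      · exact rieszIntegral_apply_of_eigen hs hr μ.2 (by simpa using hv)
      · exact isClosed_eq (rieszIntegral c r h).continuous continuous_id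
    exact fun v hv => h3 hv
  -- the complementary part of `h`, extended by `1`
  set M : H →L[ℂ] H := (h - 1) * (1 - P) with hM
  have hMc : IsCompactOperator M := hc.comp_clm (1 - P)
  have hPM : P * M = 0 := by
    rw [hM]
    calc P * ((h - 1) * (1 - P)) = (h - 1) * (P - P * P) + (P * h - h * P) * (1 - P) := by
          noncomm_ring
      _ = 0 := by rw [hPP, hPh]; simp
  have hMs : ∀ ξ ∈ Metric.closedBall c r, ξ ∉ spectrum ℂ (1 + M) := by
    intro ξ hξ
    have hξ1 : ξ - 1 ≠ 0 := by
      rw [sub_ne_zero]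
      rintro rfl
      exact h1 hξ
    have hres : ξ - 1 ∈ resolventSet ℂ M := by
      refine (hMc.hasEigenvalue_or_mem_resolventSet hξ1).resolve_left fun hev => ?_
      obtain ⟨v, hv, hv0⟩ := hev.exists_hasEigenvector
      have hv' : M v = (ξ - 1) • v := by simpa using hv
      have hPv : P v = 0 := by
        have h4 : P (M v) = 0 := by rw [← mul_apply_eq_comp, hPM]; rfl
        rw [hv', map_smul] at h4
        exact (smul_eq_zero.1 h4).resolve_left hξ1
      have hhv : h v = ξ • v := by
        have : M v = h v - v := by simp [hM, hPv]
        rw [this, sub_smul, one_smul] at hv'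
        simpa using hv'
      rcases (Metric.mem_closedBall.1 hξ).lt_or_eq with hlt | heq
      · have hvK : v ∈ K := (discSpace c r h).le_topologicalClosure
          (Submodule.mem_iSup_of_mem ⟨ξ, hlt⟩ (by simpa using hhv))
        exact hv0 ((K.starProjection_eq_self_iff.2 hvK).symm.trans hPv)
      · exact hs ξ heq (mem_spectrum_of_eigen hhv hv0)
    rw [spectrum.notMem_iff]
    have : algebraMap ℂ (H →L[ℂ] H) ξ - (1 + M) = algebraMap ℂ (H →L[ℂ] H) (ξ - 1) - M := by
      rw [map_sub, map_one]; abel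
    rw [this]
    exact hres
  have hz : ∮ ξ in C(c, r), resolvent (1 + M) ξ = 0 :=
    Complex.circleIntegral_eq_zero_of_differentiable_on_off_countable hr.le Set.countable_empty
      (continuousOn_resolvent hMs) fun ξ hξ =>
        (spectrum.hasDerivAt_resolvent_const_left (spectrum.notMem_iff.1
          (hMs ξ (Metric.ball_subset_closedBall hξ.1)))).differentiableAt
  have hR : ∀ ξ ∈ Metric.sphere c r,
      resolvent h ξ * (1 - P) = resolvent (1 + M) ξ * (1 - P) := by
    intro ξ hξ
    have hξ' := hMs ξ (Metric.sphere_subset_closedBall hξ)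
    have h5 : (ξ • 1 - (1 + M)) * (1 - P) = (1 - P) * (ξ • 1 - h) := by
      rw [hM]
      have e1 : (ξ • 1 - (1 + (h - 1) * (1 - P))) * (1 - P) =
          ξ • (1 - P) - (1 - P) - (h - 1) * (1 - P - P + P * P) := by
        rw [sub_mul, smul_mul_assoc]; noncomm_ring
      have e2 : (1 - P) * (ξ • 1 - h) = ξ • (1 - P) - h + P * h := by
        rw [mul_sub, mul_smul_comm]; noncomm_ring
      rw [e1, e2, hPP, hPh]
      noncomm_ring
    have h6 : (ξ • 1 - h) * (1 - P) = (1 - P) * (ξ • 1 - h) := by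
      have e1 : (ξ • 1 - h) * (1 - P) = ξ • (1 - P) - h + h * P := by
        rw [sub_mul, smul_mul_assoc]; noncomm_ring
      have e2 : (1 - P) * (ξ • 1 - h) = ξ • (1 - P) - h + P * h := by
        rw [mul_sub, mul_smul_comm]; noncomm_ring
      rw [e1, e2, hPh]
    have h7 : resolvent h ξ * (1 - P) = (1 - P) * resolvent h ξ :=
      calc resolvent h ξ * (1 - P)
          = resolvent h ξ * ((1 - P) * (ξ • 1 - h)) * resolvent h ξ := by
            rw [mul_assoc, mul_assoc, sub_mul_resolvent (hs ξ hξ), mul_one]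
        _ = (1 - P) * resolvent h ξ := by
            rw [← h6, ← mul_assoc, resolvent_mul_sub (hs ξ hξ), one_mul]
    calc resolvent h ξ * (1 - P)
        = resolvent (1 + M) ξ * ((ξ • 1 - (1 + M)) * (1 - P)) * resolvent h ξ := by
          rw [← mul_assoc, resolvent_mul_sub hξ', one_mul, h7]
      _ = resolvent (1 + M) ξ * (1 - P) := by
          rw [h5, mul_assoc, mul_assoc, sub_mul_resolvent (hs ξ hξ), mul_one]
  have hQ : rieszIntegral c r h * (1 - P) = 0 := by
    have hint' : CircleIntegrable (resolvent (1 + M)) c r :=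
      (continuousOn_resolvent fun ξ hξ =>
        hMs ξ (Metric.sphere_subset_closedBall hξ)).circleIntegrable hr.le
    have e1 := ((ContinuousLinearMap.mul ℂ (H →L[ℂ] H)).flip (1 - P)).map_circleIntegral hint
    have e2 := ((ContinuousLinearMap.mul ℂ (H →L[ℂ] H)).flip (1 - P)).map_circleIntegral hint'
    simp only [ContinuousLinearMap.flip_apply, ContinuousLinearMap.mul_apply'] at e1 e2
    rw [rieszIntegral, smul_mul_assoc, e1, circleIntegral.integral_congr hr.le hR, ← e2, hz,
      zero_mul, smul_zero]
  ext v
  have h7 : rieszIntegral c r h v - rieszIntegral c r h (P v) = 0 := by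
    simpa using congrArg (fun T : H →L[ℂ] H => T v) hQ
  rw [sub_eq_zero.1 h7, hon _ (K.starProjection_apply_mem v)]

/-- If `h - 1` is Hilbert-Schmidt, so is the Riesz projection, since `(ξ - 1)⁻¹ (ξ - h)⁻¹ (h - 1)`
differs from `(ξ - h)⁻¹` by a function that is holomorphic in the disc. -/
theorem isHilbertSchmidt_rieszIntegral (hr : 0 < r) (h1 : (1 : ℂ) ∉ Metric.closedBall c r)
    (hc : IsHilbertSchmidt (h - 1)) (hs : ∀ ξ ∈ Metric.sphere c r, ξ ∉ spectrum ℂ h) :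
    IsHilbertSchmidt (rieszIntegral c r h) := by
  have hne : ∀ ξ ∈ Metric.closedBall c r, ξ - 1 ≠ 0 := fun ξ hξ => by
    rw [sub_ne_zero]
    rintro rfl
    exact h1 hξ
  have hinv : ContinuousOn (fun ξ : ℂ => (ξ - 1)⁻¹) (Metric.closedBall c r) :=
    (continuousOn_id.sub continuousOn_const).inv₀ hne
  have hinv' := hinv.mono Metric.sphere_subset_closedBall
  have hres := continuousOn_resolvent hs
  have hz : ∮ ξ in C(c, r), ((ξ - 1)⁻¹ • (1 : H →L[ℂ] H)) = 0 := by
    rw [circleIntegral.integral_smul_const,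
      Complex.circleIntegral_eq_zero_of_differentiable_on_off_countable hr.le Set.countable_empty
        hinv fun ξ hξ => ?_, zero_smul]
    exact (differentiableAt_id.sub (differentiableAt_const _)).inv
      (hne ξ (Metric.ball_subset_closedBall hξ.1))
  have hint : CircleIntegrable (fun ξ => (ξ - 1)⁻¹ • resolvent h ξ) c r :=
    (hinv'.smul hres).circleIntegrable hr.le
  have e1 := ((ContinuousLinearMap.mul ℂ (H →L[ℂ] H)).flip (h - 1)).map_circleIntegral hint
  simp only [ContinuousLinearMap.flip_apply, ContinuousLinearMap.mul_apply'] at e1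
  have e2 : ∀ ξ ∈ Metric.sphere c r, ((ξ - 1)⁻¹ • resolvent h ξ) * (h - 1) =
      resolvent h ξ - (ξ - 1)⁻¹ • 1 := fun ξ hξ => by
    have h2 : resolvent h ξ * (h - 1) = (ξ - 1) • resolvent h ξ - 1 := by
      have h3 : h - 1 = (ξ - 1) • 1 - (ξ • 1 - h) := by rw [sub_smul, one_smul]; abel
      conv_lhs => rw [h3, mul_sub, resolvent_mul_sub (hs ξ hξ), mul_smul_comm, mul_one]
    rw [smul_mul_assoc, h2, smul_sub, smul_smul,
      inv_mul_cancel₀ (hne ξ (Metric.sphere_subset_closedBall hξ)), one_smul]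
  have e3 : (∮ ξ in C(c, r), (ξ - 1)⁻¹ • resolvent h ξ) * (h - 1) =
      ∮ ξ in C(c, r), resolvent h ξ := by
    have hint2 : CircleIntegrable (fun ξ => (ξ - 1)⁻¹ • (1 : H →L[ℂ] H)) c r :=
      (hinv'.smul continuousOn_const).circleIntegrable hr.le
    rw [e1, circleIntegral.integral_congr hr.le e2,
      circleIntegral.integral_sub (hres.circleIntegrable hr.le) hint2, hz, sub_zero]
  rw [rieszIntegral, ← e3, ← smul_mul_assoc]
  exact hc.mul_left _

end Riesz

/-! ### Smooth dependence of the projection on the point -/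

noncomputable section Smooth

section CircleAlgebra

variable (A : Type*) [NormedRing A] [NormedAlgebra ℂ A] (c : ℂ) (r : ℝ)

/-- The point with parameter `θ` of the circle. -/
def circlePoint (hr : 0 ≤ r) : C(ℝ, Metric.sphere c r) where
  toFun θ := ⟨circleMap c r θ, circleMap_mem_sphere c hr θ⟩
  continuous_toFun := (continuous_circleMap c r).subtype_mk _

/-- Integration over the circle, as a continuous linear functional on the algebra of continuous
functions on the circle. -/
def circleIntegralL (hr : 0 ≤ r) : C(Metric.sphere c r, A) →L[ℂ] A :=
  LinearMap.mkContinuous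
    { toFun := fun F => ∫ θ in (0 : ℝ)..2 * Real.pi,
        deriv (circleMap c r) θ • F (circlePoint c r hr θ)
      map_add' := fun F G => by
        simp only [ContinuousMap.add_apply, smul_add]
        refine intervalIntegral.integral_add ?_ ?_ <;>
        · simp only [deriv_circleMap]
          exact Continuous.intervalIntegrable (by fun_prop) _ _
      map_smul' := fun a F => by
        simp only [ContinuousMap.smul_apply, RingHom.id_apply]
        rw [← intervalIntegral.integral_smul]
        simp only [smul_comm a] } (2 * Real.pi * r) fun F => by
    have h : ∀ θ ∈ Set.uIoc (0 : ℝ) (2 * Real.pi),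
        ‖deriv (circleMap c r) θ • F (circlePoint c r hr θ)‖ ≤ r * ‖F‖ := fun θ _ => by
      rw [norm_smul, deriv_circleMap, norm_mul, norm_circleMap_zero, Complex.norm_I, mul_one,
        abs_of_nonneg hr]
      gcongr
      exact F.norm_coe_le_norm _
    refine (intervalIntegral.norm_integral_le_of_norm_le_const h).trans (le_of_eq ?_)
    rw [sub_zero, abs_of_pos Real.two_pi_pos]
    ring

/-- The function `ξ ↦ ξ - a` on the circle. -/
def circleSub (a : A) : C(Metric.sphere c r, A) where
  toFun ξ := algebraMap ℂ A ξ - a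
  continuous_toFun := by
    have := (algebraMapCLM ℂ A).continuous
    fun_prop

variable {A c r}

theorem contDiff_circleSub : ContDiff ℝ ∞ (circleSub A c r) := by
  have h : IsBoundedLinearMap ℝ fun a : A => ContinuousMap.const (Metric.sphere c r) a :=
    { map_add := fun _ _ => rfl
      map_smul := fun _ _ => rfl
      bound := ⟨1, one_pos, fun a => by
        rw [one_mul]
        exact (ContinuousMap.norm_le _ (norm_nonneg a)).2 fun _ => le_rfl⟩ }
  have h2 : circleSub A c r = fun a =>
      circleSub A c r 0 - ContinuousMap.const (Metric.sphere c r) a := by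
    funext a
    ext ξ
    simp [circleSub]
  rw [h2]
  exact contDiff_const.sub h.contDiff

variable [CompleteSpace A]

/-- The circle integral of the resolvent depends smoothly on the element of the algebra: it is
inversion in the Banach algebra of continuous functions on the circle, at `ξ ↦ ξ - a`, followed by a
continuous linear map. -/
theorem contDiffAt_circleIntegral_resolvent (hr : 0 ≤ r) {a : A}
    (hs : ∀ ξ ∈ Metric.sphere c r, ξ ∉ spectrum ℂ a) :
    (∀ᶠ a' in 𝓝 a, ∀ ξ ∈ Metric.sphere c r, ξ ∉ spectrum ℂ a') ∧
      ContDiffAt ℝ ∞ (fun a => ∮ ξ in C(c, r), resolvent a ξ) a := by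
  have hiff : ∀ a' : A, IsUnit (circleSub A c r a') ↔
      ∀ ξ ∈ Metric.sphere c r, ξ ∉ spectrum ℂ a' := fun a' => by
    rw [ContinuousMap.isUnit_iff_forall_isUnit]
    simp only [spectrum.notMem_iff, Subtype.forall]
    rfl
  have hu : IsUnit (circleSub A c r a) := (hiff a).2 hs
  have hev : ∀ᶠ a' in 𝓝 a, IsUnit (circleSub A c r a') :=
    contDiff_circleSub.continuous.continuousAt.eventually (Units.isOpen.mem_nhds hu)
  refine ⟨hev.mono fun a' => (hiff a').1, ?_⟩
  have h1 : ContDiffAt ℝ ∞ (fun a => circleIntegralL A c r hr (Ring.inverse (circleSub A c r a)))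
      a := by
    have h2 : ContDiffAt ℝ ∞ Ring.inverse (circleSub A c r a) := by
      obtain ⟨u, hu⟩ := hu
      rw [← hu]
      exact contDiffAt_ringInverse ℝ u
    exact ((circleIntegralL A c r hr).restrictScalars ℝ).contDiff.contDiffAt.comp a
      (h2.comp a contDiff_circleSub.contDiffAt)
  refine h1.congr_of_eventuallyEq (hev.mono fun a' ha' => ?_)
  simp only [circleIntegral]
  refine intervalIntegral.integral_congr fun θ _ => ?_
  obtain ⟨u, hu⟩ := ha'
  change deriv (circleMap c r) θ • Ring.inverse (circleSub A c r a' (circlePoint c r hr θ)) =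
    deriv (circleMap c r) θ • (Ring.inverse (circleSub A c r a')) (circlePoint c r hr θ)
  congr 1
  rw [← hu, Ring.inverse_unit]
  exact Ring.inverse_unit (Units.map ((Pi.evalMonoidHom (fun _ => A) (circlePoint c r hr θ)).comp
    (ContinuousMap.coeFnMonoidHom (α := Metric.sphere c r) (β := A))) u)

end CircleAlgebra

section Chart

variable {H : Type*} [NormedAddCommGroup H] [InnerProductSpace ℂ H] [CompleteSpace H]

theorem contDiffAt_rieszIntegral {c : ℂ} {r : ℝ} (hr : 0 ≤ r) {h : H →L[ℂ] H}
    (hs : ∀ ξ ∈ Metric.sphere c r, ξ ∉ spectrum ℂ h) :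
    ContDiffAt ℝ ∞ (rieszIntegral c r) h :=
  (contDiffAt_circleIntegral_resolvent hr hs).2.const_smul _

theorem eventually_le_norm_sub_of_notMem_spectrum {g : H →L[ℂ] H} {z : ℂ}
    (hz : z ∉ spectrum ℂ g) :
    ∃ η > 0, ∀ᶠ h in 𝓝 g, ∀ μ ∈ spectrum ℂ h, η ≤ ‖μ - z‖ := by
  have hc : Continuous fun q : ℂ × (H →L[ℂ] H) => algebraMap ℂ (H →L[ℂ] H) q.1 - q.2 :=
    ((algebraMapCLM ℂ (H →L[ℂ] H)).continuous.comp continuous_fst).sub continuous_snd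
  have h1 : ∀ᶠ q : ℂ × (H →L[ℂ] H) in 𝓝 (z, g), q.1 ∉ spectrum ℂ q.2 := by
    have h2 := (hc.tendsto (z, g)).eventually
      (Units.isOpen.mem_nhds (spectrum.notMem_iff.1 hz))
    exact h2.mono fun q hq => spectrum.notMem_iff.2 hq
  rw [nhds_prod_eq, Filter.eventually_prod_iff] at h1
  obtain ⟨p, hp, q, hq, hpq⟩ := h1
  obtain ⟨η, hη, hball⟩ := Metric.eventually_nhds_iff.1 hp
  refine ⟨η, hη, hq.mono fun h hh μ hμ => ?_⟩
  by_contra! hlt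
  exact hpq (hball (by rwa [dist_eq_norm])) hh hμ

theorem fibreProj_eq_of_fibre_eq {y : ℂ × ℂ × (H →L[ℂ] H)} {K : Submodule ℂ H}
    (h : fibre y = K) : fibreProj y = K.topologicalClosure.starProjection := by
  subst h
  rfl

theorem isIdempotentElem_fibreProj (y : ℂ × ℂ × (H →L[ℂ] H)) :
    fibreProj y * fibreProj y = fibreProj y :=
  (fibre y).topologicalClosure.isIdempotentElem_starProjection

/-- A Hilbert-Schmidt projection has finite rank. -/
theorem finiteDimensional_of_isHilbertSchmidt_starProjection {K : Submodule ℂ H}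
    [K.HasOrthogonalProjection] (hK : IsClosed (K : Set H))
    (h : IsHilbertSchmidt K.starProjection) : FiniteDimensional ℂ K := by
  have h1 := (h.isCompactOperator.comp_clm K.subtypeL).codRestrict
    (V := K) (fun x => K.starProjection_apply_mem _) hK
  refine FiniteDimensional.of_isCompactOperator_id (𝕜 := ℂ) ?_
  have h2 : (id : K → K) = Set.codRestrict (K.starProjection ∘ K.subtypeL) K
      (fun x => K.starProjection_apply_mem _) :=
    funext fun x => Subtype.ext (K.starProjection_eq_self_iff.2 x.2).symm
  rw [h2]
  exact h1

theorem fibre_eq_range_of_isHilbertSchmidt {y : ℂ × ℂ × (H →L[ℂ] H)}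
    (h : IsHilbertSchmidt (fibreProj y)) :
    FiniteDimensional ℂ (fibre y) ∧ ∀ v, v ∈ fibre y ↔ fibreProj y v = v := by
  have h1 : FiniteDimensional ℂ (fibre y).topologicalClosure :=
    finiteDimensional_of_isHilbertSchmidt_starProjection (fibre y).isClosed_topologicalClosure h
  have h2 : FiniteDimensional ℂ (fibre y) :=
    Submodule.finiteDimensional_of_le (fibre y).le_topologicalClosure
  refine ⟨h2, fun v => ?_⟩
  have h3 : (fibre y).topologicalClosure = fibre y :=
    (fibre y).closed_of_finiteDimensional.submodule_topologicalClosure_eq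
  rw [fibreProj, Submodule.starProjection_eq_self_iff, h3]

variable {V : Type*} [NormedAddCommGroup V] [NormedSpace ℝ V] (ι : V →L[ℝ] (H →L[ℂ] H))

theorem expChart_zero (y : ℂ × ℂ × (H →L[ℂ] H)) : expChart ι y 0 = y := by
  simp [expChart]

theorem contDiff_expChart_grp (y : ℂ × ℂ × (H →L[ℂ] H)) :
    ContDiff ℝ ∞ fun x => (expChart ι y x).2.2 := by
  have h1 : ContDiff ℝ ∞ (NormedSpace.exp : (H →L[ℂ] H) → (H →L[ℂ] H)) :=
    contDiff_iff_contDiffAt.2 fun x => (NormedSpace.exp_analytic (𝕂 := ℝ) x).contDiffAt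
  have h2 : ContDiff ℝ ∞ fun x : ℝ × ℝ × V => ι x.2.2 :=
    ι.contDiff.comp (contDiff_snd.comp contDiff_snd)
  exact contDiff_const.mul (h1.comp h2)

theorem dGrp_eq (y : ℂ × ℂ × (H →L[ℂ] H)) (v : ℝ × ℝ × V) :
    dGrp ι y v = y.2.2 * ι v.2.2 := by
  have h2 : HasFDerivAt (fun x : ℝ × ℝ × V => ι x.2.2)
      (ι.comp ((ContinuousLinearMap.snd ℝ ℝ V).comp (ContinuousLinearMap.snd ℝ ℝ (ℝ × V)))) 0 :=
    (ι.comp ((ContinuousLinearMap.snd ℝ ℝ V).comp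
      (ContinuousLinearMap.snd ℝ ℝ (ℝ × V)))).hasFDerivAt
  have h1 : HasFDerivAt (NormedSpace.exp : (H →L[ℂ] H) → (H →L[ℂ] H))
      (1 : (H →L[ℂ] H) →L[ℝ] (H →L[ℂ] H)) (ι (0 : ℝ × ℝ × V).2.2) := by
    simpa using hasFDerivAt_exp_zero (𝕂 := ℝ) (𝔸 := H →L[ℂ] H)
  have h3 := (HasFDerivAt.comp (f := fun x : ℝ × ℝ × V => ι x.2.2) 0 h1 h2).const_mul y.2.2
  have h4 : HasFDerivAt (fun x : ℝ × ℝ × V => (expChart ι y x).2.2) _ 0 := h3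
  rw [dGrp, h4.fderiv]
  rfl

variable {ι} {z₁ z₂ : ℂ} {g : H →L[ℂ] H}

theorem expChart_grp_mem_unitary (hskew : ∀ X, star (ι X) = -ι X)
    (hg : g ∈ unitary (H →L[ℂ] H)) (x : ℝ × ℝ × V) :
    (expChart ι (z₁, z₂, g) x).2.2 ∈ unitary (H →L[ℂ] H) :=
  letI : NormedAlgebra ℚ (H →L[ℂ] H) := NormedAlgebra.restrictScalars ℚ ℂ (H →L[ℂ] H)
  mul_mem hg (NormedSpace.exp_mem_unitary_of_mem_skewAdjoint
    (skewAdjoint.mem_iff.2 (hskew x.2.2)))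

theorem isHilbertSchmidt_expChart_grp_sub_one (hHS : ∀ X, IsHilbertSchmidt (ι X))
    (hg : IsHilbertSchmidt (g - 1)) (x : ℝ × ℝ × V) :
    IsHilbertSchmidt ((expChart ι (z₁, z₂, g) x).2.2 - 1) := by
  have h : (expChart ι (z₁, z₂, g) x).2.2 - 1 =
      g * (NormedSpace.exp (ι x.2.2) - 1) + (g - 1) := by
    simp only [expChart]
    noncomm_ring
  rw [h]
  exact ((hHS _).exp_sub_one.mul_left g).add hg

/-- Near a point of `Y^{[2]}_+` the fibre is the sum of the eigenspaces in a fixed disc. -/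
theorem eventually_fibre_expChart_eq {c : ℂ} {r : ℝ} (hd : IsArcDisc z₁ z₂ c r)
    (hskew : ∀ X, star (ι X) = -ι X) (hg : g ∈ unitary (H →L[ℂ] H)) (hz₁ : z₁ ∉ spectrum ℂ g)
    (hz₂ : z₂ ∉ spectrum ℂ g) :
    ∀ᶠ x in 𝓝 (0 : ℝ × ℝ × V), fibre (expChart ι (z₁, z₂, g) x) =
      discSpace c r (expChart ι (z₁, z₂, g) x).2.2 := by
  have hcont : Filter.Tendsto (fun x => (expChart ι (z₁, z₂, g) x).2.2)
      (𝓝 (0 : ℝ × ℝ × V)) (𝓝 g) := by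
    have := (contDiff_expChart_grp ι (z₁, z₂, g)).continuous.tendsto 0
    rwa [expChart_zero] at this
  obtain ⟨η₁, hη₁, h₁⟩ := eventually_le_norm_sub_of_notMem_spectrum hz₁
  obtain ⟨η₂, hη₂, h₂⟩ := eventually_le_norm_sub_of_notMem_spectrum hz₂
  obtain ⟨ε, hε, hrot⟩ := hd.rotate (min η₁ η₂) (lt_min hη₁ hη₂)
  have ha : ∀ᶠ x in 𝓝 (0 : ℝ × ℝ × V), |x.1| < ε :=
    (continuous_fst.abs.tendsto 0).eventually (gt_mem_nhds (by simpa using hε))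
  have hb : ∀ᶠ x in 𝓝 (0 : ℝ × ℝ × V), |x.2.1| < ε :=
    ((continuous_fst.comp continuous_snd).abs.tendsto 0).eventually
      (gt_mem_nhds (by simpa using hε))
  filter_upwards [hcont.eventually h₁, hcont.eventually h₂, ha, hb] with x hx₁ hx₂ hxa hxb
  have hu := expChart_grp_mem_unitary (z₁ := z₁) (z₂ := z₂) hskew hg x
  have key : ∀ (μ : ℂ) (v : H), v ≠ 0 → (expChart ι (z₁, z₂, g) x).2.2 v = μ • v →
      (RotGT (expChart ι (z₁, z₂, g) x).1 μ ∧ RotGT μ (expChart ι (z₁, z₂, g) x).2.1 ↔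
        μ ∈ Metric.ball c r) := fun μ v hv0 hv => by
    have hμ := mem_spectrum_of_eigen hv hv0
    exact hrot x.1 x.2.1 hxa hxb μ (norm_eq_one_of_mem_spectrum_unitary hu hμ)
      ((min_le_left _ _).trans (hx₁ μ hμ)) ((min_le_right _ _).trans (hx₂ μ hμ))
  refine le_antisymm (iSup_le fun μ v hv => ?_) (iSup_le fun μ v hv => ?_)
  · by_cases hv0 : v = 0
    · rw [hv0]; exact zero_mem _
    exact Submodule.mem_iSup_of_mem ⟨μ.1, (key μ v hv0 (by simpa using hv)).1 μ.2⟩ hv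
  · by_cases hv0 : v = 0
    · rw [hv0]; exact zero_mem _
    exact Submodule.mem_iSup_of_mem ⟨μ.1, (key μ v hv0 (by simpa using hv)).2 μ.2⟩ hv

/-- Near a point of `Y^{[2]}_+` the projection `P` is smooth, Hilbert-Schmidt and commutes with the
group element. -/
theorem eventually_contDiffAt_fibreProj (hskew : ∀ X, star (ι X) = -ι X)
    (hHS : ∀ X, IsHilbertSchmidt (ι X)) (hg : g ∈ unitary (H →L[ℂ] H))
    (hg1 : IsHilbertSchmidt (g - 1)) (hy : IsPositivePoint z₁ z₂ g) :
    ∀ᶠ x in 𝓝 (0 : ℝ × ℝ × V),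
      ContDiffAt ℝ ∞ (fun x => fibreProj (expChart ι (z₁, z₂, g) x)) x ∧
      IsHilbertSchmidt (fibreProj (expChart ι (z₁, z₂, g) x)) ∧
      Commute (fibreProj (expChart ι (z₁, z₂, g) x)) (expChart ι (z₁, z₂, g) x).2.2 := by
  obtain ⟨c, r, hd⟩ := exists_isArcDisc hy.norm_left hy.norm_right hy.left_ne_one
    hy.right_ne_one hy.gt
  have hsg : ∀ ξ ∈ Metric.sphere c r, ξ ∉ spectrum ℂ g := fun ξ hξ hspec => by
    rcases hd.eq_of_mem_sphere ξ (norm_eq_one_of_mem_spectrum_unitary hg hspec) hξ with h | h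
    · exact hy.left_notMem (h ▸ hspec)
    · exact hy.right_notMem (h ▸ hspec)
  have hsm := contDiff_expChart_grp ι (z₁, z₂, g)
  have hcont : Filter.Tendsto (fun x => (expChart ι (z₁, z₂, g) x).2.2)
      (𝓝 (0 : ℝ × ℝ × V)) (𝓝 g) := by
    have := hsm.continuous.tendsto 0
    rwa [expChart_zero] at this
  have hs := hcont.eventually (contDiffAt_circleIntegral_resolvent hd.pos.le hsg).1
  have hfib := eventually_fibre_expChart_eq hd hskew hg hy.left_notMem hy.right_notMem
  have hP : ∀ᶠ x in 𝓝 (0 : ℝ × ℝ × V), fibreProj (expChart ι (z₁, z₂, g) x) =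
      rieszIntegral c r (expChart ι (z₁, z₂, g) x).2.2 := by
    filter_upwards [hs, hfib] with x hx hfx
    rw [fibreProj_eq_of_fibre_eq hfx, rieszIntegral_eq_starProjection hd.pos hd.one_notMem
      (expChart_grp_mem_unitary hskew hg x)
      (isHilbertSchmidt_expChart_grp_sub_one hHS hg1 x).isCompactOperator hx]
  filter_upwards [hs, hP, hP.eventually_nhds] with x hx hPx hPx'
  refine ⟨?_, ?_, ?_⟩
  · have h := (contDiffAt_rieszIntegral hd.pos.le hx).comp x hsm.contDiffAt
    exact h.congr_of_eventuallyEq hPx'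
  · rw [hPx]
    exact isHilbertSchmidt_rieszIntegral hd.pos hd.one_notMem
      (isHilbertSchmidt_expChart_grp_sub_one hHS hg1 x) hx
  · exact commute_starProjection_iSup_eigenspace _ (expChart_grp_mem_unitary hskew hg x)

end Chart

end Smooth

/-! ### The curvature of the determinant connection -/

noncomputable section DetCurvature

theorem AlternatingMap.map_update_sum_smul {M N : Type*} [AddCommGroup M] [Module ℂ M]
    [AddCommGroup N] [Module ℂ N] {k : ℕ} (f : M [⋀^Fin k]→ₗ[ℂ] N) (s : Fin k → M) (i : Fin k)
    (a : Fin k → ℂ) : f (Function.update s i (∑ j, a j • s j)) = a i • f s := by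
  rw [f.map_update_sum, Finset.sum_eq_single i]
  · rw [f.map_update_smul, Function.update_eq_self]
  · intro j _ hj
    rw [f.map_update_smul, f.map_update_self s hj.symm, smul_zero]
  · simp

variable {H : Type*} [NormedAddCommGroup H] [InnerProductSpace ℂ H]

/-- A tuple of vectors as a linear map on coordinate vectors. -/
def tupleMap {k : ℕ} : (Fin k → H) →L[ℂ] (Fin k → ℂ) →L[ℂ] H :=
  ∑ i, ((ContinuousLinearMap.smulRightL ℂ (Fin k → ℂ) H)
    (ContinuousLinearMap.proj (R := ℂ) (φ := fun _ : Fin k => ℂ) i)).comp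
      (ContinuousLinearMap.proj (R := ℂ) (φ := fun _ : Fin k => H) i)

theorem tupleMap_apply {k : ℕ} (s : Fin k → H) (a : Fin k → ℂ) :
    tupleMap s a = ∑ i, a i • s i := by
  simp [tupleMap]

theorem tupleMap_single {k : ℕ} (s : Fin k → H) (i : Fin k) :
    tupleMap s (Pi.single i 1) = s i := by
  rw [tupleMap_apply, Finset.sum_eq_single i] <;> simp +contextual

theorem tupleMap_ext {k : ℕ} {F : Type*} [NormedAddCommGroup F] [NormedSpace ℂ F]
    {S T : (Fin k → ℂ) →L[ℂ] F} (h : ∀ i, S (Pi.single i 1) = T (Pi.single i 1)) : S = T :=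
  ContinuousLinearMap.coe_injective ((Pi.basisFun ℂ (Fin k)).ext fun i => by simpa using h i)

/-- The pairing `(L, S) ↦ tr (L S)`. -/
def tracePairing (H : Type*) [NormedAddCommGroup H] [InnerProductSpace ℂ H] (k : ℕ) :
    (H →L[ℂ] (Fin k → ℂ)) →L[ℝ] ((Fin k → ℂ) →L[ℂ] H) →L[ℝ] ℂ :=
  (((ContinuousLinearMap.compL ℂ ((Fin k → ℂ) →L[ℂ] H) ((Fin k → ℂ) →L[ℂ] (Fin k → ℂ)) ℂ)
    (LinearMap.toContinuousLinearMap ((LinearMap.trace ℂ (Fin k → ℂ)) ∘ₗ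
      (ContinuousLinearMap.coeLM ℂ)))).comp
    (ContinuousLinearMap.compL ℂ (Fin k → ℂ) H (Fin k → ℂ))).bilinearRestrictScalars ℝ

theorem tracePairing_apply {k : ℕ} (L : H →L[ℂ] (Fin k → ℂ)) (S : (Fin k → ℂ) →L[ℂ] H) :
    tracePairing H k L S = LinearMap.trace ℂ (Fin k → ℂ)
      (L.comp S : (Fin k → ℂ) →L[ℂ] (Fin k → ℂ)) := rfl

theorem tracePairing_eq_sum {k : ℕ} (L : H →L[ℂ] (Fin k → ℂ)) (S : (Fin k → ℂ) →L[ℂ] H) :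
    tracePairing H k L S = ∑ i, L (S (Pi.single i 1)) i := by
  rw [tracePairing_apply, LinearMap.trace_eq_matrix_trace ℂ (Pi.basisFun ℂ (Fin k)), Matrix.trace]
  exact Finset.sum_congr rfl fun j _ => by simp

theorem tracePairing_comp_comm {k : ℕ} (L L' : H →L[ℂ] (Fin k → ℂ))
    (S S' : (Fin k → ℂ) →L[ℂ] H) :
    tracePairing H k (L.comp (S.comp L')) S' = tracePairing H k (L'.comp (S'.comp L)) S := by
  have := LinearMap.trace_mul_comm ℂ (L.comp S : (Fin k → ℂ) →ₗ[ℂ] (Fin k → ℂ))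
    (L'.comp S' : (Fin k → ℂ) →ₗ[ℂ] (Fin k → ℂ))
  exact this

/-- If `L` is a left inverse of the frame `s`, and `w` is a tuple in the span of `s`, the
derivation action of `s ↦ w` on `s₁ ∧ ⋯ ∧ s_k` is multiplication by `tr (L w)`. -/
theorem sum_ιMulti_update {k : ℕ} {s w : Fin k → H} {L : H →L[ℂ] (Fin k → ℂ)}
    (hL : L.comp (tupleMap s) = ContinuousLinearMap.id ℂ _)
    (hw : ∀ i, w i ∈ Submodule.span ℂ (Set.range s)) :
    ∑ i, exteriorPower.ιMulti ℂ k (Function.update s i (w i)) =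
      tracePairing H k L (tupleMap w) • exteriorPower.ιMulti ℂ k s := by
  rw [tracePairing_eq_sum, Finset.sum_smul]
  refine Finset.sum_congr rfl fun i _ => ?_
  obtain ⟨a, ha⟩ := (Submodule.mem_span_range_iff_exists_fun ℂ).1 (hw i)
  have h1 : L (w i) = a := by
    rw [← ha, ← tupleMap_apply, ← ContinuousLinearMap.comp_apply, hL]; rfl
  rw [tupleMap_single, h1, ← ha, AlternatingMap.map_update_sum_smul]

theorem ιMulti_ne_zero {k : ℕ} {s : Fin k → H} {L : H →L[ℂ] (Fin k → ℂ)}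
    (hL : L.comp (tupleMap s) = ContinuousLinearMap.id ℂ _) :
    exteriorPower.ιMulti ℂ k s ≠ 0 := by
  intro h0
  let f : H [⋀^Fin k]→ₗ[ℂ] ℂ := (Pi.basisFun ℂ (Fin k)).det.compLinearMap (L : H →ₗ[ℂ] _)
  have h1 : exteriorPower.alternatingMapLinearEquiv f (exteriorPower.ιMulti ℂ k s) = f s :=
    exteriorPower.alternatingMapLinearEquiv_apply_ιMulti f s
  have h2 : f s = 1 := by
    have h3 : (fun i => L (s i)) = Pi.basisFun ℂ (Fin k) := by
      funext i
      rw [← tupleMap_single s i, ← ContinuousLinearMap.comp_apply, hL]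
      simp
    change (Pi.basisFun ℂ (Fin k)).det (fun i => L (s i)) = 1
    rw [h3, Module.Basis.det_self]
  rw [h0, map_zero, h2] at h1
  exact zero_ne_one h1

/-- A linearly independent tuple has a continuous left inverse. -/
theorem exists_comp_tupleMap_eq_id [CompleteSpace H] {k : ℕ} {s : Fin k → H}
    (hs : LinearIndependent ℂ s) :
    ∃ L : H →L[ℂ] (Fin k → ℂ), L.comp (tupleMap s) = ContinuousLinearMap.id ℂ _ := by
  have : FiniteDimensional ℂ (Submodule.span ℂ (Set.range s)) :=
    FiniteDimensional.span_of_finite ℂ (Set.finite_range s)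
  let b := Module.Basis.span hs
  refine ⟨(b.equivFunL : _ →L[ℂ] _).comp
    (Submodule.span ℂ (Set.range s)).orthogonalProjectionOnto, tupleMap_ext fun i => ?_⟩
  have h1 : s i = (b i : H) := by simp [b, Module.Basis.span_apply]
  rw [ContinuousLinearMap.comp_apply, tupleMap_single, ContinuousLinearMap.comp_apply, h1,
    Submodule.orthogonalProjectionOnto_mem_subspace_eq_self]
  ext j
  simp [Pi.single_apply, Finsupp.single_apply, eq_comm]

end DetCurvature

noncomputable section DetCurvatureFormula

theorem fderiv_bilinear_of_eventuallyEq {W E F G : Type*} [NormedAddCommGroup W] [NormedSpace ℝ W]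
    [NormedAddCommGroup E] [NormedSpace ℝ E] [NormedAddCommGroup F] [NormedSpace ℝ F]
    [NormedAddCommGroup G] [NormedSpace ℝ G] (B : E →L[ℝ] F →L[ℝ] G) {f : W → E} {g : W → F}
    {h : W → G} {x : W} (hf : DifferentiableAt ℝ f x) (hg : DifferentiableAt ℝ g x)
    (hh : h =ᶠ[𝓝 x] fun x => B (f x) (g x)) (u : W) :
    B (f x) (fderiv ℝ g x u) + B (fderiv ℝ f x u) (g x) = fderiv ℝ h x u := by
  rw [hh.fderiv_eq, (B.hasFDerivAt_of_bilinear hf.hasFDerivAt hg.hasFDerivAt).fderiv]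
  rfl

theorem fderiv_bilinear_comp_fderiv {W E F G : Type*} [NormedAddCommGroup W] [NormedSpace ℝ W]
    [NormedAddCommGroup E] [NormedSpace ℝ E] [NormedAddCommGroup F] [NormedSpace ℝ F]
    [NormedAddCommGroup G] [NormedSpace ℝ G] (B : E →L[ℝ] F →L[ℝ] G) {f : W → E} {g : W → F}
    {A : W → W →L[ℝ] G} {x : W} (hf : DifferentiableAt ℝ f x)
    (hg : DifferentiableAt ℝ (fderiv ℝ g) x)
    (hA : A =ᶠ[𝓝 x] fun x => (B (f x)).comp (fderiv ℝ g x)) :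
    DifferentiableAt ℝ A x ∧ ∀ u v, fderiv ℝ A x u v =
      B (f x) (fderiv ℝ (fderiv ℝ g) x u v) + B (fderiv ℝ f x u) (fderiv ℝ g x v) := by
  have h1 : HasFDerivAt (fun x => B (f x)) (B.comp (fderiv ℝ f x)) x :=
    B.hasFDerivAt.comp x hf.hasFDerivAt
  have h2 := (h1.clm_comp hg.hasFDerivAt).congr_of_eventuallyEq hA
  exact ⟨h2.differentiableAt, fun u v => by rw [h2.fderiv]; rfl⟩

/-- Composition of complex linear maps, as a real bilinear map. -/
def compBilin (E F G : Type*) [NormedAddCommGroup E] [NormedSpace ℂ E]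
    [NormedAddCommGroup F] [NormedSpace ℂ F] [NormedAddCommGroup G] [NormedSpace ℂ G] :
    (F →L[ℂ] G) →L[ℝ] (E →L[ℂ] F) →L[ℝ] (E →L[ℂ] G) :=
  (ContinuousLinearMap.compL ℂ E F G).bilinearRestrictScalars ℝ

theorem ContDiffAt.compBilin {W E F G : Type*} [NormedAddCommGroup W] [NormedSpace ℝ W]
    [NormedAddCommGroup E] [NormedSpace ℂ E]
    [NormedAddCommGroup F] [NormedSpace ℂ F] [NormedAddCommGroup G] [NormedSpace ℂ G]
    {S : W → F →L[ℂ] G} {T : W → E →L[ℂ] F} {x : W} {n : ℕ∞ω} (hS : ContDiffAt ℝ n S x)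
    (hT : ContDiffAt ℝ n T x) : ContDiffAt ℝ n (fun x => (S x).comp (T x)) x :=
  (_root_.compBilin E F G).isBoundedBilinearMap.contDiff.contDiffAt.comp x (hS.prodMk hT)

variable {H : Type*} [NormedAddCommGroup H] [InnerProductSpace ℂ H]
  {W : Type*} [NormedAddCommGroup W] [NormedSpace ℝ W]

theorem contDiffAt_tupleMap {k : ℕ} {s : Fin k → W → H} {x : W}
    (hs : ∀ i, ContDiffAt ℝ ∞ (s i) x) :
    ContDiffAt ℝ ∞ (fun x => tupleMap fun i => s i x) x :=
  ((tupleMap (H := H) (k := k)).restrictScalars ℝ).contDiff.contDiffAt.comp x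
    (contDiffAt_pi.2 hs)

theorem fderiv_tupleMap {k : ℕ} {s : Fin k → W → H} {x : W}
    (hs : ∀ i, ContDiffAt ℝ ∞ (s i) x) (v : W) :
    fderiv ℝ (fun x => tupleMap fun i => s i x) x v = tupleMap fun i => fderiv ℝ (s i) x v := by
  have h1 : HasFDerivAt (fun x i => s i x) (ContinuousLinearMap.pi fun i => fderiv ℝ (s i) x) x :=
    hasFDerivAt_pi.2 fun i => ((hs i).differentiableAt (by simp)).hasFDerivAt
  have h2 := ((tupleMap (H := H) (k := k)).restrictScalars ℝ).hasFDerivAt.comp x h1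
  have h3 : HasFDerivAt (fun x => tupleMap fun i => s i x) _ x := h2
  rw [h3.fderiv]
  rfl

variable [CompleteSpace H]

/-- The structure equation for the determinant connection. With the frame `S`, a smooth left inverse
`L` such that `L P = L`, and `S L = P`, the connection form is `tr (L dS)`, and its differential is
`tr (dL dS) = tr (P dP dP)`. -/
theorem fderiv_detConnForm {P : W → H →L[ℂ] H} (hP : ContDiffAt ℝ ∞ P 0)
    (hPP : ∀ᶠ x in 𝓝 (0 : W), P x * P x = P x) {k : ℕ} {s : Fin k → W → H}
    (hs : ∀ᶠ x in 𝓝 (0 : W), ∀ i, ContDiffAt ℝ ∞ (s i) x)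
    (hli : LinearIndependent ℂ fun i => s i 0)
    (hspan : ∀ᶠ x in 𝓝 (0 : W), ∀ v,
      v ∈ Submodule.span ℂ (Set.range fun i => s i x) ↔ P x v = v)
    {A : W → W →L[ℝ] ℂ}
    (hA : ∀ᶠ x in 𝓝 (0 : W), ∀ v, ∑ i, exteriorPower.ιMulti ℂ k
      (Function.update (fun j => s j x) i (P x (fderiv ℝ (s i) x v))) =
        A x v • exteriorPower.ιMulti ℂ k (fun j => s j x)) :
    DifferentiableAt ℝ A 0 ∧ ∃ (L : H →L[ℂ] (Fin k → ℂ)) (S : (Fin k → ℂ) →L[ℂ] H),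
      L.comp S = ContinuousLinearMap.id ℂ _ ∧ S.comp L = P 0 ∧ ∀ u v,
      fderiv ℝ A 0 u v - fderiv ℝ A 0 v u = tracePairing H k
        (L.comp (fderiv ℝ P 0 u * fderiv ℝ P 0 v - fderiv ℝ P 0 v * fderiv ℝ P 0 u)) S := by
  obtain ⟨L₀, hL₀⟩ := exists_comp_tupleMap_eq_id hli
  set S : W → (Fin k → ℂ) →L[ℂ] H := fun x => tupleMap fun i => s i x with hSdef
  have hS : ContDiffAt ℝ ∞ S 0 := contDiffAt_tupleMap hs.self_of_nhds
  -- a smooth left inverse of the frame that vanishes on the kernel of `P`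
  let D : W → (Fin k → ℂ) →L[ℂ] (Fin k → ℂ) := fun x => L₀.comp (S x)
  have hD : ContDiffAt ℝ ∞ D 0 := contDiffAt_const.compBilin hS
  have hD0 : D 0 = 1 := hL₀
  have hDu : ∀ᶠ x in 𝓝 (0 : W), IsUnit (D x) :=
    hD.continuousAt.eventually (Units.isOpen.mem_nhds (by rw [hD0]; exact isUnit_one))
  let L : W → H →L[ℂ] (Fin k → ℂ) := fun x => (Ring.inverse (D x)).comp (L₀.comp (P x))
  have hL : ContDiffAt ℝ ∞ L 0 := by
    have h1 : ContDiffAt ℝ ∞ (fun x => Ring.inverse (D x)) 0 := by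
      have h2 : ContDiffAt ℝ ∞ Ring.inverse (D 0) := by
        rw [hD0]
        exact contDiffAt_ringInverse ℝ (1 : ((Fin k → ℂ) →L[ℂ] (Fin k → ℂ))ˣ)
      exact h2.comp (0 : W) hD
    exact h1.compBilin (contDiffAt_const.compBilin hP)
  have hPS : ∀ᶠ x in 𝓝 (0 : W), (P x).comp (S x) = S x := by
    filter_upwards [hspan] with x hx
    refine tupleMap_ext fun i => ?_
    rw [ContinuousLinearMap.comp_apply, hSdef, tupleMap_single]
    exact (hx _).1 (Submodule.subset_span (Set.mem_range_self i))
  have hLS : ∀ᶠ x in 𝓝 (0 : W), (L x).comp (S x) = ContinuousLinearMap.id ℂ _ := by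
    filter_upwards [hPS, hDu] with x hx hux
    change (Ring.inverse (D x)).comp (L₀.comp ((P x).comp (S x))) = _
    rw [hx]
    exact Ring.inverse_mul_cancel _ hux
  have hLP : ∀ᶠ x in 𝓝 (0 : W), (L x).comp (P x) = L x := by
    filter_upwards [hPP] with x hx
    change (Ring.inverse (D x)).comp (L₀.comp (P x * P x)) = _
    rw [hx]
  have hSL : (S 0).comp (L 0) = P 0 := by
    ext w
    have h1 : P 0 w ∈ Submodule.span ℂ (Set.range fun i => s i 0) :=
      (hspan.self_of_nhds _).2 (by
        rw [← mul_apply_eq_comp, hPP.self_of_nhds])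
    obtain ⟨a, ha⟩ := (Submodule.mem_span_range_iff_exists_fun ℂ).1 h1
    have h2 : S 0 a = P 0 w := by rw [hSdef, ← ha]; exact tupleMap_apply _ _
    have h3 : L 0 w = a := by
      rw [← hLP.self_of_nhds, ContinuousLinearMap.comp_apply, ← h2,
        ← ContinuousLinearMap.comp_apply, hLS.self_of_nhds]
      rfl
    rw [ContinuousLinearMap.comp_apply, h3, h2]
  -- the connection form
  have hAeq : A =ᶠ[𝓝 0] fun x => (tracePairing H k (L x)).comp (fderiv ℝ S x) := by
    filter_upwards [hs, hspan, hPP, hA, hLS, hLP] with x hsx hspx hPx hAx hLSx hLPx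
    ext v
    have h1 := sum_ιMulti_update (s := fun j => s j x) (L := L x)
      (w := fun i => P x (fderiv ℝ (s i) x v)) hLSx (fun i => (hspx _).2 (by
        rw [← mul_apply_eq_comp, hPx]))
    rw [hAx v] at h1
    have h2 := smul_left_injective ℂ (ιMulti_ne_zero hLSx) h1
    rw [h2, ContinuousLinearMap.comp_apply, hSdef, fderiv_tupleMap hsx, tracePairing_eq_sum,
      tracePairing_eq_sum]
    refine Finset.sum_congr rfl fun i _ => ?_
    rw [tupleMap_single, tupleMap_single, ← ContinuousLinearMap.comp_apply, hLPx]
  have hLd : DifferentiableAt ℝ L 0 := hL.differentiableAt (by simp)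
  have hSd : DifferentiableAt ℝ S 0 := hS.differentiableAt (by simp)
  have hPd : DifferentiableAt ℝ P 0 := hP.differentiableAt (by simp)
  have hS2 : DifferentiableAt ℝ (fderiv ℝ S) 0 :=
    (hS.fderiv_right (m := ∞) (by simp)).differentiableAt (by simp)
  obtain ⟨hAd, hfA⟩ := fderiv_bilinear_comp_fderiv (tracePairing H k) hLd hS2 hAeq
  refine ⟨hAd, L 0, S 0, hLS.self_of_nhds, hSL, fun u v => ?_⟩
  have hsymm : fderiv ℝ (fderiv ℝ S) 0 u v = fderiv ℝ (fderiv ℝ S) 0 v u :=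
    (hS.isSymmSndFDerivAt (by
      rw [minSmoothness_of_isRCLikeNormedField]
      exact WithTop.coe_le_coe.2 (le_top : (2 : ℕ∞) ≤ ⊤))).eq u v
  -- the differentiated relations `P S = S`, `L P = L`, `L S = 1`
  have r1 : ∀ u, (fderiv ℝ P 0 u).comp (S 0) = fderiv ℝ S 0 u - (P 0).comp (fderiv ℝ S 0 u) :=
    fun u => eq_sub_of_add_eq' (fderiv_bilinear_of_eventuallyEq (compBilin (Fin k → ℂ) H H) hPd hSd
      (hPS.mono fun _ h => h.symm) u)
  have r2 : ∀ u, (L 0).comp (fderiv ℝ P 0 u) = fderiv ℝ L 0 u - (fderiv ℝ L 0 u).comp (P 0) :=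
    fun u => eq_sub_of_add_eq (fderiv_bilinear_of_eventuallyEq (compBilin H H (Fin k → ℂ)) hLd hPd
      (hLP.mono fun _ h => h.symm) u)
  have r3 : ∀ u, (fderiv ℝ L 0 u).comp (S 0) = -(L 0).comp (fderiv ℝ S 0 u) := fun u => by
    have h1 := fderiv_bilinear_of_eventuallyEq (h := fun _ => ContinuousLinearMap.id ℂ (Fin k → ℂ))
      (compBilin (Fin k → ℂ) H (Fin k → ℂ)) hLd hSd (hLS.mono fun _ h => h.symm) u
    rw [fderiv_fun_const] at h1
    exact (neg_eq_of_add_eq_zero_right h1).symm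
  have hP0 := hPP.self_of_nhds
  have key : ∀ u v, tracePairing H k ((L 0).comp (fderiv ℝ P 0 u * fderiv ℝ P 0 v)) (S 0) =
      tracePairing H k (fderiv ℝ L 0 u) (fderiv ℝ S 0 v) +
        tracePairing H k ((L 0).comp ((fderiv ℝ S 0 u).comp (L 0))) (fderiv ℝ S 0 v) := by
    intro u v
    have e1 : tracePairing H k ((L 0).comp (fderiv ℝ P 0 u * fderiv ℝ P 0 v)) (S 0) =
        tracePairing H k ((L 0).comp (fderiv ℝ P 0 u)) ((fderiv ℝ P 0 v).comp (S 0)) := rfl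
    have e2 : ∀ (M : H →L[ℂ] (Fin k → ℂ)) (T : (Fin k → ℂ) →L[ℂ] H),
        tracePairing H k M ((P 0).comp T) = tracePairing H k (M.comp (P 0)) T := fun _ _ => rfl
    have e3 : ∀ M : H →L[ℂ] (Fin k → ℂ), (M.comp (P 0)).comp (P 0) = M.comp (P 0) := fun M => by
      rw [ContinuousLinearMap.comp_assoc]
      exact congrArg M.comp hP0
    have e4 : (fderiv ℝ L 0 u).comp (P 0) = -(L 0).comp ((fderiv ℝ S 0 u).comp (L 0)) := by
      rw [← hSL, ← ContinuousLinearMap.comp_assoc, r3, ContinuousLinearMap.neg_comp,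
        ContinuousLinearMap.comp_assoc]
    rw [e1, r1, r2, map_sub (tracePairing H k _), e2, map_sub (tracePairing H k), sub_apply,
      ContinuousLinearMap.sub_comp, e3, sub_self, map_zero, zero_apply, sub_zero, e4, map_neg,
      neg_apply, sub_neg_eq_add]
  rw [hfA, hfA, hsymm, ContinuousLinearMap.comp_sub, map_sub (tracePairing H k), sub_apply, key,
    key, tracePairing_comp_comm (L 0) (L 0) (fderiv ℝ S 0 u)]
  abel

end DetCurvatureFormula

noncomputable section ChartCurvature

variable {H : Type*} [NormedAddCommGroup H] [InnerProductSpace ℂ H] [CompleteSpace H]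

/-- A smooth family of projections near `0` has smooth frames: the operators
`T(x) = P(0) P(x) + (1 - P(0)) (1 - P(x))` are invertible near `0` and intertwine `P(x)` with `P(0)`,
so that `T(x)⁻¹` carries a basis of the range of `P(0)` to a basis of the range of `P(x)`. -/
theorem exists_smooth_frame {W : Type*} [NormedAddCommGroup W] [NormedSpace ℝ W]
    {P : W → H →L[ℂ] H} (hP : ∀ᶠ x in 𝓝 (0 : W), ContDiffAt ℝ ∞ P x)
    (hPP : ∀ x, P x * P x = P x) {k : ℕ} {e : Fin k → H} (he : LinearIndependent ℂ e)
    (hspan : ∀ v, v ∈ Submodule.span ℂ (Set.range e) ↔ P 0 v = v) :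
    ∃ (s : Fin k → W → H) (L : W → H →L[ℂ] (Fin k → ℂ)),
      ∀ᶠ x in 𝓝 (0 : W), (∀ i, ContDiffAt ℝ ∞ (s i) x) ∧
      (LinearIndependent ℂ fun i => s i x) ∧
      (∀ v, v ∈ Submodule.span ℂ (Set.range fun i => s i x) ↔ P x v = v) ∧
      (L x).comp (tupleMap fun i => s i x) = ContinuousLinearMap.id ℂ _ := by
  obtain ⟨L₀, hL₀⟩ := exists_comp_tupleMap_eq_id he
  let T : W → H →L[ℂ] H := fun x => P 0 * P x + (1 - P 0) * (1 - P x)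
  have hT : ∀ x, ContDiffAt ℝ ∞ P x → ContDiffAt ℝ ∞ T x := fun x hx =>
    (contDiffAt_const.mul hx).add (contDiffAt_const.mul (contDiffAt_const.sub hx))
  have hT0 : T 0 = 1 := by
    have : T 0 = P 0 * P 0 + (1 - P 0 - P 0 + P 0 * P 0) := by
      simp only [T]; noncomm_ring
    rw [this, hPP]; abel
  have hTu : ∀ᶠ x in 𝓝 (0 : W), IsUnit (T x) :=
    (hT 0 hP.self_of_nhds).continuousAt.eventually
      (Units.isOpen.mem_nhds (by rw [hT0]; exact isUnit_one))
  have hTP : ∀ x, T x * P x = P 0 * T x := fun x => by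
    have e1 : T x * P x = P 0 * (P x * P x) + (1 - P 0) * (P x - P x * P x) := by
      simp only [T]; noncomm_ring
    have e2 : P 0 * T x = P 0 * P 0 * P x + (P 0 - P 0 * P 0) * (1 - P x) := by
      simp only [T]; noncomm_ring
    rw [e1, e2, hPP, hPP, sub_self, sub_self, mul_zero, zero_mul]
  refine ⟨fun i x => Ring.inverse (T x) (e i), fun x => L₀.comp (T x), ?_⟩
  filter_upwards [hP, hTu] with x hPx hux
  have i1 : T x * Ring.inverse (T x) = 1 := Ring.mul_inverse_cancel _ hux
  have i2 : Ring.inverse (T x) * T x = 1 := Ring.inverse_mul_cancel _ hux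
  have i1' : ∀ v, T x (Ring.inverse (T x) v) = v := fun v => by
    rw [← mul_apply_eq_comp, i1]; rfl
  have i2' : ∀ v, Ring.inverse (T x) (T x v) = v := fun v => by
    rw [← mul_apply_eq_comp, i2]; rfl
  have hTP' : ∀ v, T x (P x v) = P 0 (T x v) := fun v => congrArg (fun B : H →L[ℂ] H => B v) (hTP x)
  have hL : (L₀.comp (T x)).comp (tupleMap fun i => Ring.inverse (T x) (e i)) =
      ContinuousLinearMap.id ℂ _ := by
    rw [← hL₀]
    refine tupleMap_ext fun i => ?_
    rw [ContinuousLinearMap.comp_apply, tupleMap_single, ContinuousLinearMap.comp_apply, i1',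
      ContinuousLinearMap.comp_apply, tupleMap_single]
  refine ⟨fun i => ?_, ?_, fun v => ?_, hL⟩
  · have h1 : ContDiffAt ℝ ∞ (fun x => Ring.inverse (T x)) x := by
      have h2 : ContDiffAt ℝ ∞ Ring.inverse (T x) := by
        obtain ⟨u, hu⟩ := hux
        rw [← hu]
        exact contDiffAt_ringInverse ℝ u
      exact h2.comp x (hT x hPx)
    exact ((ContinuousLinearMap.apply ℂ H (e i)).restrictScalars ℝ).contDiff.contDiffAt.comp x h1
  · refine he.map' ((Ring.inverse (T x) : H →L[ℂ] H) : H →ₗ[ℂ] H) (LinearMap.ker_eq_bot.2 ?_)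
    exact Function.LeftInverse.injective i1'
  · have h1 : Submodule.span ℂ (Set.range fun i => Ring.inverse (T x) (e i)) =
        (Submodule.span ℂ (Set.range e)).map ((Ring.inverse (T x) : H →L[ℂ] H) : H →ₗ[ℂ] H) := by
      rw [Submodule.map_span, ← Set.range_comp]
      rfl
    rw [h1, Submodule.mem_map]
    constructor
    · rintro ⟨w, hw, rfl⟩
      have h2 : T x (P x (Ring.inverse (T x) w)) = w := by
        rw [hTP', i1', (hspan w).1 hw]
      have h3 := i2' (P x (Ring.inverse (T x) w))
      rw [h2] at h3
      exact h3.symm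
    · intro hv
      refine ⟨T x v, (hspan _).2 ?_, i2' v⟩
      rw [← hTP', hv]

variable {V : Type*} [NormedAddCommGroup V] [NormedSpace ℝ V] {ι : V →L[ℝ] (H →L[ℂ] H)}
  {z₁ z₂ : ℂ} {g : H →L[ℂ] H}

theorem projForm_eq (y : ℂ × ℂ × (H →L[ℂ] H)) (u v : ℝ × ℝ × V) :
    projForm ι y u v = fibreProj y * (dProj ι y u * dProj ι y v - dProj ι y v * dProj ι y u) := by
  rw [projForm, mul_sub, mul_assoc, mul_assoc]

/-- The curvature of `det ∇` is the trace of `P dP dP`. -/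
theorem isDetCurvature_opTrace_projForm {κ : Type*} (b : HilbertBasis κ ℂ H)
    (hskew : ∀ X, star (ι X) = -ι X) (hHS : ∀ X, IsHilbertSchmidt (ι X))
    (hg : g ∈ unitary (H →L[ℂ] H)) (hg1 : IsHilbertSchmidt (g - 1))
    (hy : IsPositivePoint z₁ z₂ g) :
    IsDetCurvature ι (z₁, z₂, g) (fun u v => opTrace b (projForm ι (z₁, z₂, g) u v)) := by
  have hev := eventually_contDiffAt_fibreProj hskew hHS hg hg1 hy
  set P : ℝ × ℝ × V → H →L[ℂ] H := fun x => fibreProj (expChart ι (z₁, z₂, g) x) with hPdef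
  have hPsm : ∀ᶠ x in 𝓝 (0 : ℝ × ℝ × V), ContDiffAt ℝ ∞ P x := hev.mono fun x hx => hx.1
  have hPP : ∀ x, P x * P x = P x := fun x => isIdempotentElem_fibreProj _
  have hfib : ∀ᶠ x in 𝓝 (0 : ℝ × ℝ × V),
      ∀ v, v ∈ fibre (expChart ι (z₁, z₂, g) x) ↔ P x v = v :=
    hev.mono fun x hx => (fibre_eq_range_of_isHilbertSchmidt hx.2.1).2
  constructor
  · have hfin : FiniteDimensional ℂ (fibre (expChart ι (z₁, z₂, g) 0)) :=
      (fibre_eq_range_of_isHilbertSchmidt hev.self_of_nhds.2.1).1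
    let e₀ := Module.finBasis ℂ (fibre (expChart ι (z₁, z₂, g) 0))
    have he : LinearIndependent ℂ fun i => (e₀ i : H) :=
      e₀.linearIndependent.map' (Submodule.subtype _) (Submodule.ker_subtype _)
    have hspan : Submodule.span ℂ (Set.range fun i => (e₀ i : H)) =
        fibre (expChart ι (z₁, z₂, g) 0) := by
      have h1 := congrArg (Submodule.map (Submodule.subtype _)) e₀.span_eq
      rw [Submodule.map_span, Submodule.map_top, Submodule.range_subtype, ← Set.range_comp] at h1
      exact h1
    obtain ⟨s, L, hsL⟩ := exists_smooth_frame hPsm hPP he fun v => by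
      rw [hspan]; exact hfib.self_of_nhds v
    obtain ⟨U, hU, hUo, hU0⟩ := eventually_nhds_iff.1 (hsL.and hfib)
    refine ⟨U, _, s, fun x => (tracePairing H _ ((L x).comp (P x))).comp
      (fderiv ℝ (fun x => tupleMap fun i => s i x) x), ⟨hUo, hU0, fun i x hx =>
        ((hU x hx).1.1 i).contDiffWithinAt, fun x hx => (hU x hx).1.2.1, fun x hx => ?_⟩,
        fun x hx v => ?_⟩
    · ext v
      rw [(hU x hx).1.2.2.1 v, (hU x hx).2 v]
    · have h1 := sum_ιMulti_update (s := fun j => s j x) (L := L x)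
        (w := fun i => projConn ι (z₁, z₂, g) (s i) x v) (hU x hx).1.2.2.2 (fun i =>
          ((hU x hx).1.2.2.1 _).2 (by
            change P x (P x _) = P x _
            rw [← mul_apply_eq_comp, hPP]))
      rw [h1, ContinuousLinearMap.comp_apply, fderiv_tupleMap (hU x hx).1.1, tracePairing_eq_sum,
        tracePairing_eq_sum]
      congr 1
      refine Finset.sum_congr rfl fun i _ => ?_
      rw [tupleMap_single, tupleMap_single]
      rfl
  · intro U k s A hs hA
    have hUx : ∀ᶠ x in 𝓝 (0 : ℝ × ℝ × V), x ∈ U := hs.isOpen.mem_nhds hs.zero_mem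
    obtain ⟨hAd, L, S, hLS, hSL, hcurv⟩ := fderiv_detConnForm (P := P) (s := s) (A := A)
      hPsm.self_of_nhds (Filter.Eventually.of_forall hPP)
      (hUx.mono fun x hx i => (hs.contDiffOn i).contDiffAt (hs.isOpen.mem_nhds hx))
      (hs.linearIndependent 0 hs.zero_mem)
      (by
        filter_upwards [hUx, hfib] with x hx hfx v
        rw [hs.span_eq x hx, hfx])
      (hUx.mono fun x hx v => hA x hx v)
    refine ⟨hAd, fun u v => ?_⟩
    beta_reduce
    rw [hcurv, projForm_eq]
    have hP0 : fibreProj (z₁, z₂, g) = P 0 := by rw [hPdef]; simp only [expChart_zero]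
    rw [hP0, ← hSL]
    exact (opTrace_comp_eq_trace b S (L.comp _)).tsum_eq

end ChartCurvature

/-! ### Eigenbases of unitary operators -/

section Eigenbasis

universe u v

variable {H : Type*} [NormedAddCommGroup H] [InnerProductSpace ℂ H]

theorem mem_orthogonal_of_forall_hilbertBasis {E : Submodule ℂ H} {κ : Type*}
    (e : HilbertBasis κ ℂ E) {x : H} (hx : ∀ i, inner ℂ (e i : H) x = 0) :
    E ≤ (Submodule.span ℂ {x})ᗮ := by
  have h1 : Submodule.span ℂ (Set.range e) ≤ ((Submodule.span ℂ {x})ᗮ).comap E.subtype := by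
    rw [Submodule.span_le]
    rintro _ ⟨i, rfl⟩
    exact Submodule.mem_orthogonal_singleton_iff_inner_left.2 (hx i)
  have h2 := Submodule.topologicalClosure_minimal _ h1
    ((Submodule.isClosed_orthogonal _).preimage continuous_subtype_val)
  rw [e.dense_span] at h2
  exact fun u hu => h2 (Submodule.mem_top (x := ⟨u, hu⟩))

variable [CompleteSpace H]

theorem inner_apply_of_eigen {g : H →L[ℂ] H} (hu : g ∈ unitary (H →L[ℂ] H)) {μ : ℂ} {v : H}
    (hv : g v = μ • v) (w : H) : inner ℂ v (g w) = μ * inner ℂ v w := by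
  by_cases hv0 : v = 0
  · simp [hv0]
  have hμ := norm_eq_one_of_mem_spectrum_unitary hu (mem_spectrum_of_eigen hv hv0)
  rw [← ContinuousLinearMap.adjoint_inner_left, ← ContinuousLinearMap.star_eq_adjoint,
    star_apply_of_eigen hu hv, inner_smul_left, map_inv₀, ← Complex.inv_eq_conj hμ, inv_inv]

theorem inner_eq_zero_of_eigen {g : H →L[ℂ] H} (hu : g ∈ unitary (H →L[ℂ] H)) {μ ν : ℂ} {v w : H}
    (hv : g v = μ • v) (hw : g w = ν • w) (hne : μ ≠ ν) : inner ℂ v w = 0 := by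
  have h := inner_apply_of_eigen hu hv w
  rw [hw, inner_smul_right] at h
  have h2 : (μ - ν) * inner ℂ v w = 0 := by rw [sub_mul, h, sub_self]
  exact (mul_eq_zero.1 h2).resolve_left (sub_ne_zero.2 hne)

/-- The eigenspaces of a unitary operator that differs from `1` by a compact operator span a dense
subspace: on their orthogonal complement `g - 1` is compact and normal without nonzero eigenvalues,
hence zero. -/
theorem topologicalClosure_iSup_eigenspace_eq_top {g : H →L[ℂ] H}
    (hu : g ∈ unitary (H →L[ℂ] H)) (hc : IsCompactOperator (g - 1 : H →L[ℂ] H)) :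
    (⨆ μ : ℂ, Module.End.eigenspace (g : H →ₗ[ℂ] H) μ).topologicalClosure = ⊤ := by
  set K := (⨆ μ : ℂ, Module.End.eigenspace (g : H →ₗ[ℂ] H) μ).topologicalClosure with hK
  set P := K.starProjection with hP
  have hmem : ∀ (μ : ℂ) (v : H), g v = μ • v → v ∈ K := fun μ v hv =>
    Submodule.le_topologicalClosure _ (Submodule.mem_iSup_of_mem μ (by simpa using hv))
  have hPg : Commute P g := commute_starProjection_iSup_eigenspace (fun μ : ℂ => μ) hu
  have hPs : star P = P := isSelfAdjoint_starProjection K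
  have hPP : P * P = P := K.isIdempotentElem_starProjection
  set M : H →L[ℂ] H := (g - 1) * (1 - P) with hM
  have hMc : IsCompactOperator M := hc.comp_clm (1 - P)
  have hcomm : Commute (1 - P) (g - 1) :=
    ((Commute.one_left g).sub_left hPg).sub_right (Commute.one_right _)
  have hQs : star (1 - P) = 1 - P := by rw [star_sub, star_one, hPs]
  have hcomm' : Commute (star (g - 1)) (1 - P) := by
    have := hcomm.star_star
    rw [hQs] at this
    exact this.symm
  have hN : Commute (star (g - 1)) (g - 1) := by
    have h1 : Commute (star g) g := by
      rw [Commute, SemiconjBy, (Unitary.mem_iff.1 hu).1, (Unitary.mem_iff.1 hu).2]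
    rw [star_sub, star_one]
    exact (h1.sub_left (Commute.one_left g)).sub_right (Commute.one_right _)
  have hMn : IsStarNormal M := ⟨by
    rw [hM, star_mul, hQs]
    exact (hcomm.mul_right (Commute.refl _)).mul_left (hN.mul_right hcomm')⟩
  have hPM : P * M = 0 := by
    have : P * M = (g - 1) * (P - P * P) := by
      rw [hM, ← mul_assoc, (hPg.sub_right (Commute.one_right P)).eq]; noncomm_ring
    rw [this, hPP, sub_self, mul_zero]
  have hspec : ∀ ν ∈ spectrum ℂ M, ν = 0 := by
    intro ν hν
    by_contra hν0
    obtain ⟨v, hv, hv0⟩ := ((hMc.hasEigenvalue_iff_mem_spectrum hν0).2 hν).exists_hasEigenvector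
    have hv' : M v = ν • v := by simpa using hv
    have hPv : P v = 0 := by
      have h4 : P (M v) = 0 := by rw [← mul_apply_eq_comp, hPM]; rfl
      rw [hv', map_smul] at h4
      exact (smul_eq_zero.1 h4).resolve_left hν0
    have hgv : g v = (ν + 1) • v := by
      have : M v = g v - v := by simp [hM, hPv]
      rw [this] at hv'
      rw [add_smul, one_smul, ← hv', sub_add_cancel]
    exact hv0 ((K.starProjection_eq_self_iff.2 (hmem _ v hgv)).symm.trans hPv)
  have hM0 : M = 0 := by
    have h1 := IsStarNormal.spectralRadius_eq_nnnorm M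
    have h2 : spectralRadius ℂ M = 0 := by
      rw [spectralRadius]
      simp only [ENNReal.iSup_eq_zero]
      intro ν hν
      simp [hspec ν hν]
    rw [h2] at h1
    simpa using h1.symm
  rw [eq_top_iff]
  intro w _
  have h1 : g (w - P w) = (1 : ℂ) • (w - P w) := by
    have h2 : M w = 0 := by rw [hM0]; rfl
    have h3 : M w = g (w - P w) - (w - P w) := by simp [hM]
    rw [h3, sub_eq_zero] at h2
    rw [h2, one_smul]
  have h4 := K.add_mem (hmem _ _ h1) (K.starProjection_apply_mem w)
  rwa [sub_add_cancel] at h4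

/-- Orthonormal bases of the members of an orthogonal family with dense sum form an orthonormal
basis. -/
theorem exists_hilbertBasis_of_orthogonalFamily {H : Type u} [NormedAddCommGroup H]
    [InnerProductSpace ℂ H] [CompleteSpace H] {ι : Type v} {E : ι → Submodule ℂ H}
    (hE : ∀ i, IsClosed (E i : Set H)) (horth : ∀ i j, i ≠ j → ∀ v ∈ E i, ∀ w ∈ E j,
      inner ℂ v w = 0) (htop : (⨆ i, E i).topologicalClosure = ⊤) :
    ∃ (κ : Type (max u v)) (f : HilbertBasis κ ℂ H) (l : κ → ι), ∀ j, f j ∈ E (l j) := by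
  have hcl : ∀ i, CompleteSpace (E i) := fun i => (hE i).completeSpace_coe
  choose w e he using fun i => exists_hilbertBasis ℂ (E i)
  have hV : OrthogonalFamily ℂ (fun i => E i) fun i => (E i).subtypeₗᵢ := fun i j hij v v' =>
    horth i j hij v v.2 v' v'.2
  let F : (Σ i, w i) → H := fun q => (e q.1 q.2 : H)
  have hFon : Orthonormal ℂ F := hV.orthonormal_sigma_orthonormal fun i => (e i).orthonormal
  have hdense : (Submodule.span ℂ (Set.range F))ᗮ = ⊥ := by
    rw [eq_bot_iff]
    intro x hx
    have hx' : ∀ q, inner ℂ (F q) x = 0 := fun q =>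
      Submodule.inner_right_of_mem_orthogonal (Submodule.subset_span (Set.mem_range_self q)) hx
    have h4 : (⨆ i, E i) ≤ (Submodule.span ℂ {x})ᗮ :=
      iSup_le fun i => mem_orthogonal_of_forall_hilbertBasis (e i) fun j => hx' ⟨i, j⟩
    have h5 := Submodule.topologicalClosure_minimal _ h4 (Submodule.isClosed_orthogonal _)
    rw [htop] at h5
    have h6 := h5 (Submodule.mem_top (x := x))
    rw [Submodule.mem_orthogonal_singleton_iff_inner_left] at h6
    exact inner_self_eq_zero.1 h6
  refine ⟨_, HilbertBasis.mkOfOrthogonalEqBot hFon hdense, fun q => q.1, fun q => ?_⟩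
  rw [HilbertBasis.coe_mkOfOrthogonalEqBot]
  exact (e q.1 q.2).2

/-- A unitary operator that differs from `1` by a compact operator has an orthonormal basis of
eigenvectors. -/
theorem exists_hilbertBasis_eigenvectors {H : Type u} [NormedAddCommGroup H]
    [InnerProductSpace ℂ H] [CompleteSpace H] {g : H →L[ℂ] H} (hu : g ∈ unitary (H →L[ℂ] H))
    (hc : IsCompactOperator (g - 1 : H →L[ℂ] H)) :
    ∃ (κ : Type u) (f : HilbertBasis κ ℂ H) (l : κ → ℂ), ∀ j, g (f j) = l j • f j := by
  have hcl : ∀ μ : ℂ, IsClosed (Module.End.eigenspace (g : H →ₗ[ℂ] H) μ : Set H) := fun μ => by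
    have : (Module.End.eigenspace (g : H →ₗ[ℂ] H) μ : Set H) = {v | g v = μ • v} := by
      ext v; exact Module.End.mem_eigenspace_iff
    rw [this]
    exact isClosed_eq g.continuous (continuous_const_smul μ)
  obtain ⟨κ, f, l, hl⟩ := exists_hilbertBasis_of_orthogonalFamily hcl
    (fun μ ν hne v hv w hw => inner_eq_zero_of_eigen hu (Module.End.mem_eigenspace_iff.1 hv)
      (Module.End.mem_eigenspace_iff.1 hw) hne)
    (topologicalClosure_iSup_eigenspace_eq_top hu hc)
  exact ⟨κ, f, l, fun j => Module.End.mem_eigenspace_iff.1 (hl j)⟩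

end Eigenbasis

/-! ### Contour integrals -/

section ContourIntegrals

theorem exists_mem_Icc_of_strictMono {n : ℕ} {t : Fin (n + 1) → ℝ} {x : ℝ}
    (hx : x ∈ Set.Icc (t 0) (t (Fin.last n))) (hx0 : x ≠ t 0) :
    ∃ i : Fin n, x ∈ Set.Ioc (t i.castSucc) (t i.succ) := by
  induction n with
  | zero => exact absurd (le_antisymm hx.2 hx.1) hx0
  | succ n ih =>
    by_cases h : x ≤ t (Fin.last n).castSucc
    · obtain ⟨i, hi⟩ := ih (t := fun i => t i.castSucc) ⟨hx.1, h⟩ hx0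
      exact ⟨i.castSucc, hi⟩
    · exact ⟨Fin.last n, not_le.1 h, hx.2⟩

theorem IsClosedContour.continuousOn {γ : ℝ → ℂ} (hγ : IsClosedContour γ) :
    ContinuousOn γ (Set.Icc 0 1) := by
  obtain ⟨n, t, ht, h0, h1, hs⟩ := hγ.piecewise
  have hn : n ≠ 0 := by
    rintro rfl
    have : t 0 = t (Fin.last 0) := rfl
    rw [h0, h1] at this
    exact zero_ne_one this
  obtain ⟨m, rfl⟩ := Nat.exists_eq_succ_of_ne_zero hn
  have hcov : Set.Icc (0 : ℝ) 1 ⊆ ⋃ i : Fin (m + 1), Set.Icc (t i.castSucc) (t i.succ) := by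
    intro x hx
    rw [Set.mem_iUnion]
    by_cases hx0 : x = t 0
    · exact ⟨0, by rw [hx0]; exact ⟨le_rfl, (ht (Fin.castSucc_lt_succ (i := 0))).le⟩⟩
    · obtain ⟨i, hi⟩ := exists_mem_Icc_of_strictMono (t := t) (by rwa [h0, h1]) hx0
      exact ⟨i, hi.1.le, hi.2⟩
  exact ((locallyFinite_of_finite _).continuousOn_iUnion (fun _ => isClosed_Icc)
    fun i => (hs i).continuousOn).mono hcov

theorem IsClosedContour.exists_countable_hasDerivAt {γ : ℝ → ℂ} (hγ : IsClosedContour γ) :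
    ∃ s : Set ℝ, s.Countable ∧ ∀ x ∈ Set.Ioo (0 : ℝ) 1 \ s, HasDerivAt γ (deriv γ x) x := by
  obtain ⟨n, t, ht, h0, h1, hs⟩ := hγ.piecewise
  refine ⟨Set.range t, (Set.finite_range t).countable, fun x hx => ?_⟩
  have hne : ∀ i, x ≠ t i := fun i h => hx.2 ⟨i, h.symm⟩
  obtain ⟨i, hi⟩ := exists_mem_Icc_of_strictMono (t := t)
    (by rw [h0, h1]; exact Set.Ioo_subset_Icc_self hx.1) (hne 0)
  have hmem : Set.Icc (t i.castSucc) (t i.succ) ∈ 𝓝 x :=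
    Icc_mem_nhds hi.1 (lt_of_le_of_ne hi.2 (hne _))
  exact (((hs i).contDiffAt hmem).differentiableAt one_ne_zero).hasDerivAt

theorem IsClosedContour.intervalIntegrable_deriv {γ : ℝ → ℂ} (hγ : IsClosedContour γ) :
    IntervalIntegrable (deriv γ) MeasureTheory.volume 0 1 := by
  obtain ⟨n, t, ht, h0, h1, hs⟩ := hγ.piecewise
  have hpiece : ∀ i : Fin n,
      IntervalIntegrable (deriv γ) MeasureTheory.volume (t i.castSucc) (t i.succ) := by
    intro i
    have hlt : t i.castSucc < t i.succ := ht Fin.castSucc_lt_succ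
    have h2 : ContinuousOn (derivWithin γ (Set.Icc (t i.castSucc) (t i.succ)))
        (Set.Icc (t i.castSucc) (t i.succ)) :=
      (hs i).continuousOn_derivWithin (uniqueDiffOn_Icc hlt) le_rfl
    rw [← Set.uIcc_of_le hlt.le] at h2
    refine (h2.intervalIntegrable).congr_ae ?_
    rw [Set.uIoc_of_le hlt.le, Set.uIcc_of_le hlt.le,
      MeasureTheory.Measure.restrict_congr_set MeasureTheory.Ioo_ae_eq_Ioc.symm]
    refine (MeasureTheory.ae_restrict_mem measurableSet_Ioo).mono fun x hx => ?_
    exact derivWithin_of_mem_nhds (Icc_mem_nhds hx.1 hx.2)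
  have hall : ∀ (k : ℕ) (hk : k < n + 1),
      IntervalIntegrable (deriv γ) MeasureTheory.volume (t 0) (t ⟨k, hk⟩) := by
    intro k
    induction k with
    | zero => intro _; exact IntervalIntegrable.refl
    | succ k ih => intro hk; exact (ih (by omega)).trans (hpiece ⟨k, by omega⟩)
  have := hall n (by omega)
  rw [h0] at this
  have h1' : t ⟨n, by omega⟩ = 1 := h1
  rwa [h1'] at this

theorem IsClosedContour.intervalIntegrable_mul_deriv {γ : ℝ → ℂ} (hγ : IsClosedContour γ)
    {w : ℝ → ℂ} (hw : ContinuousOn w (Set.Icc 0 1)) :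
    IntervalIntegrable (fun t => w t * deriv γ t) MeasureTheory.volume 0 1 := by
  rw [← Set.uIcc_of_le zero_le_one] at hw
  exact hγ.intervalIntegrable_deriv.continuousOn_mul hw

/-- The integral over a closed contour of a function with a primitive along the contour. -/
theorem IsClosedContour.contourIntegral_eq_zero {γ : ℝ → ℂ} (hγ : IsClosedContour γ) {F F' : ℂ → ℂ}
    (hF : ∀ t ∈ Set.Icc (0 : ℝ) 1, HasDerivAt F (F' (γ t)) (γ t))
    (hF' : ContinuousOn (fun t => F' (γ t)) (Set.Icc 0 1)) : contourIntegral γ F' = 0 := by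
  obtain ⟨s, hs, hd⟩ := hγ.exists_countable_hasDerivAt
  have h := MeasureTheory.integral_eq_of_hasDerivAt_off_countable_of_le (F ∘ γ)
    (fun t => F' (γ t) * deriv γ t) zero_le_one hs
    (fun t ht => (hF t ht).continuousAt.comp_continuousWithinAt (hγ.continuousOn t ht))
    (fun t ht => (hF t (Set.Ioo_subset_Icc_self ht.1)).comp t (hd t ht))
    (hγ.intervalIntegrable_mul_deriv hF')
  rw [contourIntegral, h, Function.comp_apply, Function.comp_apply, hγ.closed, sub_self]

theorem IsClosedContour.contourIntegral_inv_sq {γ : ℝ → ℂ} (hγ : IsClosedContour γ) {a : ℂ}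
    (ha : ∀ t ∈ Set.Icc (0 : ℝ) 1, γ t ≠ a) :
    contourIntegral γ (fun ξ => ((ξ - a) ^ 2)⁻¹) = 0 := by
  have hne : ∀ t ∈ Set.Icc (0 : ℝ) 1, γ t - a ≠ 0 := fun t ht => sub_ne_zero.2 (ha t ht)
  refine hγ.contourIntegral_eq_zero (F := fun ξ => -(ξ - a)⁻¹) (fun t ht => ?_)
    (((hγ.continuousOn.sub continuousOn_const).pow 2).inv₀ fun t ht => pow_ne_zero 2 (hne t ht))
  have h : HasDerivAt (fun ξ => -(ξ - a)⁻¹) (-(-1 / (γ t - a) ^ 2)) (γ t) :=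
    (((hasDerivAt_id (γ t)).sub_const a).inv (hne t ht)).neg
  rwa [neg_div, neg_neg, one_div] at h

theorem contourIntegral_inv_eq {γ : ℝ → ℂ} (a : ℂ) :
    contourIntegral γ (fun ξ => (ξ - a)⁻¹) = 2 * Real.pi * Complex.I * contourWinding γ a := by
  rw [contourWinding, ← mul_assoc, mul_inv_cancel₀ (by simp), one_mul]

/-- The partial fraction decomposition of
`(ξ - a)⁻¹ (ξ - b)⁻² - (ξ - b)⁻¹ (ξ - a)⁻²`, integrated over a contour. Both sides vanish if
`a = b`. -/
theorem IsClosedContour.contourIntegral_partialFractions {γ : ℝ → ℂ} (hγ : IsClosedContour γ)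
    {a b : ℂ} (ha : ∀ t ∈ Set.Icc (0 : ℝ) 1, γ t ≠ a) (hb : ∀ t ∈ Set.Icc (0 : ℝ) 1, γ t ≠ b) :
    contourIntegral γ (fun ξ => (ξ - a)⁻¹ * ((ξ - b)⁻¹) ^ 2 - (ξ - b)⁻¹ * ((ξ - a)⁻¹) ^ 2) =
      4 * Real.pi * Complex.I * ((contourWinding γ a - contourWinding γ b) / (a - b) ^ 2) := by
  by_cases hab : a = b
  · subst hab
    simp [contourIntegral]
  have hd : a - b ≠ 0 := sub_ne_zero.2 hab
  have hne : ∀ t ∈ Set.Icc (0 : ℝ) 1, γ t - a ≠ 0 := fun t ht => sub_ne_zero.2 (ha t ht)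
  have hne' : ∀ t ∈ Set.Icc (0 : ℝ) 1, γ t - b ≠ 0 := fun t ht => sub_ne_zero.2 (hb t ht)
  have c1 : ∀ c : ℂ, (∀ t ∈ Set.Icc (0 : ℝ) 1, γ t - c ≠ 0) →
      IntervalIntegrable (fun t => (γ t - c)⁻¹ * deriv γ t) MeasureTheory.volume 0 1 := fun c hc =>
    hγ.intervalIntegrable_mul_deriv ((hγ.continuousOn.sub continuousOn_const).inv₀ hc)
  have c2 : ∀ c : ℂ, (∀ t ∈ Set.Icc (0 : ℝ) 1, γ t - c ≠ 0) →
      IntervalIntegrable (fun t => ((γ t - c) ^ 2)⁻¹ * deriv γ t) MeasureTheory.volume 0 1 :=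
    fun c hc => hγ.intervalIntegrable_mul_deriv
      (((hγ.continuousOn.sub continuousOn_const).pow 2).inv₀ fun t ht => pow_ne_zero 2 (hc t ht))
  have h1 : contourIntegral γ
      (fun ξ => (ξ - a)⁻¹ * ((ξ - b)⁻¹) ^ 2 - (ξ - b)⁻¹ * ((ξ - a)⁻¹) ^ 2) =
      ∫ t in (0 : ℝ)..1,
        (2 / (a - b) ^ 2 * ((γ t - a)⁻¹ * deriv γ t - (γ t - b)⁻¹ * deriv γ t) -
        (a - b)⁻¹ * (((γ t - a) ^ 2)⁻¹ * deriv γ t + ((γ t - b) ^ 2)⁻¹ * deriv γ t)) := by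
    refine intervalIntegral.integral_congr fun t ht => ?_
    rw [Set.uIcc_of_le zero_le_one] at ht
    have h2 := hne t ht
    have h3 := hne' t ht
    beta_reduce
    field_simp
    ring
  rw [h1, intervalIntegral.integral_sub ((((c1 a hne).sub (c1 b hne')).const_mul _))
    (((c2 a hne).add (c2 b hne')).const_mul _), intervalIntegral.integral_const_mul,
    intervalIntegral.integral_const_mul, intervalIntegral.integral_sub (c1 a hne) (c1 b hne'),
    intervalIntegral.integral_add (c2 a hne) (c2 b hne')]
  have e1 := contourIntegral_inv_eq (γ := γ) a
  have e2 := contourIntegral_inv_eq (γ := γ) b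
  have e3 := hγ.contourIntegral_inv_sq ha
  have e4 := hγ.contourIntegral_inv_sq hb
  rw [contourIntegral] at e1 e2 e3 e4
  rw [e1, e2, e3, e4]
  ring

/-- Integration along a contour of a series with absolutely summable coefficients and uniformly
bounded terms. -/
theorem IsClosedContour.contourIntegral_tsum {γ : ℝ → ℂ} (hγ : IsClosedContour γ) {Q : Type*}
    {a : Q → ℂ} (ha : Summable fun q => ‖a q‖) {φ : Q → ℂ → ℂ} {C : ℝ}
    (hφ : ∀ q, ContinuousOn (fun t => φ q (γ t)) (Set.Icc 0 1))
    (hC : ∀ q, ∀ t ∈ Set.Icc (0 : ℝ) 1, ‖φ q (γ t)‖ ≤ C) :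
    IntervalIntegrable (fun t => (∑' q, a q * φ q (γ t)) * deriv γ t) MeasureTheory.volume 0 1 ∧
      contourIntegral γ (fun ξ => ∑' q, a q * φ q ξ) = ∑' q, a q * contourIntegral γ (φ q) := by
  have hb : ∀ q, ∀ t ∈ Set.Icc (0 : ℝ) 1, ‖a q * φ q (γ t)‖ ≤ ‖a q‖ * C := fun q t ht => by
    rw [norm_mul]
    exact mul_le_mul_of_nonneg_left (hC q t ht) (norm_nonneg _)
  have hcont : ContinuousOn (fun t => ∑' q, a q * φ q (γ t)) (Set.Icc 0 1) :=
    continuousOn_tsum (fun q => continuousOn_const.mul (hφ q)) (ha.mul_right C) hb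
  refine ⟨hγ.intervalIntegrable_mul_deriv hcont, ?_⟩
  -- only countably many coefficients are nonzero
  have hcount : Countable (Function.support fun q => ‖a q‖) := ha.countable_support
  set s := Function.support fun q => ‖a q‖ with hs
  have hsub : ∀ b : Q → ℂ, ∑' q, a q * b q = ∑' q : s, a q * b q := fun b =>
    (tsum_subtype_eq_of_support_subset fun q hq => by
      rw [hs, Function.mem_support, norm_ne_zero_iff]
      exact left_ne_zero_of_mul hq).symm
  have has : Summable fun q : s => ‖a q‖ := ha.subtype s
  have hu : Set.uIoc (0 : ℝ) 1 ⊆ Set.Icc 0 1 := by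
    rw [Set.uIoc_of_le zero_le_one]; exact Set.Ioc_subset_Icc_self
  rw [hsub, contourIntegral]
  have hint : ∀ q : s, IntervalIntegrable (fun t => a q * φ q (γ t) * deriv γ t)
      MeasureTheory.volume 0 1 := fun q =>
    hγ.intervalIntegrable_mul_deriv (continuousOn_const.mul (hφ q))
  have h := intervalIntegral.hasSum_integral_of_dominated_convergence
    (μ := MeasureTheory.volume) (a := 0) (b := 1)
    (F := fun (q : s) t => a q * φ q (γ t) * deriv γ t)
    (f := fun t => (∑' q, a q * φ q (γ t)) * deriv γ t)
    (fun q t => ‖a q‖ * C * ‖deriv γ t‖) (fun q => (hint q).def'.aestronglyMeasurable)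
    (fun q => Filter.Eventually.of_forall fun t ht => by
      rw [norm_mul]
      exact mul_le_mul_of_nonneg_right (hb q t (hu ht)) (norm_nonneg _))
    (Filter.Eventually.of_forall fun t _ => (has.mul_right C).mul_right _)
    (by
      simp only [tsum_mul_right]
      exact hγ.intervalIntegrable_deriv.norm.const_mul _)
    (Filter.Eventually.of_forall fun t ht => by
      have h1 : Summable fun q : s => a q * φ q (γ t) :=
        Summable.of_norm_bounded (has.mul_right C) fun q => hb q t (hu ht)
      have h2 := h1.hasSum.mul_right (deriv γ t)
      have h3 : ∑' q, a q * φ q (γ t) = ∑' q : s, a q * φ q (γ t) := hsub fun q => φ q (γ t)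
      rwa [← h3] at h2)
  rw [← h.tsum_eq]
  refine tsum_congr fun q => ?_
  rw [contourIntegral, ← intervalIntegral.integral_const_mul]
  simp only [mul_assoc]

end ContourIntegrals

/-! ### The contour integral formula -/

section Formula

variable {H : Type*} [NormedAddCommGroup H] [InnerProductSpace ℂ H] [CompleteSpace H]

theorem summable_inner_mul_diag {κ : Type*} (b : HilbertBasis κ ℂ H) {A B : H →L[ℂ] H}
    (hA : IsHilbertSchmidt A) (hB : IsHilbertSchmidt B) :
    Summable fun i => inner ℂ (b i) ((A * B) (b i)) := by
  have hs : Summable fun q : κ × κ =>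
      inner ℂ (b q.1) (A (b q.2)) * inner ℂ (b q.2) (B (b q.1)) := by
    refine Summable.of_norm ?_
    simpa only [norm_mul] using hA.summable_inner_mul b b hB
  refine hs.prod.congr fun i => ?_
  have h := b.tsum_inner_mul_inner (ContinuousLinearMap.adjoint A (b i)) (B (b i))
  simp only [ContinuousLinearMap.adjoint_inner_left] at h
  exact h

/-- The trace of a difference of products, as a double series in any orthonormal basis. -/
theorem opTrace_mul_sub_mul {κ κ' : Type*} (b : HilbertBasis κ ℂ H) (f : HilbertBasis κ' ℂ H)
    {A B C D : H →L[ℂ] H} (hA : IsHilbertSchmidt A) (hB : IsHilbertSchmidt B)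
    (hC : IsHilbertSchmidt C) (hD : IsHilbertSchmidt D) :
    opTrace b (A * B - C * D) =
      ∑' q : κ' × κ', (inner ℂ (f q.1) (A (f q.2)) * inner ℂ (f q.2) (B (f q.1)) -
        inner ℂ (f q.2) (C (f q.1)) * inner ℂ (f q.1) (D (f q.2))) := by
  have hs : ∀ {S T : H →L[ℂ] H}, IsHilbertSchmidt S → IsHilbertSchmidt T →
      Summable fun q : κ' × κ' =>
        inner ℂ (f q.1) (S (f q.2)) * inner ℂ (f q.2) (T (f q.1)) := fun hS hT => by
    refine Summable.of_norm ?_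
    simpa only [norm_mul] using hS.summable_inner_mul f f hT
  have h1 : opTrace b (A * B - C * D) = opTrace b (A * B) - opTrace b (C * D) := by
    rw [opTrace, opTrace, opTrace, ← (summable_inner_mul_diag b hA hB).tsum_sub
      (summable_inner_mul_diag b hC hD)]
    simp
  have h2 : Summable fun q : κ' × κ' =>
      inner ℂ (f q.2) (C (f q.1)) * inner ℂ (f q.1) (D (f q.2)) :=
    (Equiv.prodComm κ' κ').summable_iff.2 (hs hC hD)
  have h3 : ∑' q : κ' × κ', inner ℂ (f q.2) (C (f q.1)) * inner ℂ (f q.1) (D (f q.2)) =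
      ∑' q : κ' × κ', inner ℂ (f q.1) (C (f q.2)) * inner ℂ (f q.2) (D (f q.1)) :=
    (Equiv.prodComm κ' κ').tsum_eq
      (fun q => inner ℂ (f q.1) (C (f q.2)) * inner ℂ (f q.2) (D (f q.1)))
  rw [h1, opTrace_mul_eq_tsum_basis b f hA hB, opTrace_mul_eq_tsum_basis b f hC hD,
    (hs hA hB).tsum_sub h2, h3]

theorem inner_resolvent_apply_of_eigen {g : H →L[ℂ] H} (hu : g ∈ unitary (H →L[ℂ] H)) {μ ξ : ℂ}
    {v : H} (hv : g v = μ • v) (hξ : ξ ∉ spectrum ℂ g) (hne : ξ ≠ μ) (w : H) :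
    inner ℂ v (resolvent g ξ w) = (ξ - μ)⁻¹ * inner ℂ v w := by
  have h1 : (ξ • 1 - g) (resolvent g ξ w) = w := by
    rw [← mul_apply_eq_comp, sub_mul_resolvent hξ]; rfl
  have h2 : inner ℂ v ((ξ • 1 - g) (resolvent g ξ w)) =
      (ξ - μ) * inner ℂ v (resolvent g ξ w) := by
    rw [sub_apply, inner_sub_right, inner_apply_of_eigen hu hv, smul_apply, inner_smul_right,
      sub_mul]
    rfl
  rw [h1] at h2
  rw [h2, ← mul_assoc, inv_mul_cancel₀ (sub_ne_zero.2 hne), one_mul]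

/-- The matrix of `dP` in an eigenbasis of `g`, from the derivatives of `P g = g P` and `P² = P`.
If the two eigenvalues coincide, then `p = q`, and both sides vanish. -/
theorem inner_dProj_of_eigen {g P X D : H →L[ℂ] H} (hu : g ∈ unitary (H →L[ℂ] H))
    (hPs : IsSelfAdjoint P) (h1 : P * X + D * g = g * D + X * P) (h2 : P * D + D * P = D)
    {v w : H} {μ ν : ℂ} {p q : ℂ} (hv : g v = μ • v) (hw : g w = ν • w) (hPv : P v = p • v)
    (hPw : P w = q • w) (hp : p = 0 ∨ p = 1) (hq : q = 0 ∨ q = 1) (hpq : μ = ν → p = q) :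
    inner ℂ v (D w) = (p - q) / (μ - ν) * inner ℂ v (X w) := by
  have hPl : ∀ z, inner ℂ v (P z) = p * inner ℂ v z := fun z => by
    have h3 : inner ℂ v (P z) = inner ℂ (P v) z := by
      rw [← ContinuousLinearMap.adjoint_inner_left, ← ContinuousLinearMap.star_eq_adjoint,
        hPs.star_eq]
    rw [h3, hPv, inner_smul_left]
    rcases hp with h | h <;> simp [h]
  have e1 : inner ℂ v ((P * X + D * g) w) = inner ℂ v ((g * D + X * P) w) := by rw [h1]
  have e2 : inner ℂ v ((P * D + D * P) w) = inner ℂ v (D w) := by rw [h2]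
  simp only [add_apply, mul_apply_eq_comp, inner_add_right, hPl, hw, hPw, map_smul,
    inner_smul_right, inner_apply_of_eigen hu hv] at e1 e2
  by_cases hμν : μ = ν
  · have h4 := hpq hμν
    rw [h4, sub_self, zero_div, zero_mul]
    rcases hq with h | h <;> simp only [h4, h] at e2
    · simpa using e2.symm
    · linear_combination e2
  · have h5 : μ - ν ≠ 0 := sub_ne_zero.2 hμν
    field_simp
    linear_combination -e1

variable {V : Type*} [NormedAddCommGroup V] [NormedSpace ℝ V] {ι : V →L[ℝ] (H →L[ℂ] H)}
  {z₁ z₂ : ℂ} {g : H →L[ℂ] H}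

theorem fibreProj_apply_of_eigen (hu : g ∈ unitary (H →L[ℂ] H)) {μ : ℂ} {v : H}
    (hv : g v = μ • v) [Decidable (RotGT z₁ μ ∧ RotGT μ z₂)] :
    fibreProj (z₁, z₂, g) v = (if RotGT z₁ μ ∧ RotGT μ z₂ then (1 : ℂ) else 0) • v := by
  split_ifs with h
  · rw [one_smul, fibreProj, Submodule.starProjection_eq_self_iff]
    exact Submodule.le_topologicalClosure _
      (Submodule.mem_iSup_of_mem ⟨μ, h⟩ (Module.End.mem_eigenspace_iff.2 hv))
  · rw [zero_smul, fibreProj, Submodule.starProjection_apply_eq_zero_iff]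
    have h1 : fibre (z₁, z₂, g) ≤ (Submodule.span ℂ {v})ᗮ := iSup_le fun ν w hw => by
      rw [Submodule.mem_orthogonal_singleton_iff_inner_left]
      refine inner_eq_zero_of_eigen hu (Module.End.mem_eigenspace_iff.1 hw) hv ?_
      intro hνμ
      exact h (hνμ ▸ ν.2)
    have h2 := Submodule.topologicalClosure_minimal _ h1 (Submodule.isClosed_orthogonal _)
    rw [Submodule.mem_orthogonal]
    intro w hw
    exact Submodule.mem_orthogonal_singleton_iff_inner_left.1 (h2 hw)

theorem dProj_relations (hskew : ∀ X, star (ι X) = -ι X)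
    (hHS : ∀ X, IsHilbertSchmidt (ι X)) (hg : g ∈ unitary (H →L[ℂ] H))
    (hg1 : IsHilbertSchmidt (g - 1)) (hy : IsPositivePoint z₁ z₂ g) (u : ℝ × ℝ × V) :
    fibreProj (z₁, z₂, g) * dGrp ι (z₁, z₂, g) u + dProj ι (z₁, z₂, g) u * g =
      g * dProj ι (z₁, z₂, g) u + dGrp ι (z₁, z₂, g) u * fibreProj (z₁, z₂, g) ∧
    fibreProj (z₁, z₂, g) * dProj ι (z₁, z₂, g) u + dProj ι (z₁, z₂, g) u * fibreProj (z₁, z₂, g) =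
      dProj ι (z₁, z₂, g) u := by
  have hev := eventually_contDiffAt_fibreProj hskew hHS hg hg1 hy
  set P : ℝ × ℝ × V → H →L[ℂ] H := fun x => fibreProj (expChart ι (z₁, z₂, g) x) with hP
  set h : ℝ × ℝ × V → H →L[ℂ] H := fun x => (expChart ι (z₁, z₂, g) x).2.2 with hh
  have hPd : DifferentiableAt ℝ P 0 := hev.self_of_nhds.1.differentiableAt (by simp)
  have hhd : DifferentiableAt ℝ h 0 :=
    (contDiff_expChart_grp ι (z₁, z₂, g)).contDiffAt.differentiableAt (by simp)
  have hP0 : P 0 = fibreProj (z₁, z₂, g) := by rw [hP]; simp only [expChart_zero]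
  have hh0 : h 0 = g := by rw [hh]; simp only [expChart_zero]
  have e1 := fderiv_bilinear_of_eventuallyEq (h := fun x => P x * h x) (compBilin H H H) hPd hhd
    (Filter.Eventually.of_forall fun _ => rfl) u
  have e2 := fderiv_bilinear_of_eventuallyEq (h := fun x => P x * h x) (compBilin H H H) hhd hPd
    (hev.mono fun x hx => hx.2.2) u
  have e3 := fderiv_bilinear_of_eventuallyEq (h := P) (compBilin H H H) hPd hPd
    (Filter.Eventually.of_forall fun x => (isIdempotentElem_fibreProj _).symm) u
  rw [hP0] at e1 e2 e3
  rw [hh0] at e1 e2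
  exact ⟨e1.trans e2.symm, e3⟩

theorem isHilbertSchmidt_fibreProj (hskew : ∀ X, star (ι X) = -ι X)
    (hHS : ∀ X, IsHilbertSchmidt (ι X)) (hg : g ∈ unitary (H →L[ℂ] H))
    (hg1 : IsHilbertSchmidt (g - 1)) (hy : IsPositivePoint z₁ z₂ g) :
    IsHilbertSchmidt (fibreProj (z₁, z₂, g)) := by
  have h := (eventually_contDiffAt_fibreProj hskew hHS hg hg1 hy).self_of_nhds.2.1
  rwa [expChart_zero] at h

theorem isHilbertSchmidt_dGrp (hHS : ∀ X, IsHilbertSchmidt (ι X)) (u : ℝ × ℝ × V) :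
    IsHilbertSchmidt (dGrp ι (z₁, z₂, g) u) := by
  rw [dGrp_eq]
  exact (hHS _).mul_left _

theorem isHilbertSchmidt_dProj (hskew : ∀ X, star (ι X) = -ι X)
    (hHS : ∀ X, IsHilbertSchmidt (ι X)) (hg : g ∈ unitary (H →L[ℂ] H))
    (hg1 : IsHilbertSchmidt (g - 1)) (hy : IsPositivePoint z₁ z₂ g) (u : ℝ × ℝ × V) :
    IsHilbertSchmidt (dProj ι (z₁, z₂, g) u) := by
  have hP := isHilbertSchmidt_fibreProj hskew hHS hg hg1 hy
  rw [← (dProj_relations hskew hHS hg hg1 hy u).2]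
  exact (hP.mul_right _).add (hP.mul_left _)

theorem resolventForm_eq (y : ℂ × ℂ × (H →L[ℂ] H)) (ξ : ℂ) (u v : ℝ × ℝ × V) :
    resolventForm ι y ξ u v =
      (resolvent y.2.2 ξ * dGrp ι y u) * (resolvent y.2.2 ξ ^ 2 * dGrp ι y v) -
        (resolvent y.2.2 ξ * dGrp ι y v) * (resolvent y.2.2 ξ ^ 2 * dGrp ι y u) := by
  rw [resolventForm]
  noncomm_ring

/-- In an eigenbasis of `g` with eigenvalues `lⱼ`, and with `pⱼ = 1` if `lⱼ` is between `z₁` and `z₂`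
and `pⱼ = 0` otherwise, both `tr (P dP dP)` and the contour integral are the double series with
terms `(pⱼ - pₖ) (lⱼ - lₖ)⁻² dg(u)ⱼₖ dg(v)ₖⱼ`. For the contour integral `pⱼ` arises as the winding
number about `lⱼ`. -/
theorem curvatureFormulaAt_of_isHilbertSchmidt {κ : Type*} (b : HilbertBasis κ ℂ H)
    (hskew : ∀ X, star (ι X) = -ι X) (hHS : ∀ X, IsHilbertSchmidt (ι X))
    (hg : g ∈ unitary (H →L[ℂ] H)) (hg1 : IsHilbertSchmidt (g - 1))
    (hy : IsPositivePoint z₁ z₂ g) {γ : ℝ → ℂ} (hγ : Encloses γ z₁ z₂ g) :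
    CurvatureFormulaAt ι b (z₁, z₂, g) γ := by
  classical
  refine ⟨(eventually_contDiffAt_fibreProj hskew hHS hg hg1 hy).self_of_nhds.1,
    isDetCurvature_opTrace_projForm b hskew hHS hg hg1 hy, fun u v => ?_⟩
  have hP := isHilbertSchmidt_fibreProj hskew hHS hg hg1 hy
  have hDu := isHilbertSchmidt_dProj hskew hHS hg hg1 hy u
  have hDv := isHilbertSchmidt_dProj hskew hHS hg hg1 hy v
  have hXu : IsHilbertSchmidt (dGrp ι (z₁, z₂, g) u) := isHilbertSchmidt_dGrp hHS u
  have hXv : IsHilbertSchmidt (dGrp ι (z₁, z₂, g) v) := isHilbertSchmidt_dGrp hHS v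
  have hrel := dProj_relations hskew hHS hg hg1 hy
  refine ⟨?_, fun ξ _ => ?_, ?_⟩
  · exact ((hP.mul_right _).isTraceClass_mul hDv).sub ((hP.mul_right _).isTraceClass_mul hDu)
  · rw [resolventForm_eq]
    exact ((hXu.mul_left _).isTraceClass_mul (hXv.mul_left _)).sub
      ((hXv.mul_left _).isTraceClass_mul (hXu.mul_left _))
  obtain ⟨κ', f, l, hf⟩ := exists_hilbertBasis_eigenvectors hg hg1.isCompactOperator
  have hl : ∀ j, l j ∈ spectrum ℂ g := fun j =>
    mem_spectrum_of_eigen (hf j) (norm_ne_zero_iff.1 (by rw [f.orthonormal.1 j]; exact one_ne_zero))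
  let p : κ' → ℂ := fun j => if RotGT z₁ (l j) ∧ RotGT (l j) z₂ then 1 else 0
  have hpf : ∀ j, fibreProj (z₁, z₂, g) (f j) = p j • f j := fun j =>
    fibreProj_apply_of_eigen hg (hf j)
  have hp01 : ∀ j, p j = 0 ∨ p j = 1 := fun j => by
    by_cases h : RotGT z₁ (l j) ∧ RotGT (l j) z₂ <;> simp [p, h]
  have hpl : ∀ i j, l i = l j → p i = p j := fun i j h => by simp only [p, h]
  have hpw : ∀ j, contourWinding γ (l j) = p j := fun j => by
    by_cases h : RotGT z₁ (l j) ∧ RotGT (l j) z₂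
    · rw [hγ.winding_one _ (hl j) h]; simp [p, h]
    · rw [hγ.winding_zero _ (hl j) h]; simp only [p, h, if_false]
  have hPs : IsSelfAdjoint (fibreProj (z₁, z₂, g)) := isSelfAdjoint_starProjection _
  have hD : ∀ w i j, inner ℂ (f i) (dProj ι (z₁, z₂, g) w (f j)) =
      (p i - p j) / (l i - l j) * inner ℂ (f i) (dGrp ι (z₁, z₂, g) w (f j)) := fun w i j =>
    inner_dProj_of_eigen hg hPs (hrel w).1 (hrel w).2 (hf i) (hf j) (hpf i) (hpf j) (hp01 i)
      (hp01 j) (hpl i j)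
  set X := dGrp ι (z₁, z₂, g) u with hX
  set Y := dGrp ι (z₁, z₂, g) v with hY
  let a : κ' × κ' → ℂ := fun q => inner ℂ (f q.1) (X (f q.2)) * inner ℂ (f q.2) (Y (f q.1))
  have ha : Summable fun q => ‖a q‖ := by
    simpa only [a, norm_mul] using hXu.summable_inner_mul f f hXv
  -- the trace of `P dP dP`
  have hPl : ∀ i z, inner ℂ (f i) (fibreProj (z₁, z₂, g) z) = p i * inner ℂ (f i) z := fun i z => by
    have h3 : inner ℂ (f i) (fibreProj (z₁, z₂, g) z) =
        inner ℂ (fibreProj (z₁, z₂, g) (f i)) z := by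
      rw [← ContinuousLinearMap.adjoint_inner_left, ← ContinuousLinearMap.star_eq_adjoint,
        hPs.star_eq]
    rw [h3, hpf, inner_smul_left]
    rcases hp01 i with h | h <;> simp [h]
  have hleft : opTrace b (projForm ι (z₁, z₂, g) u v) =
      ∑' q, a q * ((p q.1 - p q.2) / (l q.1 - l q.2) ^ 2) := by
    rw [projForm, opTrace_mul_sub_mul b f (hP.mul_right _) hDv (hP.mul_right _) hDu]
    refine tsum_congr fun q => ?_
    simp only [mul_apply_eq_comp, hPl, hD, a]
    have h4 : (p q.1 - p q.2) ^ 3 = p q.1 - p q.2 := by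
      rcases hp01 q.1 with h | h <;> rcases hp01 q.2 with h' | h' <;> rw [h, h'] <;> norm_num
    by_cases h5 : l q.1 = l q.2
    · rw [hpl _ _ h5]; simp
    · have h6 : l q.1 - l q.2 ≠ 0 := sub_ne_zero.2 h5
      have h7 : (p q.2 - p q.1) / (l q.2 - l q.1) = (p q.1 - p q.2) / (l q.1 - l q.2) := by
        rw [← neg_sub (p q.1), ← neg_sub (l q.1), neg_div_neg_eq]
      rw [h7]
      field_simp
      linear_combination (inner ℂ (f q.1) (X (f q.2)) * inner ℂ (f q.2) (Y (f q.1))) * h4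
  -- the trace of the resolvent form
  let φ : κ' × κ' → ℂ → ℂ := fun q ξ =>
    (ξ - l q.1)⁻¹ * ((ξ - l q.2)⁻¹) ^ 2 - (ξ - l q.2)⁻¹ * ((ξ - l q.1)⁻¹) ^ 2
  have hne : ∀ {ξ}, ξ ∉ spectrum ℂ g → ∀ j, ξ ≠ l j := fun hξ j h => hξ (h ▸ hl j)
  have hright : ∀ ξ ∉ spectrum ℂ g, opTrace b (resolventForm ι (z₁, z₂, g) ξ u v) =
      ∑' q, a q * φ q ξ := by
    intro ξ hξ
    have hR : ∀ j z, inner ℂ (f j) (resolvent g ξ z) = (ξ - l j)⁻¹ * inner ℂ (f j) z := fun j z =>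
      inner_resolvent_apply_of_eigen hg (hf j) hξ (hne hξ j) z
    rw [resolventForm_eq, opTrace_mul_sub_mul b f (hXu.mul_left _) (hXv.mul_left _)
      (hXv.mul_left _) (hXu.mul_left _)]
    refine tsum_congr fun q => ?_
    simp only [pow_two, mul_apply_eq_comp, hR, a, φ]
    ring
  have hγne : ∀ j, ∀ t ∈ Set.Icc (0 : ℝ) 1, γ t ≠ l j := fun j t ht => hne (hγ.notMem t ht) j
  have hγinv : ∀ j, ContinuousOn (fun t => (γ t - l j)⁻¹) (Set.Icc 0 1) := fun j =>
    (hγ.isClosedContour.continuousOn.sub continuousOn_const).inv₀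
      fun t ht => sub_ne_zero.2 (hγne j t ht)
  -- the resolvent is bounded along the contour, and bounds the numbers `(ξ - lⱼ)⁻¹`
  obtain ⟨C, hC⟩ : ∃ C, ∀ t ∈ Set.Icc (0 : ℝ) 1, ‖resolvent g (γ t)‖ ≤ C := by
    have h1 : ContinuousOn (fun t => resolvent g (γ t)) (Set.Icc 0 1) := fun t ht =>
      (spectrum.hasDerivAt_resolvent_const_left
        (spectrum.notMem_iff.1 (hγ.notMem t ht))).continuousAt.comp_continuousWithinAt
        (hγ.isClosedContour.continuousOn t ht)
    exact isCompact_Icc.exists_bound_of_continuousOn h1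
  have hCl : ∀ j, ∀ t ∈ Set.Icc (0 : ℝ) 1, ‖(γ t - l j)⁻¹‖ ≤ C := fun j t ht => by
    have h1 := (resolvent g (γ t)).le_opNorm (f j)
    rw [resolvent_apply_of_eigen (hγ.notMem t ht) (hf j) (hγne j t ht), norm_smul,
      f.orthonormal.1 j, mul_one, mul_one] at h1
    exact h1.trans (hC t ht)
  have hφC : ∀ q, ∀ t ∈ Set.Icc (0 : ℝ) 1, ‖φ q (γ t)‖ ≤ C * C ^ 2 + C * C ^ 2 := by
    intro q t ht
    have h1 := hCl q.1 t ht
    have h2 := hCl q.2 t ht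
    have h3 : 0 ≤ C := (norm_nonneg _).trans h1
    refine (norm_sub_le _ _).trans ?_
    rw [norm_mul, norm_mul, norm_pow, norm_pow]
    gcongr
  have hφc : ∀ q, ContinuousOn (fun t => φ q (γ t)) (Set.Icc 0 1) := fun q =>
    ((hγinv q.1).mul ((hγinv q.2).pow 2)).sub ((hγinv q.2).mul ((hγinv q.1).pow 2))
  obtain ⟨hint, hsum⟩ := hγ.isClosedContour.contourIntegral_tsum ha hφc hφC
  have hoff : ∀ t ∈ Set.Icc (0 : ℝ) 1, opTrace b (resolventForm ι (z₁, z₂, g) (γ t) u v) =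
      ∑' q, a q * φ q (γ t) := fun t ht => hright _ (hγ.notMem t ht)
  constructor
  · refine hint.congr fun t ht => ?_
    rw [Set.uIoc_of_le zero_le_one] at ht
    rw [hoff t (Set.Ioc_subset_Icc_self ht)]
  · have h1 : contourIntegral γ (fun ξ => opTrace b (resolventForm ι (z₁, z₂, g) ξ u v)) =
        contourIntegral γ fun ξ => ∑' q, a q * φ q ξ := by
      refine intervalIntegral.integral_congr fun t ht => ?_
      rw [Set.uIcc_of_le zero_le_one] at ht
      beta_reduce
      rw [hoff t ht]
    rw [h1, hsum, hleft, ← tsum_mul_left]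
    refine tsum_congr fun q => ?_
    rw [hγ.isClosedContour.contourIntegral_partialFractions (hγne q.1) (hγne q.2), hpw, hpw]
    have h2 : (4 * Real.pi * Complex.I : ℂ) ≠ 0 := by simp
    rw [mul_left_comm, inv_mul_cancel_left₀ h2]

theorem star_unitaryLieIncl (X : unitaryLie H) :
    star (unitaryLieIncl H X) = -unitaryLieIncl H X :=
  skewAdjoint.mem_iff.1 X.2

theorem schattenLieIncl_apply (p : ℝ) [Fact (1 ≤ p)] (X : schattenLie H p) :
    schattenLieIncl H p X = SchattenClass.toOp p (X : SchattenClass H p) := rfl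

theorem star_schattenLieIncl (p : ℝ) [Fact (1 ≤ p)] (X : schattenLie H p) :
    star (schattenLieIncl H p X) = -schattenLieIncl H p X := by
  rw [schattenLieIncl_apply]
  exact X.2

end Formula

theorem mainTheorem4 {H : Type*} [NormedAddCommGroup H] [InnerProductSpace ℂ H] [CompleteSpace H]
    {κ : Type*} (b : HilbertBasis κ ℂ H) (z₁ z₂ : ℂ) (g : H →L[ℂ] H)
    (hy : IsPositivePoint z₁ z₂ g) (γ : ℝ → ℂ) (hγ : Encloses γ z₁ z₂ g) :
    (FiniteDimensional ℂ H → g ∈ unitary (H →L[ℂ] H) →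
      CurvatureFormulaAt (unitaryLieIncl H) b (z₁, z₂, g) γ) ∧
    (TopologicalSpace.SeparableSpace H → ∀ (p : ℝ) [Fact (1 ≤ p)], p ≤ 2 →
      g ∈ schattenUnitary H p →
      CurvatureFormulaAt (schattenLieIncl H p) b (z₁, z₂, g) γ) := by
  refine ⟨fun _ hg => ?_, fun _ p hp1 hp2 hg => ?_⟩
  · exact curvatureFormulaAt_of_isHilbertSchmidt b star_unitaryLieIncl
      (fun X => isHilbertSchmidt_of_finiteDimensional _) hg
      (isHilbertSchmidt_of_finiteDimensional _) hy hγ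
  · refine curvatureFormulaAt_of_isHilbertSchmidt b (star_schattenLieIncl p) (fun X => ?_) hg.1
      (hg.2.two_of_le hp1.out hp2).isHilbertSchmidt hy hγ
    rw [schattenLieIncl_apply]
    exact ((SchattenClass.isSchatten p _).two_of_le hp1.out hp2).isHilbertSchmidt
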